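/- Let $n\ge 2$ and $p>1$, and let $\mathbb H^n$ be the $n$-dimensional hyperbolic space (of constant curvature $-1$). For a compact set $K\subset\mathbb H^n$ let $$\mathrm{Cap}_p(K)=\inf\int_{\mathbb H^n}|\nabla f|^p\,dv,$$ the infimum being taken over all smooth functions $f$ on $\mathbb H^n$ with compact support and $f=1$ on $K$. For a compact $K$ with smooth boundary $M=\partial K$ let $d\mu$ be the Riemannian area element of $M$ and let $\sigma_i$ be the $i$th mean curvature of $M$, i.e. the $i$th elementary symmetric function of the principal curvatures of $M$ with respect to the outward unit normal ($\sigma_0=1$; the sign is such that geodesic spheres have positive principal curvatures). If $K\subset\mathbb H^n$ is compact and (geodesically) convex with smooth boundary $M=\partial K$, then $$\mathrm{Cap}_p(K)\le\left(\int_0^\infty\left(\int_M\sum_{i=0}^{n-1}\cosh^{n-1-i}t\,\sinh^i t\;\sigma_i\,d\mu\right)^{-\frac1{p-1}}dt\right)^{1-p}.$$ Moreover, equality holds if $K$ is a closed geodesic ball of positive radius. -/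

import Mathlib

open scoped ContDiff Topology ENNReal

noncomputable section

namespace HypCap

/-- Euclidean space of dimension `k`. -/
abbrev E (k : ℕ) : Type := EuclideanSpace ℝ (Fin k)

/-- The vector space underlying Minkowski space `ℝ^{n,1}`; the last coordinate is `x.2`. -/
abbrev Mink (n : ℕ) : Type := E n × ℝ

/-- The Lorentz inner product `x₁y₁ + ⋯ + xₙyₙ - xₙ₊₁yₙ₊₁`. -/
def lorentz {n : ℕ} (x y : Mink n) : ℝ := inner ℝ x.1 y.1 - x.2 * y.2

/-- Hyperbolic space `ℍⁿ` in the hyperboloid model. -/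
abbrev Hyp (n : ℕ) : Type := {x : Mink n // x.2 = √(1 + ‖x.1‖ ^ 2)}

/-- The hyperboloid as a graph over `ℝⁿ`. Together with its inverse `q ↦ q.1.1` this is a global
smooth coordinate system on `ℍⁿ`. -/
def graph {n : ℕ} (x : E n) : Hyp n := ⟨(x, √(1 + ‖x‖ ^ 2)), rfl⟩

/-- `v` is tangent to `ℍⁿ` at `q`. The Riemannian metric is `lorentz` on such vectors. -/
def IsTangent {n : ℕ} (q : Hyp n) (v : Mink n) : Prop := lorentz q.1 v = 0

/-- Smooth real functions on `ℍⁿ`. -/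
def IsSmooth {n : ℕ} (f : Hyp n → ℝ) : Prop := ContDiff ℝ ∞ (fun x : E n => f (graph x))

/-- The differential `df_q(v)` of a function at `q`, for a tangent vector `v` at `q`
(whose components in the coordinates of `graph` are `v.1`). -/
def diff {n : ℕ} (f : Hyp n → ℝ) (q : Hyp n) (v : Mink n) : ℝ :=
  fderiv ℝ (fun x : E n => f (graph x)) q.1.1 v.1

/-- The length `|∇f|(q)` of the Riemannian gradient: the norm of the linear form `df_q` on the
tangent space with the hyperbolic metric. -/
def gradNorm {n : ℕ} (f : Hyp n → ℝ) (q : Hyp n) : ℝ :=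
  sSup {a : ℝ | ∃ v : Mink n, IsTangent q v ∧ lorentz v v ≤ 1 ∧ a = diff f q v}

/-- The matrix of the metric induced by a parametrization `φ`, at the parameter `u`. -/
def gram {n k : ℕ} (φ : E k → Hyp n) (u : E k) : Matrix (Fin k) (Fin k) ℝ :=
  Matrix.of fun i j =>
    lorentz (fderiv ℝ (fun w : E k => (φ w).1) u (EuclideanSpace.single i 1))
      (fderiv ℝ (fun w : E k => (φ w).1) u (EuclideanSpace.single j 1))

/-- The `k`-dimensional Riemannian measure `√(det g) du₁⋯duₖ` of the piece of `ℍⁿ` parametrized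
by `φ` on `U`, as a measure on `ℍⁿ`. -/
def paramMeasure {n k : ℕ} (U : Set (E k)) (φ : E k → Hyp n) :
    MeasureTheory.Measure (Hyp n) :=
  ((MeasureTheory.volume.restrict U).withDensity
    fun u => ENNReal.ofReal (√(gram φ u).det)).map φ

/-- The Riemannian volume measure of `ℍⁿ`. -/
def hypVolume (n : ℕ) : MeasureTheory.Measure (Hyp n) := paramMeasure Set.univ graph

/-- The `p`-capacity of `K`: the infimum of `∫ |∇f|^p dv` over the smooth compactly supported
functions `f` with `f = 1` on `K`. -/
def capacity {n : ℕ} (p : ℝ) (K : Set (Hyp n)) : ℝ≥0∞ :=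
  ⨅ (f : Hyp n → ℝ) (_ : IsSmooth f ∧ HasCompactSupport f ∧ ∀ x ∈ K, f x = 1),
    ∫⁻ x, ENNReal.ofReal (gradNorm f x) ^ p ∂(hypVolume n)

/-- The point at time `s` of the geodesic of `ℍⁿ` that starts at `q` with velocity the unit
tangent vector `v`. -/
def geodesic {n : ℕ} (q : Hyp n) (v : Mink n) (s : ℝ) : Mink n :=
  Real.cosh s • q.1 + Real.sinh s • v

/-- Geodesic convexity: `K` contains every geodesic segment whose end points lie in `K`. -/
def IsGeodesicallyConvex {n : ℕ} (K : Set (Hyp n)) : Prop :=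
  ∀ q ∈ K, ∀ v : Mink n, IsTangent q v → lorentz v v = 1 → ∀ r : ℝ, 0 ≤ r →
    geodesic q v r ∈ Subtype.val '' K →
      ∀ s ∈ Set.Icc 0 r, geodesic q v s ∈ Subtype.val '' K

/-- The hyperbolic distance, `cosh d(x, y) = -⟨x, y⟩`. -/
def hypDist {n : ℕ} (x y : Hyp n) : ℝ := Real.arcosh (-lorentz x.1 y.1)

/-- The closed geodesic ball of radius `r` about `x`. -/
def geodesicBall {n : ℕ} (x : Hyp n) (r : ℝ) : Set (Hyp n) := {y | hypDist x y ≤ r}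

/-- `ρ` is a smooth function with `ρ(q) = 0`, `dρ_q ≠ 0` and `K = {ρ ≤ 0}` near `q`. -/
def IsDefiningFunctionAt {n : ℕ} (K : Set (Hyp n)) (q : Hyp n) (ρ : Hyp n → ℝ) : Prop :=
  IsSmooth ρ ∧ ρ q = 0 ∧ (∃ v, IsTangent q v ∧ diff ρ q v ≠ 0) ∧ ∀ᶠ y in 𝓝 q, y ∈ K ↔ ρ y ≤ 0

/-- `K` has smooth boundary. -/
def HasSmoothBoundary {n : ℕ} (K : Set (Hyp n)) : Prop :=
  ∀ q ∈ frontier K, ∃ ρ : Hyp n → ℝ, IsDefiningFunctionAt K q ρ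

/-- `v` is the outward unit normal of `∂K` at `q`, that is `v = ∇ρ/|∇ρ|` for a defining
function `ρ`. -/
def IsOutwardUnitNormal {n : ℕ} (K : Set (Hyp n)) (q : Hyp n) (v : Mink n) : Prop :=
  IsTangent q v ∧ lorentz v v = 1 ∧ ∃ ρ : Hyp n → ℝ, IsDefiningFunctionAt K q ρ ∧
    ∃ c : ℝ, 0 < c ∧ ∀ w, IsTangent q w → diff ρ q w = c * lorentz v w

open Classical in
/-- The outward unit normal field of `∂K` (zero where there is none). -/
def outwardNormal {n : ℕ} (K : Set (Hyp n)) (q : Hyp n) : Mink n :=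
  if h : ∃ v, IsOutwardUnitNormal K q v then h.choose else 0

/-- The tangent space of `∂K` at a boundary point `q`: the vectors that are orthogonal to `q`
(tangent to `ℍⁿ`) and to the normal. -/
def boundaryTangent {n : ℕ} (K : Set (Hyp n)) (q : Hyp n) : Submodule ℝ (Mink n) where
  carrier := {v | lorentz q.1 v = 0 ∧ lorentz (outwardNormal K q) v = 0}
  add_mem' := by
    rintro a b ⟨h1, h2⟩ ⟨h3, h4⟩
    simp only [lorentz, Set.mem_ofPred_eq, Prod.fst_add, Prod.snd_add, inner_add_right] at *
    constructor <;> linarith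
  zero_mem' := by simp [lorentz]
  smul_mem' := by
    rintro c a ⟨h1, h2⟩
    simp only [lorentz, Set.mem_ofPred_eq, Prod.smul_fst, Prod.smul_snd, inner_smul_right,
      smul_eq_mul] at *
    constructor
    · linear_combination c * h1
    · linear_combination c * h2

/-- The derivative `v ↦ D_v ν` at `q` of the outward unit normal `ν` along `∂K`. For `v` tangent to
`∂K` it is determined by the values of `ν` on `∂K`, and it is orthogonal to `q`, hence equal
to the covariant derivative `∇_v ν` in `ℍⁿ`. -/
def normalDeriv {n : ℕ} (K : Set (Hyp n)) (q : Hyp n) : Mink n →ₗ[ℝ] Mink n :=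
  (fderivWithin ℝ (fun x : E n => outwardNormal K (graph x))
    (graph ⁻¹' frontier K) q.1.1).toLinearMap ∘ₗ LinearMap.fst ℝ (E n) ℝ

open Classical in
/-- The shape operator `v ↦ ∇_v ν` of `∂K` with respect to the outward unit normal, an endomorphism
of the tangent space of `∂K` (positive on geodesic spheres). Where `∂K` is smooth the first
alternative holds. -/
def shapeOperator {n : ℕ} (K : Set (Hyp n)) (q : Hyp n) :
    boundaryTangent K q →ₗ[ℝ] boundaryTangent K q :=
  if h : ∀ v ∈ boundaryTangent K q, normalDeriv K q v ∈ boundaryTangent K q then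
    (normalDeriv K q).restrict h
  else 0

/-- The principal curvatures of `∂K` at `q`, with multiplicity: the eigenvalues of the shape
operator. -/
def principalCurvatures {n : ℕ} (K : Set (Hyp n)) (q : Hyp n) : Multiset ℝ :=
  (shapeOperator K q).charpoly.roots

/-- The `i`th mean curvature `σᵢ` of `∂K`: the `i`th elementary symmetric function of the principal
curvatures (`σ₀ = 1`). -/
def meanCurvature {n : ℕ} (K : Set (Hyp n)) (i : ℕ) (q : Hyp n) : ℝ :=
  (principalCurvatures K q).esymm i

/-- `φ` restricted to the open set `U ⊆ ℝⁿ⁻¹` is a local parametrization of the hypersurface `M`: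
a smooth injective immersion into `M`. -/
structure IsPatch {n : ℕ} (M : Set (Hyp n)) (U : Set (E (n - 1))) (φ : E (n - 1) → Hyp n) :
    Prop where
  isOpen : IsOpen U
  mapsTo : Set.MapsTo φ U M
  injOn : Set.InjOn φ U
  smooth : ContDiffOn ℝ ∞ (fun u => (φ u).1) U
  immersion : ∀ u ∈ U, Function.Injective (fderiv ℝ (fun w => (φ w).1) u)

/-- The area measure `μ` of a hypersurface `M`, glued from the Riemannian measures of its local
parametrizations: it is the least measure that dominates all of them. (They agree where they
overlap, so `μ` restricts to each of them on its patch.) -/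
def areaMeasure {n : ℕ} (M : Set (Hyp n)) : MeasureTheory.Measure (Hyp n) :=
  ⨆ (U : Set (E (n - 1))) (φ : E (n - 1) → Hyp n) (_ : IsPatch M U φ), paramMeasure U φ

/-- `∫_M ∑ᵢ cosh^{n-1-i} t sinh^i t σᵢ dμ` for `M = ∂K`. -/
def curvatureIntegral {n : ℕ} (K : Set (Hyp n)) (t : ℝ) : ℝ :=
  ∫ x, ∑ i ∈ Finset.range n,
    Real.cosh t ^ (n - 1 - i) * Real.sinh t ^ i * meanCurvature K i x ∂(areaMeasure (frontier K))

end HypCap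

end

/-! The proof works in normal coordinates around `∂K`. For a nonempty convex body, `(q, t) ↦ cosh t
• q + sinh t • N(q)`, with `N` the outward unit normal, maps `∂K × (0, ∞)` bijectively onto the
exterior of `K`, with smooth local inverses, and `t` is the distance to `K`. Its differential is
`cosh t + sinh t S` on vectors tangent to `∂K`, with `S` the shape operator, and it sends the
`t`-direction to a unit vector orthogonal to these. Its Jacobian is therefore `det (cosh t + sinh t
S) = ∏ (cosh t + sinh t kᵢ)`, which expands into the sum of the `σᵢ` in the statement (`jac`). So
`A(t) = curvatureIntegral K t` is the area of the parallel hypersurface at distance `t`, and the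
integral of `g(dist)` over the exterior is `∫ g(t) A(t) dt` (`lintegral_exterior_radial`).

Convexity enters through the support inequality `lorentz_normal_le`: `⟨x, N(q)⟩ ≤ 0` for `x ∈ K`. It
makes `q` the nearest point of `K` along its normal geodesic, which gives injectivity, and it makes
`N` monotone, so that `S ≥ 0` and the Jacobian is at least `1`.

Upper bound: the function `η(dist)` has energy at most `∫ |η'|^p A dt`. Among profiles falling from
`1` to `0` the optimum has `|η'|` proportional to `A^(-1/(p-1))`, and its energy is the claimed
bound. Cutting it off smoothly near `0` and `∞` and passing to the limit proves the inequality
(`capacity_le_Icc`, `capacity_le`).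

Equality for balls: along every normal geodesic a competitor falls from `1` to `0`. Hölder's
inequality on that geodesic with weight `jac` (`rpow_lintegral_le`), integrated over `∂K`, gives a
lower bound. It agrees with the upper bound when `jac` does not depend on `q` (`le_capacity`), as
happens for a ball, where `S = coth r`.

The area measure is a supremum over patches. It is identified with the push-forward, under the foot
point map, of a suitably weighted volume on the collar `0 < dist < 1` (`areaMeasure_eq`). This
measure is defined without patches, so overlapping patches never have to be compared. -/

namespace HypCap

variable {n : ℕ}

/-! ### Lorentz algebra -/

/-- The Lorentz inner product as a continuous bilinear map. -/
noncomputable def lorentzL (n : ℕ) : Mink n →L[ℝ] Mink n →L[ℝ] ℝ :=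
  (isBoundedBilinearMap_inner (𝕜 := ℝ) (E := E n)).toContinuousLinearMap.bilinearComp 
      (ContinuousLinearMap.fst ℝ (E n) ℝ) (ContinuousLinearMap.fst ℝ (E n) ℝ) -
    (ContinuousLinearMap.mul ℝ ℝ).bilinearComp (ContinuousLinearMap.snd ℝ (E n) ℝ)
      (ContinuousLinearMap.snd ℝ (E n) ℝ)

theorem lorentzL_apply (x y : Mink n) : lorentzL n x y = lorentz x y := rfl

theorem lorentz_comm (x y : Mink n) : lorentz x y = lorentz y x := by
  simp only [lorentz, real_inner_comm, mul_comm]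

theorem lorentz_add_left (x y z : Mink n) : lorentz (x + y) z = lorentz x z + lorentz y z := by
  simp [← lorentzL_apply]

theorem lorentz_add_right (x y z : Mink n) : lorentz z (x + y) = lorentz z x + lorentz z y := by
  simp [← lorentzL_apply]

theorem lorentz_sub_left (x y z : Mink n) : lorentz (x - y) z = lorentz x z - lorentz y z := by
  simp [← lorentzL_apply]

theorem lorentz_sub_right (x y z : Mink n) : lorentz z (x - y) = lorentz z x - lorentz z y := by
  simp [← lorentzL_apply]

theorem lorentz_smul_left (c : ℝ) (x z : Mink n) : lorentz (c • x) z = c * lorentz x z := by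
  simp [← lorentzL_apply]

theorem lorentz_smul_right (c : ℝ) (x z : Mink n) : lorentz z (c • x) = c * lorentz z x := by
  simp [← lorentzL_apply]

theorem lorentz_zero_right (z : Mink n) : lorentz z 0 = 0 := by
  simp [← lorentzL_apply]

theorem lorentz_zero_left (z : Mink n) : lorentz 0 z = 0 := by
  simp [← lorentzL_apply]

theorem continuous_lorentz : Continuous fun x : Mink n × Mink n => lorentz x.1 x.2 := by
  unfold lorentz; fun_prop

theorem _root_.Continuous.lorentz {X : Type*} [TopologicalSpace X] {f g : X → Mink n}
    (hf : Continuous f) (hg : Continuous g) : Continuous fun x => lorentz (f x) (g x) :=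
  continuous_lorentz.comp (hf.prodMk hg)

theorem _root_.ContDiffAt.lorentz {F : Type*} [NormedAddCommGroup F] [NormedSpace ℝ F]
    {k : WithTop ℕ∞} {f g : F → Mink n} {x : F} (hf : ContDiffAt ℝ k f x)
    (hg : ContDiffAt ℝ k g x) : ContDiffAt ℝ k (fun x => lorentz (f x) (g x)) x := by
  unfold HypCap.lorentz
  exact (hf.fst.inner ℝ hg.fst).sub (hf.snd.mul hg.snd)

theorem hasFDerivAt_lorentz {F : Type*} [NormedAddCommGroup F] [NormedSpace ℝ F]
    {f g : F → Mink n} {f' g' : F →L[ℝ] Mink n} {x : F} (hf : HasFDerivAt f f' x)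
    (hg : HasFDerivAt g g' x) :
    ∃ L : F →L[ℝ] ℝ, HasFDerivAt (fun x => lorentz (f x) (g x)) L x ∧
      ∀ w, L w = lorentz (f x) (g' w) + lorentz (f' w) (g x) :=
  ⟨_, (lorentzL n).hasFDerivAt_of_bilinear hf hg, fun w => by
    simp [← lorentzL_apply]⟩

theorem hasDerivAt_lorentz {f g : ℝ → Mink n} {f' g' : Mink n} {x : ℝ} (hf : HasDerivAt f f' x)
    (hg : HasDerivAt g g' x) :
    HasDerivAt (fun x => lorentz (f x) (g x)) (lorentz (f x) g' + lorentz f' (g x)) x := by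
  obtain ⟨L, hL, h⟩ := hasFDerivAt_lorentz hf.hasFDerivAt hg.hasFDerivAt
  have := hL.hasDerivAt
  simpa [h] using this

/-! ### The hyperboloid -/

theorem graph_coord (q : Hyp n) : graph q.1.1 = q := by
  obtain ⟨⟨x, t⟩, h⟩ := q
  simp only at h
  subst h
  rfl

theorem hyp_snd_pos (q : Hyp n) : 0 < q.1.2 := by
  rw [q.2]; positivity

theorem hyp_snd_sq (q : Hyp n) : q.1.2 ^ 2 = 1 + ‖q.1.1‖ ^ 2 := by
  rw [q.2, Real.sq_sqrt (by positivity)]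

theorem lorentz_hyp_self (q : Hyp n) : lorentz q.1 q.1 = -1 := by
  have := hyp_snd_sq q
  simp only [lorentz, real_inner_self_eq_norm_sq]
  linarith

theorem contDiff_graph : ContDiff ℝ ∞ fun x : E n => (graph x).1 := by
  unfold graph
  exact contDiff_id.prodMk
    (ContDiff.sqrt (contDiff_const.add (contDiff_norm_sq ℝ)) fun x => by positivity)

theorem continuous_graph : Continuous (graph : E n → Hyp n) :=
  Continuous.subtype_mk contDiff_graph.continuous _

theorem continuous_coord : Continuous fun q : Hyp n => q.1.1 :=
  continuous_fst.comp continuous_subtype_val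

/-- The global coordinate system as a homeomorphism. -/
noncomputable def graphHomeo (n : ℕ) : E n ≃ₜ Hyp n where
  toFun := graph
  invFun q := q.1.1
  left_inv _ := rfl
  right_inv := graph_coord
  continuous_toFun := continuous_graph
  continuous_invFun := continuous_coord

theorem hasFDerivAt_graph (x : E n) :
    ∃ L : E n →L[ℝ] Mink n, HasFDerivAt (fun x : E n => (graph x).1) L x ∧
      ∀ w, IsTangent (graph x) (L w) ∧ (L w).1 = w := by
  have h := (contDiff_graph (n := n)).differentiable (by simp) x
  refine ⟨_, h.hasFDerivAt, fun w => ⟨?_, ?_⟩⟩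
  · obtain ⟨L, hL, hL'⟩ := hasFDerivAt_lorentz h.hasFDerivAt h.hasFDerivAt
    have h0 : (fun x : E n => lorentz (graph x).1 (graph x).1) = fun _ => -1 := by
      funext x; exact lorentz_hyp_self _
    rw [h0] at hL
    have := hL.unique (hasFDerivAt_const _ _)
    have h2 := hL' w
    rw [this, lorentz_comm _ (graph x).1] at h2
    simp only [_root_.zero_apply] at h2
    unfold IsTangent
    linarith
  · have h1 := h.hasFDerivAt.fst
    have h2 : HasFDerivAt (fun x : E n => ((graph x).1).1) (ContinuousLinearMap.id ℝ (E n)) x :=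
      hasFDerivAt_id x
    have := h1.unique h2
    calc _ = ((ContinuousLinearMap.fst ℝ (E n) ℝ).comp (fderiv ℝ (fun x : E n => (graph x).1) x)) w
        := rfl
      _ = w := by rw [this]; rfl

theorem tangent_snd {q : Hyp n} {v : Mink n} (h : IsTangent q v) :
    q.1.2 * v.2 = inner ℝ q.1.1 v.1 := by
  unfold IsTangent lorentz at h; linarith

theorem tangent_ext {q : Hyp n} {v w : Mink n} (hv : IsTangent q v) (hw : IsTangent q w)
    (h : v.1 = w.1) : v = w := by
  refine Prod.ext h ?_
  have h1 := tangent_snd hv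
  have h2 := tangent_snd hw
  rw [h, ← h2] at h1
  exact mul_left_cancel₀ (hyp_snd_pos q).ne' h1

theorem fderiv_graph_coord {q : Hyp n} {v : Mink n} (h : IsTangent q v) :
    fderiv ℝ (fun x : E n => (graph x).1) q.1.1 v.1 = v := by
  obtain ⟨L, hL, hL'⟩ := hasFDerivAt_graph q.1.1
  rw [hL.fderiv]
  have := hL' v.1
  rw [graph_coord] at this
  exact tangent_ext this.1 h this.2

/-- Tangency expresses `v.2` through `⟨q.1, v.1⟩`, and Cauchy–Schwarz bounds the latter. This is the
quantitative form of positive definiteness of the Lorentz form on tangent spaces. -/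
theorem norm_sq_le_of_tangent {q : Hyp n} {v : Mink n} (h : IsTangent q v) :
    ‖v.1‖ ^ 2 ≤ (1 + ‖q.1.1‖ ^ 2) * lorentz v v := by
  have h1 := tangent_snd h
  have h2 := abs_real_inner_le_norm q.1.1 v.1
  have h3 := hyp_snd_sq q
  have h4 : (q.1.2 * v.2) ^ 2 ≤ (‖q.1.1‖ * ‖v.1‖) ^ 2 := by
    rw [h1]; exact sq_le_sq' (abs_le.1 h2).1 (abs_le.1 h2).2
  simp only [lorentz, real_inner_self_eq_norm_sq]
  rw [← h3]
  nlinarith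

theorem lorentz_self_nonneg {q : Hyp n} {v : Mink n} (h : IsTangent q v) : 0 ≤ lorentz v v := by
  have := norm_sq_le_of_tangent h
  by_contra! h'
  nlinarith [sq_nonneg ‖v.1‖, sq_nonneg ‖q.1.1‖]

theorem tangent_zero (q : Hyp n) : IsTangent q 0 := lorentz_zero_right _

theorem IsTangent.smul {q : Hyp n} {v : Mink n} (hv : IsTangent q v) (c : ℝ) :
    IsTangent q (c • v) := by
  unfold IsTangent at *; rw [lorentz_smul_right, hv, mul_zero]

theorem IsTangent.sub {q : Hyp n} {v w : Mink n} (hv : IsTangent q v) (hw : IsTangent q w) :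
    IsTangent q (v - w) := by
  unfold IsTangent at *; rw [lorentz_sub_right, hv, hw, sub_zero]

theorem eq_zero_of_lorentz_self {q : Hyp n} {v : Mink n} (h : IsTangent q v)
    (h0 : lorentz v v ≤ 0) : v = 0 := by
  have := norm_sq_le_of_tangent h
  refine tangent_ext h (tangent_zero q) ?_
  have h1 : ‖v.1‖ ^ 2 ≤ 0 := this.trans (mul_nonpos_of_nonneg_of_nonpos (by positivity) h0)
  simpa using le_antisymm h1 (sq_nonneg _)

/-- Cauchy–Schwarz, from nonnegativity of the form on `w - ⟨v, w⟩ v`. -/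
theorem lorentz_mul_le {q : Hyp n} {v w : Mink n} (hv : IsTangent q v) (hw : IsTangent q w)
    (h1 : lorentz v v = 1) : lorentz v w ^ 2 ≤ lorentz w w := by
  have := lorentz_self_nonneg (hw.sub (hv.smul (lorentz v w)))
  simp only [lorentz_sub_left, lorentz_sub_right, lorentz_smul_left, lorentz_smul_right, h1,
    lorentz_comm w v] at this
  nlinarith

theorem eq_of_lorentz_eq_one {q : Hyp n} {v w : Mink n} (hv : IsTangent q v) (hw : IsTangent q w)
    (h1 : lorentz v v = 1) (h2 : lorentz w w = 1) (h : 1 ≤ lorentz v w) : v = w := by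
  refine sub_eq_zero.1 (eq_zero_of_lorentz_self (hv.sub hw) ?_)
  simp only [lorentz_sub_left, lorentz_sub_right, h1, h2, lorentz_comm w v]
  linarith

theorem lorentz_hyp_neg (x y : Hyp n) : lorentz x.1 y.1 < 0 := by
  have h1 := (abs_le.1 (abs_real_inner_le_norm x.1.1 y.1.1)).2
  have h2 : ‖x.1.1‖ < x.1.2 := by
    rw [x.2]; exact Real.lt_sqrt_of_sq_lt (by linarith)
  have h3 : ‖y.1.1‖ < y.1.2 := by
    rw [y.2]; exact Real.lt_sqrt_of_sq_lt (by linarith)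
  unfold lorentz
  nlinarith [norm_nonneg x.1.1, norm_nonneg y.1.1]

/-- The component of `x` tangent to `ℍⁿ` at `q`. -/
noncomputable def tangentPart (q : Hyp n) (x : Mink n) : Mink n := x + lorentz x q.1 • q.1

theorem isTangent_tangentPart (q : Hyp n) (x : Mink n) : IsTangent q (tangentPart q x) := by
  simp only [IsTangent, tangentPart, lorentz_add_right, lorentz_smul_right, lorentz_hyp_self,
    lorentz_comm x]
  ring

theorem lorentz_tangentPart {q : Hyp n} {w : Mink n} (hw : IsTangent q w) (x : Mink n) :
    lorentz (tangentPart q x) w = lorentz x w := by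
  unfold IsTangent at hw
  simp only [tangentPart, lorentz_add_left, lorentz_smul_left, hw]
  ring

theorem lorentz_tangentPart_self (q : Hyp n) (x : Mink n) :
    lorentz (tangentPart q x) (tangentPart q x) = lorentz x x + lorentz x q.1 ^ 2 := by
  rw [lorentz_tangentPart (isTangent_tangentPart q x), tangentPart, lorentz_add_right,
    lorentz_smul_right]
  ring

/-- The part of `x` tangent at `y` has squared length `⟨x, y⟩² - 1 ≥ 0`, and `⟨x, y⟩` is negative.
The equality case, treated next, forces the tangent part to vanish. -/
theorem lorentz_hyp_le (x y : Hyp n) : lorentz x.1 y.1 ≤ -1 := by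
  have h := lorentz_self_nonneg (isTangent_tangentPart y x.1)
  rw [lorentz_tangentPart_self, lorentz_hyp_self] at h
  nlinarith [lorentz_hyp_neg x y]

theorem eq_of_lorentz_hyp {x y : Hyp n} (h : -1 ≤ lorentz x.1 y.1) : x = y := by
  have h1 : lorentz x.1 y.1 = -1 := le_antisymm (lorentz_hyp_le x y) h
  have h2 := eq_zero_of_lorentz_self (isTangent_tangentPart y x.1) (by
    rw [lorentz_tangentPart_self, lorentz_hyp_self, h1]; norm_num)
  rw [tangentPart, h1] at h2
  refine Subtype.ext (sub_eq_zero.1 ?_)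
  rw [← h2]; module

theorem lorentz_geodesic_self {q : Hyp n} {v : Mink n} (hv : IsTangent q v) (h1 : lorentz v v = 1)
    (t : ℝ) : lorentz (geodesic q v t) (geodesic q v t) = -1 := by
  unfold IsTangent at hv
  have := Real.cosh_sq t
  simp only [geodesic, lorentz_add_left, lorentz_add_right, lorentz_smul_left, lorentz_smul_right,
    h1, lorentz_hyp_self, lorentz_comm v, hv]
  nlinarith

/-- The curve has Lorentz square `-1`, which fixes its last coordinate up to sign. The sign is
positive because `|sinh t| < cosh t` and `|v.2| < q.2`. -/
theorem graph_geodesic {q : Hyp n} {v : Mink n} (hv : IsTangent q v) (h1 : lorentz v v = 1)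
    (t : ℝ) : (graph (geodesic q v t).1).1 = geodesic q v t := by
  refine Prod.ext rfl ?_
  have hs : (geodesic q v t).2 ^ 2 = 1 + ‖(geodesic q v t).1‖ ^ 2 := by
    have := lorentz_geodesic_self hv h1 t
    simp only [lorentz, real_inner_self_eq_norm_sq] at this
    linarith
  have hpos : 0 < (geodesic q v t).2 := by
    have h2 := tangent_snd hv
    have h3 := norm_sq_le_of_tangent hv
    have h4 := hyp_snd_sq q
    have h5 := hyp_snd_pos q
    have h6 : v.2 ^ 2 = ‖v.1‖ ^ 2 - 1 := by
      simp only [lorentz, real_inner_self_eq_norm_sq] at h1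
      linarith
    have h7 : |v.2| < q.1.2 := by
      refine abs_lt_of_sq_lt_sq ?_ h5.le
      rw [h1] at h3
      nlinarith
    have h8 : |Real.sinh t| < Real.cosh t := by
      refine abs_lt_of_sq_lt_sq ?_ (Real.cosh_pos t).le
      rw [Real.sinh_sq]; linarith
    have h9 : |Real.sinh t * v.2| < Real.cosh t * q.1.2 := by
      rw [abs_mul]
      exact mul_lt_mul'' h8 h7 (abs_nonneg _) (abs_nonneg _)
    have := (abs_lt.1 h9).1
    simp only [geodesic, Prod.snd_add, Prod.smul_snd, smul_eq_mul]
    linarith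
  change √(1 + ‖(geodesic q v t).1‖ ^ 2) = _
  rw [← hs, Real.sqrt_sq hpos.le]

/-- A point of `ℍⁿ` other than `q` is reached from `q` along a unit speed geodesic. -/
theorem exists_geodesic {q y : Hyp n} (h : y ≠ q) :
    ∃ v : Mink n, ∃ t : ℝ, 0 < t ∧ IsTangent q v ∧ lorentz v v = 1 ∧ y.1 = geodesic q v t := by
  have h1 : 1 < -lorentz y.1 q.1 := by
    by_contra! h'
    exact h (eq_of_lorentz_hyp (by linarith))
  set a := -lorentz y.1 q.1 with ha
  have ht := Real.arcosh_pos h1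
  have hc := Real.cosh_arcosh h1.le
  have hs : 0 < Real.sinh (Real.arcosh a) := Real.sinh_pos_iff.2 ht
  have hs2 := Real.sinh_sq (Real.arcosh a)
  have hp : tangentPart q y.1 = y.1 - a • q.1 := by
    rw [tangentPart, ha]; module
  refine ⟨(Real.sinh (Real.arcosh a))⁻¹ • tangentPart q y.1, Real.arcosh a, ht,
    (isTangent_tangentPart q y.1).smul _, ?_, ?_⟩
  · rw [lorentz_smul_left, lorentz_smul_right, lorentz_tangentPart_self, lorentz_hyp_self]
    rw [hc] at hs2
    field_simp
    rw [hs2, ha]; ring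
  · rw [geodesic, smul_smul, mul_inv_cancel₀ hs.ne', one_smul, hc, hp]
    module

theorem lorentz_geodesic_left (q : Hyp n) (v x : Mink n) (t : ℝ) :
    lorentz (geodesic q v t) x = Real.cosh t * lorentz q.1 x + Real.sinh t * lorentz v x := by
  simp [geodesic, lorentz_add_left, lorentz_smul_left]

/-! ### Differentials and gradients -/

/-- The coordinate line through `q` with velocity `v`. -/
theorem hasDerivAt_coordLine {q : Hyp n} {v : Mink n} (hv : IsTangent q v) :
    HasDerivAt (fun s : ℝ => (graph (q.1.1 + s • v.1)).1) v 0 := by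
  have h1 : HasDerivAt (fun s : ℝ => q.1.1 + s • v.1) v.1 0 := by
    simpa using ((hasDerivAt_id (0 : ℝ)).smul_const v.1).const_add q.1.1
  have h2 := (contDiff_graph (n := n)).differentiable (by simp) (q.1.1 + (0 : ℝ) • v.1)
  have := h2.hasFDerivAt.comp_hasDerivAt (0 : ℝ) h1
  rw [zero_smul, add_zero, fderiv_graph_coord hv] at this
  exact this

theorem coordLine_zero (q : Hyp n) (v : Mink n) : graph (q.1.1 + (0 : ℝ) • v.1) = q := by
  simp [graph_coord]

theorem hasDerivAt_comp_coordLine {f : Hyp n → ℝ} {q : Hyp n}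
    (hf : DifferentiableAt ℝ (fun x : E n => f (graph x)) q.1.1) (v : Mink n) :
    HasDerivAt (fun s : ℝ => f (graph (q.1.1 + s • v.1))) (diff f q v) 0 := by
  have h1 : HasDerivAt (fun s : ℝ => q.1.1 + s • v.1) v.1 0 := by
    simpa using ((hasDerivAt_id (0 : ℝ)).smul_const v.1).const_add q.1.1
  exact HasFDerivAt.comp_hasDerivAt_of_eq (0 : ℝ) hf.hasFDerivAt h1 (by simp)

theorem IsSmooth.differentiableAt {f : Hyp n → ℝ} (hf : IsSmooth f) (x : E n) :
    DifferentiableAt ℝ (fun x : E n => f (graph x)) x :=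
  ContDiff.differentiable hf (by simp) x

theorem IsSmooth.continuous {f : Hyp n → ℝ} (hf : IsSmooth f) : Continuous f := by
  have := (ContDiff.continuous hf).comp (continuous_coord (n := n))
  simpa [Function.comp_def, graph_coord] using this

/-- The Riemannian gradient of `f`, at the point with coordinates `x`. -/
noncomputable def grad (f : Hyp n → ℝ) (x : E n) : Mink n :=
  tangentPart (graph x) ((InnerProductSpace.toDual ℝ (E n)).symm
    (fderiv ℝ (fun x : E n => f (graph x)) x), 0)

theorem isTangent_grad (f : Hyp n → ℝ) (q : Hyp n) : IsTangent q (grad f q.1.1) := by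
  rw [grad, graph_coord]
  exact isTangent_tangentPart q _

theorem lorentz_grad (f : Hyp n → ℝ) {q : Hyp n} {w : Mink n} (hw : IsTangent q w) :
    lorentz (grad f q.1.1) w = diff f q w := by
  rw [grad, graph_coord, lorentz_tangentPart hw, lorentz, InnerProductSpace.toDual_symm_apply]
  simp [diff]

theorem contDiff_grad {f : Hyp n → ℝ} (hf : IsSmooth f) : ContDiff ℝ ∞ (grad f) := by
  have h1 : ContDiff ℝ ∞ fun x : E n => (((InnerProductSpace.toDual ℝ (E n)).symm
    (fderiv ℝ (fun x : E n => f (graph x)) x), (0 : ℝ)) : Mink n) := by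
    refine ContDiff.prodMk ?_ contDiff_const
    exact (InnerProductSpace.toDual ℝ (E n)).symm.toContinuousLinearEquiv.contDiff.comp
      (ContDiff.fderiv_right hf (by simp))
  unfold grad tangentPart
  have h2 : ContDiff ℝ ∞ fun x : E n => lorentz (((InnerProductSpace.toDual ℝ (E n)).symm
      (fderiv ℝ (fun x : E n => f (graph x)) x), (0 : ℝ)) : Mink n) (graph x).1 := by
    rw [contDiff_iff_contDiffAt] at h1 ⊢
    exact fun x => (h1 x).lorentz contDiff_graph.contDiffAt
  exact h1.add (ContDiff.smul h2 contDiff_graph)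

/-! ### Gram determinants -/

/-- The Gram matrix, for the Lorentz product, of the images of the standard basis vectors. -/
noncomputable def gramL {k : ℕ} (A : E k →ₗ[ℝ] Mink n) : Matrix (Fin k) (Fin k) ℝ :=
  Matrix.of fun i j => lorentz (A (EuclideanSpace.single i 1)) (A (EuclideanSpace.single j 1))

theorem euclidean_eq_sum {k : ℕ} (x : E k) : x = ∑ i, x i • EuclideanSpace.single i (1 : ℝ) := by
  ext j
  simp [Finset.sum_apply, Pi.single_apply]

/-- With `P` the matrix of `L`, the Gram matrix transforms as `Pᵀ G P`. -/
theorem det_gramL_comp {k : ℕ} (A : E k →ₗ[ℝ] Mink n) (L : E k →ₗ[ℝ] E k) :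
    (gramL (A ∘ₗ L)).det = LinearMap.det L ^ 2 * (gramL A).det := by
  let b := (EuclideanSpace.basisFun (Fin k) ℝ).toBasis
  set P := LinearMap.toMatrix b b L with hP
  have hL (i : Fin k) : L (EuclideanSpace.single i 1) =
      ∑ j, P j i • EuclideanSpace.single j (1 : ℝ) := by
    rw [euclidean_eq_sum (L _)]
    refine Finset.sum_congr rfl fun j _ => ?_
    simp [hP, b, LinearMap.toMatrix_apply]
  have h : gramL (A ∘ₗ L) = P.transpose * gramL A * P := by
    ext i j
    simp only [gramL, Matrix.of_apply, LinearMap.comp_apply, hL, map_sum, map_smul,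
      ← lorentzL_apply, Matrix.mul_apply, Matrix.transpose_apply, FunLike.coe_sum,
      Finset.sum_apply, _root_.smul_apply, smul_eq_mul, Finset.sum_mul]
    simp only [Finset.mul_sum]
    refine Finset.sum_congr rfl fun a _ => Finset.sum_congr rfl fun c _ => ?_
    rw [lorentzL_apply]
    ring
  rw [h, Matrix.det_mul, Matrix.det_mul, Matrix.det_transpose, hP, LinearMap.det_toMatrix]
  ring

/-- Splits off one coordinate without changing volume. If the image of that coordinate vector is a
unit vector orthogonal to the others, expanding the Gram determinant along the first row removes it;
this reduces the `n`-dimensional Jacobian of the normal exponential map to an `(n-1)`-dimensional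
one. -/
theorem exists_prod_equiv (m : ℕ) : ∃ e : (E m × ℝ) ≃L[ℝ] E (m + 1),
    MeasureTheory.MeasurePreserving e ∧
    ∀ (k : ℕ) (A : E (m + 1) →ₗ[ℝ] Mink k) (A₁ : E m →ₗ[ℝ] Mink k) (N : Mink k),
      (∀ w a, A (e (w, a)) = A₁ w + a • N) → (∀ w, lorentz (A₁ w) N = 0) → lorentz N N = 1 →
      (gramL A).det = (gramL A₁).det := by
  let l : (E m × ℝ) ≃ₗ[ℝ] E (m + 1) :=
    { toFun := fun x => WithLp.toLp 2 (Fin.cons x.2 x.1.ofLp : Fin (m + 1) → ℝ)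
      invFun := fun y => (WithLp.toLp 2 fun i => y i.succ, y 0)
      left_inv := fun x => by simp
      right_inv := fun y => by
        ext i; refine Fin.cases ?_ (fun i => ?_) i <;> simp
      map_add' := fun x y => by
        ext i; refine Fin.cases ?_ (fun i => ?_) i <;> simp
      map_smul' := fun c x => by
        ext i; refine Fin.cases ?_ (fun i => ?_) i <;> simp }
  refine ⟨l.toContinuousLinearEquiv, ?_, fun k A A₁ N hA h0 h1 => ?_⟩
  · have h2 := (MeasureTheory.volume_preserving_piFinSuccAbove (fun _ : Fin (m + 1) => ℝ) 0).symm
    have h3 := PiLp.volume_preserving_toLp (Fin (m + 1))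
    have h4 := (MeasureTheory.MeasurePreserving.id (MeasureTheory.volume : MeasureTheory.Measure ℝ)).prod
      (PiLp.volume_preserving_ofLp (Fin m))
    have h5 := h3.comp (h2.comp (h4.comp MeasureTheory.Measure.measurePreserving_swap))
    convert h5 using 1
    · funext x
      ext i
      refine Fin.cases ?_ (fun i => ?_) i <;>
        simp [l, MeasurableEquiv.piFinSuccAbove, Fin.insertNthEquiv]
    · rfl
  · have hs0 : EuclideanSpace.single (0 : Fin (m + 1)) (1 : ℝ) = l (0, 1) := by
      ext i; refine Fin.cases ?_ (fun i => ?_) i <;> simp [l]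
    have hs (j : Fin m) : EuclideanSpace.single j.succ (1 : ℝ) = l (EuclideanSpace.single j 1, 0) := by
      ext i; refine Fin.cases ?_ (fun i => ?_) i <;> simp [l, Pi.single_apply]
    have hl0 : A (l (0, 1)) = N := by simpa using hA 0 1
    have hl (j : Fin m) : A (l (EuclideanSpace.single j 1, 0)) = A₁ (EuclideanSpace.single j 1) := by
      simpa using hA (EuclideanSpace.single j 1) 0
    rw [Matrix.det_succ_row_zero, Fin.sum_univ_succ, Finset.sum_eq_zero]
    · have : (gramL A).submatrix Fin.succ (Fin.succAbove 0) = gramL A₁ := by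
        ext i j
        simp [gramL, hs, hl]
      rw [this]
      simp [gramL, hs0, hl0, h1]
    · intro j _
      simp [gramL, hs0, hl0, hs, hl, lorentz_comm N, h0]

/-! ### Symmetric endomorphisms -/

/-- Vieta's formula for `∏ (X + k)` evaluated at `a / b` and made homogeneous. -/
theorem multiset_prod_eq_sum_esymm (s : Multiset ℝ) {a b : ℝ} (hb : b ≠ 0) :
    (s.map fun k => a + b * k).prod =
      ∑ i ∈ Finset.range (s.card + 1), a ^ (s.card - i) * b ^ i * s.esymm i := by
  have h1 : (s.map fun k => a + b * k) = s.map fun k => b * (a / b + k) := by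
    refine Multiset.map_congr rfl fun k _ => by field_simp
  rw [h1, Multiset.prod_map_mul, Multiset.map_const', Multiset.prod_replicate]
  have h2 := congrArg (Polynomial.eval (a / b)) (Multiset.prod_X_add_C_eq_sum_esymm s)
  rw [Polynomial.eval_multiset_prod, Multiset.map_map] at h2
  simp only [Function.comp_def, Polynomial.eval_add, Polynomial.eval_X, Polynomial.eval_C,
    Polynomial.eval_finsetSum, Polynomial.eval_mul, Polynomial.eval_pow] at h2
  rw [h2, Finset.mul_sum]
  refine Finset.sum_congr rfl fun i hi => ?_
  have hi' : i ≤ s.card := by simpa [Nat.lt_succ_iff] using hi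
  obtain ⟨j, hj⟩ := Nat.exists_eq_add_of_le hi'
  rw [hj, Nat.add_sub_cancel_left, div_pow, pow_add]
  field_simp

section Symmetric

variable {V : Type*} [AddCommGroup V] [Module ℝ V] [FiniteDimensional ℝ V]
  {B : V →ₗ[ℝ] V →ₗ[ℝ] ℝ} {S : V →ₗ[ℝ] V}

/-- The spectral theorem for the inner product `B`. It guarantees that the multiset of real roots
misses no eigenvalue, so that there are as many principal curvatures as dimensions. -/
theorem splits_charpoly_of_symmetric (hsymm : ∀ x y, B x y = B y x) (hpos : ∀ x, x ≠ 0 → 0 < B x x)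
    (hS : ∀ x y, B (S x) y = B x (S y)) : S.charpoly.Splits := by
  let c : InnerProductSpace.Core ℝ V :=
    { inner := fun x y => B x y
      conj_inner_symm := fun x y => by simp [hsymm x y]
      re_inner_nonneg := fun x => by
        by_cases h : x = 0
        · simp [h]
        · simpa using (hpos x h).le
      add_left := fun x y z => by simp
      smul_left := fun x y r => by simp
      definite := fun x h => by
        by_contra h'
        exact (hpos x h').ne' h }
  let _ : NormedAddCommGroup V := c.toNormedAddCommGroup
  let _ : InnerProductSpace ℝ V := InnerProductSpace.ofCore c.toCore
  have : S.IsSymmetric := fun x y => hS x y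
  exact this.splits_charpoly

theorem root_charpoly_nonneg (hpos : ∀ x, x ≠ 0 → 0 < B x x) (hS : ∀ x, 0 ≤ B (S x) x)
    {a : ℝ} (ha : a ∈ S.charpoly.roots) : 0 ≤ a := by
  have h : Module.End.HasEigenvalue S a := by
    rw [Module.End.hasEigenvalue_iff_isRoot_charpoly]
    exact (Polynomial.mem_roots'.1 ha).2
  obtain ⟨v, hv⟩ := h.exists_hasEigenvector
  have h1 := hS v
  rw [hv.apply_eq_smul, map_smul] at h1
  have h2 : 0 ≤ a * B v v := h1
  exact nonneg_of_mul_nonneg_left h2 (hpos v hv.2)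

/-- `a + bS = -b (-(a/b) - S)`, so the determinant is the characteristic polynomial at `-(a/b)` up
to a power of `-b`. -/
theorem det_add_smul_eq (h : S.charpoly.Splits) {a b : ℝ} (hb : b ≠ 0) :
    LinearMap.det (a • LinearMap.id + b • S) =
      (S.charpoly.roots.map fun k => a + b * k).prod := by
  have hcard : S.charpoly.roots.card = Module.finrank ℝ V := by
    rw [← h.natDegree_eq_card_roots, LinearMap.charpoly_natDegree]
  have h1 : a • LinearMap.id + b • S = (-b) • ((algebraMap ℝ (Module.End ℝ V) (-(a / b))) - S) := by
    ext x
    change a • x + b • S x = (-b) • ((-(a / b)) • x - S x)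
    rw [smul_sub, smul_smul, show -b * -(a / b) = a by field_simp]
    module
  rw [h1, LinearMap.det_smul, ← LinearMap.eval_charpoly,
    h.eval_eq_prod_roots_of_monic S.charpoly_monic, ← hcard]
  have : (S.charpoly.roots.map fun k => a + b * k) =
      S.charpoly.roots.map fun k => (-b) * (-(a / b) - k) :=
    Multiset.map_congr rfl fun k _ => by field_simp; ring
  rw [this, Multiset.prod_map_mul, Multiset.map_const', Multiset.prod_replicate]

end Symmetric

/-! ### Defining functions and the outward normal -/

theorem eventually_neg_of_hasDerivAt {f : ℝ → ℝ} {f' : ℝ} (hf : HasDerivAt f f' 0) (h0 : f 0 = 0)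
    (h : f' < 0) : ∀ᶠ s in 𝓝[>] (0 : ℝ), f s < 0 := by
  have h1 := (hasDerivAt_iff_tendsto_slope.1 hf).mono_left
    (nhdsWithin_mono 0 (fun s (hs : 0 < s) => (ne_of_gt hs : s ∈ ({0}ᶜ : Set ℝ))))
  filter_upwards [h1.eventually_lt_const h, self_mem_nhdsWithin] with s hs hs0
  rw [slope_def_field, h0, sub_zero, sub_zero] at hs
  have hs0' : (0 : ℝ) < s := hs0
  by_contra! h'
  exact absurd (div_nonneg h' hs0'.le) (not_le.2 hs)

theorem hasDerivAt_comp_curve {f : Hyp n → ℝ} {q : Hyp n}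
    (hf : DifferentiableAt ℝ (fun x : E n => f (graph x)) q.1.1) {v : Mink n} {γ : ℝ → E n}
    (h0 : γ 0 = q.1.1) (hγ : HasDerivAt γ v.1 0) :
    HasDerivAt (fun s : ℝ => f (graph (γ s))) (diff f q v) 0 :=
  HasFDerivAt.comp_hasDerivAt_of_eq (0 : ℝ) hf.hasFDerivAt hγ h0.symm

theorem hasDerivAt_line (x v : E n) : HasDerivAt (fun s : ℝ => x + s • v) v 0 := by
  simpa using ((hasDerivAt_id (0 : ℝ)).smul_const v).const_add x

theorem diff_smul (f : Hyp n → ℝ) (q : Hyp n) (c : ℝ) (v : Mink n) :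
    diff f q (c • v) = c * diff f q v := by
  simp [diff]

theorem tendsto_curve {q : Hyp n} {v : Mink n} {γ : ℝ → E n} (h0 : γ 0 = q.1.1)
    (hγ : HasDerivAt γ v.1 0) : Filter.Tendsto (fun s => graph (γ s)) (𝓝[>] 0) (𝓝 q) := by
  have := (continuous_graph.continuousAt (x := γ 0)).tendsto.comp hγ.continuousAt.tendsto
  rw [h0, graph_coord] at this
  exact this.mono_left nhdsWithin_le_nhds

theorem IsDefiningFunctionAt.eventually_mem {K : Set (Hyp n)} {q : Hyp n} {ρ : Hyp n → ℝ}
    (h : IsDefiningFunctionAt K q ρ) {w : Mink n} {γ : ℝ → E n} (h0 : γ 0 = q.1.1)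
    (hγ : HasDerivAt γ w.1 0) (hw : diff ρ q w < 0) : ∀ᶠ s in 𝓝[>] (0 : ℝ), graph (γ s) ∈ K := by
  have h1 := hasDerivAt_comp_curve (h.1.differentiableAt _) h0 hγ
  have h2 := eventually_neg_of_hasDerivAt h1 (by rw [h0, graph_coord, h.2.1]) hw
  filter_upwards [h2, (tendsto_curve h0 hγ).eventually h.2.2.2] with s hs hs'
  exact hs'.2 hs.le

theorem IsDefiningFunctionAt.eventually_not_mem {K : Set (Hyp n)} {q : Hyp n} {ρ : Hyp n → ℝ}
    (h : IsDefiningFunctionAt K q ρ) {w : Mink n} {γ : ℝ → E n} (h0 : γ 0 = q.1.1)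
    (hγ : HasDerivAt γ w.1 0) (hw : 0 < diff ρ q w) : ∀ᶠ s in 𝓝[>] (0 : ℝ), graph (γ s) ∉ K := by
  have h1 := (hasDerivAt_comp_curve (h.1.differentiableAt _) h0 hγ).neg
  have h2 := eventually_neg_of_hasDerivAt h1 (by simp [h0, graph_coord, h.2.1]) (neg_lt_zero.2 hw)
  filter_upwards [h2, (tendsto_curve h0 hγ).eventually h.2.2.2] with s hs hs' hm
  have h3 := hs'.1 hm
  simp only [Pi.neg_apply] at hs
  linarith

/-- A half-space determines its unit normal. The lemma serves both for uniqueness of the outward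
normal and for recognizing the direction of a shortest geodesic as that normal. -/
theorem eq_of_halfspace {q : Hyp n} {v v' : Mink n} (hv : IsTangent q v) (hv' : IsTangent q v')
    (h1 : lorentz v v = 1) (h2 : lorentz v' v' = 1)
    (h : ∀ w, IsTangent q w → lorentz v w < 0 → lorentz v' w ≤ 0) : v = v' := by
  refine eq_of_lorentz_eq_one hv hv' h1 h2 ?_
  set a := lorentz v v' with ha
  -- The test vector `v' - (a + ε) v` pairs to `-ε` with `v`. The choices `ε = 1 - a` for `a ≤ 0`
  -- and `ε = (1 - a) / 2` for `a > 0` then contradict `a < 1`.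
  have key (ε : ℝ) (hε : 0 < ε) : 1 ≤ (a + ε) * a := by
    have := h (v' - (a + ε) • v) (hv'.sub (hv.smul _)) (by
      rw [lorentz_sub_right, lorentz_smul_right, h1, ← ha]; linarith)
    rw [lorentz_sub_right, lorentz_smul_right, h2, lorentz_comm v', ← ha] at this
    linarith
  have hb : a ^ 2 ≤ 1 := h2 ▸ lorentz_mul_le hv hv' h1
  by_contra! hlt
  rcases le_or_gt a 0 with h0 | h0
  · have := key (1 - a) (by linarith)
    nlinarith
  · have := key ((1 - a) / 2) (by linarith)
    nlinarith

theorem IsOutwardUnitNormal.eventually_mem {K : Set (Hyp n)} {q : Hyp n} {v : Mink n}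
    (h : IsOutwardUnitNormal K q v) {w : Mink n} (hw : IsTangent q w) (hvw : lorentz v w < 0) :
    ∀ᶠ s in 𝓝[>] (0 : ℝ), graph (q.1.1 + s • w.1) ∈ K := by
  obtain ⟨-, -, ρ, hρ, c, hc, h⟩ := h
  refine hρ.eventually_mem (w := w) (by simp) (hasDerivAt_line _ _) ?_
  rw [h w hw]
  exact mul_neg_of_pos_of_neg hc hvw

/-- A curve staying in `K` cannot start with an outward velocity, since a defining function would
become positive along it. General curves are allowed because the support inequality needs geodesics
and uniqueness of the normal needs coordinate lines. -/
theorem IsOutwardUnitNormal.lorentz_le {K : Set (Hyp n)} {q : Hyp n} {v : Mink n}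
    (h : IsOutwardUnitNormal K q v) {w : Mink n} {γ : ℝ → E n} (hw : IsTangent q w)
    (h0 : γ 0 = q.1.1) (hγ : HasDerivAt γ w.1 0) (hK : ∀ᶠ s in 𝓝[>] (0 : ℝ), graph (γ s) ∈ K) :
    lorentz v w ≤ 0 := by
  obtain ⟨-, -, ρ, hρ, c, hc, h⟩ := h
  by_contra! hvw
  have h1 := hρ.eventually_not_mem h0 hγ (by rw [h w hw]; positivity)
  obtain ⟨s, hs⟩ := (hK.and h1).exists
  exact hs.2 hs.1

/-- The set `K` alone decides which directions point inwards, so the normal does not depend on the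
defining function and the choice made in `outwardNormal` is harmless. -/
theorem IsOutwardUnitNormal.unique {K : Set (Hyp n)} {q : Hyp n} {v v' : Mink n}
    (h : IsOutwardUnitNormal K q v) (h' : IsOutwardUnitNormal K q v') : v = v' :=
  eq_of_halfspace h.1 h'.1 h.2.1 h'.2.1 fun _ hw hvw =>
    h'.lorentz_le hw (by simp) (hasDerivAt_line _ _) (h.eventually_mem hw hvw)

theorem IsOutwardUnitNormal.eq {K : Set (Hyp n)} {q : Hyp n} {v : Mink n}
    (h : IsOutwardUnitNormal K q v) : outwardNormal K q = v := by
  have h1 : ∃ v, IsOutwardUnitNormal K q v := ⟨v, h⟩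
  rw [outwardNormal, dif_pos h1]
  exact h1.choose_spec.unique h

/-- The normalized gradient. -/
noncomputable def unitGrad (f : Hyp n → ℝ) (x : E n) : Mink n :=
  (√(lorentz (grad f x) (grad f x)))⁻¹ • grad f x

theorem lorentz_grad_pos_iff (f : Hyp n → ℝ) (q : Hyp n) :
    0 < lorentz (grad f q.1.1) (grad f q.1.1) ↔ ∃ v, IsTangent q v ∧ diff f q v ≠ 0 := by
  constructor
  · intro h
    refine ⟨grad f q.1.1, isTangent_grad f q, ?_⟩
    rw [← lorentz_grad f (isTangent_grad f q)]
    exact h.ne'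
  · rintro ⟨v, hv, h⟩
    by_contra! h'
    rw [← lorentz_grad f hv, eq_zero_of_lorentz_self (isTangent_grad f q) h',
      lorentz_zero_left] at h
    exact h rfl

theorem contDiffAt_unitGrad {f : Hyp n → ℝ} (hf : IsSmooth f) {x : E n}
    (h : 0 < lorentz (grad f x) (grad f x)) : ContDiffAt ℝ ∞ (unitGrad f) x := by
  have h1 := (contDiff_grad hf).contDiffAt (x := x)
  have h2 := h1.lorentz h1
  exact ((h2.sqrt h.ne').inv (Real.sqrt_pos.2 h).ne').smul h1

theorem IsDefiningFunctionAt.isOutwardUnitNormal {K : Set (Hyp n)} {q : Hyp n} {ρ : Hyp n → ℝ}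
    (h : IsDefiningFunctionAt K q ρ) : IsOutwardUnitNormal K q (unitGrad ρ q.1.1) := by
  have h1 := (lorentz_grad_pos_iff ρ q).2 h.2.2.1
  have h2 := Real.sqrt_pos.2 h1
  refine ⟨(isTangent_grad ρ q).smul _, ?_, ρ, h, _, h2, fun w hw => ?_⟩
  · rw [unitGrad, lorentz_smul_left, lorentz_smul_right]
    nth_rw 3 [← Real.sq_sqrt h1.le]
    field_simp
  · rw [unitGrad, lorentz_smul_left, lorentz_grad ρ hw]
    field_simp

theorem isOutwardUnitNormal_outwardNormal {K : Set (Hyp n)} (h : HasSmoothBoundary K) {q : Hyp n}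
    (hq : q ∈ frontier K) : IsOutwardUnitNormal K q (outwardNormal K q) := by
  obtain ⟨ρ, hρ⟩ := h q hq
  rw [hρ.isOutwardUnitNormal.eq]
  exact hρ.isOutwardUnitNormal

theorem IsDefiningFunctionAt.eventually {K : Set (Hyp n)} {q : Hyp n} {ρ : Hyp n → ℝ}
    (h : IsDefiningFunctionAt K q ρ) :
    ∀ᶠ y in 𝓝 q, ρ y = 0 → IsDefiningFunctionAt K y ρ := by
  have h1 := (lorentz_grad_pos_iff ρ q).2 h.2.2.1
  have h2 : Continuous fun y : Hyp n => lorentz (grad ρ y.1.1) (grad ρ y.1.1) := by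
    have := (contDiff_grad h.1).continuous.comp (continuous_coord (n := n))
    exact this.lorentz this
  filter_upwards [h.2.2.2.eventually_nhds, h2.continuousAt.eventually_const_lt h1] with y hy hy' h0
  exact ⟨h.1, h0, (lorentz_grad_pos_iff ρ y).1 hy', hy⟩

theorem IsDefiningFunctionAt.mem_frontier {K : Set (Hyp n)} {q : Hyp n} {ρ : Hyp n → ℝ}
    (h : IsDefiningFunctionAt K q ρ) : q ∈ frontier K := by
  refine ⟨subset_closure (h.2.2.2.self_of_nhds.2 h.2.1.le), fun hi => ?_⟩
  obtain ⟨v, hv, hv0⟩ := h.2.2.1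
  have h1 := h.eventually_not_mem (w := diff ρ q v • v) (γ := fun s => q.1.1 + s • (diff ρ q v • v).1)
    (by simp) (hasDerivAt_line _ _) (by rw [diff_smul]; exact mul_self_pos.2 hv0)
  have h2 := (tendsto_curve (q := q) (v := diff ρ q v • v)
    (γ := fun s => q.1.1 + s • (diff ρ q v • v).1) (by simp) (hasDerivAt_line _ _)).eventually
    (mem_interior_iff_mem_nhds.1 hi)
  obtain ⟨s, hs⟩ := (h1.and h2).exists
  exact hs.1 hs.2

/-- Points with `ρ < 0` are interior by continuity, and at nearby zeros of `ρ` the differential is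
still nonzero, so `ρ` is a defining function there too. -/
theorem IsDefiningFunctionAt.eventually_frontier_iff {K : Set (Hyp n)} (hK : IsClosed K)
    {q : Hyp n} {ρ : Hyp n → ℝ} (h : IsDefiningFunctionAt K q ρ) :
    ∀ᶠ y in 𝓝 q, y ∈ frontier K ↔ ρ y = 0 := by
  filter_upwards [h.eventually, h.2.2.2.eventually_nhds] with y hy hy'
  refine ⟨fun hf => ?_, fun h0 => (hy h0).mem_frontier⟩
  refine le_antisymm (hy'.self_of_nhds.1 (hK.frontier_subset hf)) ?_
  by_contra! hlt
  refine hf.2 (mem_interior_iff_mem_nhds.2 ?_)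
  filter_upwards [hy', h.1.continuous.continuousAt.eventually_lt_const hlt] with z hz hz'
  exact hz.2 hz'.le

theorem IsDefiningFunctionAt.eventually_outwardNormal {K : Set (Hyp n)} (hK : IsClosed K)
    {q : Hyp n} {ρ : Hyp n → ℝ} (h : IsDefiningFunctionAt K q ρ) :
    ∀ᶠ y in 𝓝 q, y ∈ frontier K → outwardNormal K y = unitGrad ρ y.1.1 := by
  filter_upwards [h.eventually, h.eventually_frontier_iff hK] with y hy hy' hf
  exact (hy (hy'.1 hf)).isOutwardUnitNormal.eq

theorem continuousOn_outwardNormal {K : Set (Hyp n)} (hK : IsClosed K) (h : HasSmoothBoundary K) :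
    ContinuousOn (outwardNormal K) (frontier K) := by
  intro q hq
  obtain ⟨ρ, hρ⟩ := h q hq
  have h1 := (lorentz_grad_pos_iff ρ q).2 hρ.2.2.1
  have h2 : ContinuousAt (fun y : Hyp n => unitGrad ρ y.1.1) q :=
    ContinuousAt.comp (f := fun y : Hyp n => y.1.1) (contDiffAt_unitGrad hρ.1 h1).continuousAt
      continuous_coord.continuousAt
  have h3 := hρ.eventually_outwardNormal hK
  refine h2.continuousWithinAt.congr_of_eventuallyEq ?_ (h3.self_of_nhds hq)
  filter_upwards [nhdsWithin_le_nhds h3, self_mem_nhdsWithin] with y hy hy' using hy hy'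

/-! ### Convex bodies and their normal geodesics -/

/-- A nonempty compact geodesically convex set with smooth boundary. -/
structure IsConvexBody (K : Set (Hyp n)) : Prop where
  compact : IsCompact K
  convex : IsGeodesicallyConvex K
  smooth : HasSmoothBoundary K
  nonempty : K.Nonempty

/-- The point at distance `t` from `q` on the outward normal geodesic of `∂K`. -/
noncomputable def normalExp (K : Set (Hyp n)) (q : Hyp n) (t : ℝ) : Hyp n :=
  graph (geodesic q (outwardNormal K q) t).1

/-- The hyperbolic cosine of the distance to `K`. -/
noncomputable def coshDist (K : Set (Hyp n)) (y : Hyp n) : ℝ :=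
  sInf ((fun x : Hyp n => -lorentz x.1 y.1) '' K)

/-- The distance to `K`. -/
noncomputable def distTo (K : Set (Hyp n)) (y : Hyp n) : ℝ := Real.arcosh (coshDist K y)

open Classical in
/-- The foot point on `∂K` of a point outside `K`. -/
noncomputable def footPoint (K : Set (Hyp n)) (y : Hyp n) : Hyp n :=
  if h : ∃ q ∈ frontier K, ∃ t : ℝ, 0 < t ∧ y = normalExp K q t then h.choose else y

theorem coshDist_of_mem {K : Set (Hyp n)} {y : Hyp n} (hy : y ∈ K) : coshDist K y = 1 := by
  refine IsLeast.csInf_eq ⟨⟨y, hy, by simp [lorentz_hyp_self]⟩, ?_⟩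
  rintro _ ⟨x, -, rfl⟩
  have := lorentz_hyp_le x y
  simp only
  linarith

theorem distTo_of_mem {K : Set (Hyp n)} {y : Hyp n} (hy : y ∈ K) : distTo K y = 0 := by
  rw [distTo, coshDist_of_mem hy, Real.arcosh_zero]

theorem coshDist_le {K : Set (Hyp n)} {x : Hyp n} (hx : x ∈ K) (y : Hyp n) : coshDist K y ≤ -lorentz x.1 y.1 := by
  refine csInf_le ⟨1, ?_⟩ ⟨x, hx, rfl⟩
  rintro _ ⟨z, -, rfl⟩
  have := lorentz_hyp_le z y
  simp only
  linarith

namespace IsConvexBody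

variable {K : Set (Hyp n)} (hK : IsConvexBody K)
include hK

theorem isClosed : IsClosed K := hK.compact.isClosed

theorem frontier_subset : frontier K ⊆ K := hK.isClosed.frontier_subset

theorem isCompact_frontier : IsCompact (frontier K) :=
  hK.compact.of_isClosed_subset isClosed_frontier hK.frontier_subset

theorem normal {q : Hyp n} (hq : q ∈ frontier K) : IsOutwardUnitNormal K q (outwardNormal K q) :=
  isOutwardUnitNormal_outwardNormal hK.smooth hq

theorem normalExp_coe {q : Hyp n} (hq : q ∈ frontier K) (t : ℝ) :
    (normalExp K q t).1 = geodesic q (outwardNormal K q) t :=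
  graph_geodesic (hK.normal hq).1 (hK.normal hq).2.1 t

/-- The support inequality, where convexity is used: the geodesic from `q` to `x` stays in `K`,
hence its initial velocity `v` satisfies `⟨v, N⟩ ≤ 0`, while `⟨q, N⟩ = 0` removes the other
component of `x`. -/
theorem lorentz_normal_le {q x : Hyp n} (hq : q ∈ frontier K) (hx : x ∈ K) :
    lorentz x.1 (outwardNormal K q) ≤ 0 := by
  have hN := hK.normal hq
  by_cases hxq : x = q
  · rw [hxq]; exact hN.1.le
  obtain ⟨v, t, ht, hv, hv1, hx'⟩ := exists_geodesic hxq
  have hmem := hK.convex q (hK.frontier_subset hq) v hv hv1 t ht.le ⟨x, hx, hx'⟩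
  have hd : HasDerivAt (fun s => (geodesic q v s).1) v.1 0 := by
    have h1 := ((Real.hasDerivAt_cosh 0).smul_const q.1.1).add
      ((Real.hasDerivAt_sinh 0).smul_const v.1)
    rw [Real.sinh_zero, Real.cosh_zero, zero_smul, zero_add, one_smul] at h1
    exact h1
  have h1 : lorentz (outwardNormal K q) v ≤ 0 := by
    refine hN.lorentz_le hv (γ := fun s => (geodesic q v s).1) (by simp [geodesic]) hd ?_
    have : Set.Ioc 0 t ∈ 𝓝[>] (0 : ℝ) := Ioc_mem_nhdsGT ht
    filter_upwards [this] with s hs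
    obtain ⟨z, hz, hzs⟩ := hmem s ⟨hs.1.le, hs.2⟩
    rwa [← hzs, graph_coord]
  have h2 : lorentz q.1 (outwardNormal K q) = 0 := hN.1
  rw [hx', lorentz_geodesic_left, h2, lorentz_comm v]
  have := mul_nonpos_of_nonneg_of_nonpos (Real.sinh_pos_iff.2 ht).le h1
  linarith

theorem lorentz_normalExp_le {q x : Hyp n} (hq : q ∈ frontier K) (hx : x ∈ K) {t : ℝ}
    (ht : 0 ≤ t) : Real.cosh t * -lorentz x.1 q.1 ≤ -lorentz x.1 (normalExp K q t).1 := by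
  rw [hK.normalExp_coe hq, lorentz_comm _ (geodesic _ _ _), lorentz_geodesic_left,
    lorentz_comm q.1, lorentz_comm _ x.1]
  have := mul_nonpos_of_nonneg_of_nonpos (Real.sinh_nonneg_iff.2 ht) (hK.lorentz_normal_le hq hx)
  linarith

theorem lorentz_normalExp_self {q : Hyp n} (hq : q ∈ frontier K) (t : ℝ) :
    -lorentz q.1 (normalExp K q t).1 = Real.cosh t := by
  have h2 : lorentz q.1 (outwardNormal K q) = 0 := (hK.normal hq).1
  rw [hK.normalExp_coe hq, lorentz_comm _ (geodesic _ _ _), lorentz_geodesic_left,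
    lorentz_hyp_self, lorentz_comm _ q.1, h2]
  ring

theorem isLeast_normalExp {q : Hyp n} (hq : q ∈ frontier K) {t : ℝ} (ht : 0 ≤ t) :
    IsLeast ((fun x : Hyp n => -lorentz x.1 (normalExp K q t).1) '' K) (Real.cosh t) := by
  refine ⟨⟨q, hK.frontier_subset hq, hK.lorentz_normalExp_self hq t⟩, ?_⟩
  rintro _ ⟨x, hx, rfl⟩
  have h1 := hK.lorentz_normalExp_le hq hx ht
  have h2 := lorentz_hyp_le x q
  have := Real.cosh_pos t
  simp only
  nlinarith

theorem coshDist_normalExp {q : Hyp n} (hq : q ∈ frontier K) {t : ℝ} (ht : 0 ≤ t) :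
    coshDist K (normalExp K q t) = Real.cosh t := (hK.isLeast_normalExp hq ht).csInf_eq

theorem distTo_normalExp {q : Hyp n} (hq : q ∈ frontier K) {t : ℝ} (ht : 0 ≤ t) :
    distTo K (normalExp K q t) = t := by
  rw [distTo, hK.coshDist_normalExp hq ht, Real.arcosh_cosh ht]

theorem one_le_coshDist (y : Hyp n) : 1 ≤ coshDist K y := by
  refine le_csInf (hK.nonempty.image _) ?_
  rintro _ ⟨z, -, rfl⟩
  have := lorentz_hyp_le z y
  simp only
  linarith

theorem continuous_coshDist : Continuous (coshDist K) := by
  refine hK.compact.continuous_sInf (f := fun (y : Hyp n) (x : Hyp n) => -lorentz x.1 y.1) ?_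
  exact (Continuous.lorentz (by fun_prop) (by fun_prop)).neg

theorem continuous_distTo : Continuous (distTo K) :=
  Real.continuousOn_arcosh.comp_continuous hK.continuous_coshDist hK.one_le_coshDist

theorem normalExp_not_mem {q : Hyp n} (hq : q ∈ frontier K) {t : ℝ} (ht : 0 < t) :
    normalExp K q t ∉ K := fun h => by
  have h1 := distTo_of_mem h
  rw [hK.distTo_normalExp hq ht.le] at h1
  exact ht.ne' h1

/-- The time is the distance to `K`. At equal times, `lorentz_normalExp_le` gives `cosh t * -⟨q', q⟩
≤ cosh t`, so `q'` and `q` are in the equality case of `lorentz_hyp_le`. -/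
theorem normalExp_inj {q q' : Hyp n} (hq : q ∈ frontier K) (hq' : q' ∈ frontier K) {t t' : ℝ}
    (ht : 0 ≤ t) (ht' : 0 ≤ t') (h : normalExp K q t = normalExp K q' t') : q = q' ∧ t = t' := by
  have h1 : t = t' := by
    rw [← hK.distTo_normalExp hq ht, h, hK.distTo_normalExp hq' ht']
  refine ⟨?_, h1⟩
  have h2 := hK.lorentz_normalExp_le hq (hK.frontier_subset hq') ht
  rw [h, hK.lorentz_normalExp_self hq', ← h1] at h2
  have h3 := Real.cosh_pos t
  refine (eq_of_lorentz_hyp ?_).symm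
  by_contra! h4
  nlinarith

/-- Take `q` nearest to `y` and let `v` be the direction from `q` to `y`. By the first variation,
`v` has no positive component along a direction `w` pointing into `K`. This forces `q` onto the
boundary (else `w = v` is admissible) and `v` to be the outward normal. -/
theorem exists_normalExp {y : Hyp n} (hy : y ∉ K) :
    ∃ q ∈ frontier K, ∃ t : ℝ, 0 < t ∧ y = normalExp K q t := by
  obtain ⟨q, hq, hmin⟩ := hK.compact.exists_isMinOn hK.nonempty
    (f := fun x : Hyp n => -lorentz x.1 y.1)
    (Continuous.lorentz (by fun_prop) (by fun_prop)).neg.continuousOn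
  have hne : y ≠ q := fun h => hy (h ▸ hq)
  obtain ⟨v, t, ht, hv, hv1, hyv⟩ := exists_geodesic hne
  have hs := Real.sinh_pos_iff.2 ht
  have key (w : Mink n) (hw : IsTangent q w)
      (hwK : ∀ᶠ s in 𝓝[>] (0 : ℝ), graph (q.1.1 + s • w.1) ∈ K) : lorentz v w ≤ 0 := by
    by_contra! hvw
    have hd := (hasDerivAt_lorentz (hasDerivAt_coordLine hw) (hasDerivAt_const (0 : ℝ) y.1)).neg
    have hd2 := hd.add_const (lorentz q.1 y.1)
    have h1 := eventually_neg_of_hasDerivAt hd2 (by simp [graph_coord]) (by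
      rw [coordLine_zero, lorentz_zero_right, hyv, lorentz_comm w, lorentz_geodesic_left]
      have h0 : lorentz q.1 w = 0 := hw
      rw [h0]
      have := mul_pos hs hvw
      linarith)
    obtain ⟨s, hs1, hs2⟩ := (h1.and hwK).exists
    have h2 : -lorentz q.1 y.1 ≤ -lorentz (graph (q.1.1 + s • w.1)).1 y.1 := hmin hs2
    simp only [Pi.neg_apply] at hs1
    linarith
  have hqf : q ∈ frontier K := by
    refine ⟨subset_closure hq, fun hi => ?_⟩
    have h1 := (tendsto_curve (q := q) (v := v) (γ := fun s => q.1.1 + s • v.1)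
      (by simp) (hasDerivAt_line _ _)).eventually (mem_interior_iff_mem_nhds.1 hi)
    have := key v hv h1
    linarith
  have hN := hK.normal hqf
  have hvN : outwardNormal K q = v := eq_of_halfspace hN.1 hv hN.2.1 hv1 fun w hw hvw =>
    key w hw (hN.eventually_mem hw hvw)
  refine ⟨q, hqf, t, ht, Subtype.ext ?_⟩
  rw [hK.normalExp_coe hqf, hvN, hyv]

theorem footPoint_spec {y : Hyp n} (hy : y ∉ K) :
    footPoint K y ∈ frontier K ∧ 0 < distTo K y ∧
      y = normalExp K (footPoint K y) (distTo K y) := by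
  have h := hK.exists_normalExp hy
  have h1 : footPoint K y = h.choose := dif_pos h
  obtain ⟨h2, t, ht, h3⟩ := h.choose_spec
  rw [← h1] at h2 h3
  have h4 : distTo K y = t := by rw [h3, hK.distTo_normalExp h2 ht.le]
  rw [h4]
  exact ⟨h2, ht, h3⟩

theorem footPoint_normalExp {q : Hyp n} (hq : q ∈ frontier K) {t : ℝ} (ht : 0 < t) :
    footPoint K (normalExp K q t) = q := by
  obtain ⟨h1, h2, h3⟩ := hK.footPoint_spec (hK.normalExp_not_mem hq ht)
  exact ((hK.normalExp_inj hq h1 ht.le h2.le h3).1).symm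

theorem continuousOn_normalExp :
    ContinuousOn (fun x : Hyp n × ℝ => normalExp K x.1 x.2) (frontier K ×ˢ Set.univ) := by
  refine continuous_graph.comp_continuousOn ?_
  have h1 : ContinuousOn (fun x : Hyp n × ℝ => outwardNormal K x.1) (frontier K ×ˢ Set.univ) :=
    (continuousOn_outwardNormal hK.isClosed hK.smooth).comp continuousOn_fst fun x hx => hx.1
  unfold geodesic
  refine continuous_fst.comp_continuousOn (ContinuousOn.add ?_ (ContinuousOn.smul (f := fun x : Hyp n × ℝ => Real.sinh x.2) ?_ h1))
  · exact Continuous.continuousOn (by fun_prop)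
  · exact Continuous.continuousOn (by fun_prop)

/-- The closed parallel sets are compact. -/
theorem isCompact_parallel (T : ℝ) : IsCompact {y | distTo K y ≤ T} := by
  have h1 : IsCompact ((fun x : Hyp n × ℝ => normalExp K x.1 x.2) ''
      (frontier K ×ˢ Set.Icc 0 T)) :=
    (hK.isCompact_frontier.prod isCompact_Icc).image_of_continuousOn
      (hK.continuousOn_normalExp.mono (Set.prod_mono_right (Set.subset_univ _)))
  refine (hK.compact.union h1).of_isClosed_subset
    (isClosed_le hK.continuous_distTo continuous_const) fun y hy => ?_
  by_cases hyK : y ∈ K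
  · exact Or.inl hyK
  · obtain ⟨h2, h3, h4⟩ := hK.footPoint_spec hyK
    exact Or.inr ⟨(footPoint K y, distTo K y), ⟨h2, h3.le, hy⟩, h4.symm⟩

end IsConvexBody

/-! ### Local parametrizations of the boundary -/

/-- The kernel of `l` has dimension `n - 1`; projecting onto it along a vector with `l v = 1` gives
the remaining coordinates. -/
theorem exists_straightening (hn : 1 ≤ n) {l : E n →L[ℝ] ℝ} (hl : l ≠ 0) :
    ∃ C : E n ≃L[ℝ] E (n - 1) × ℝ, ∀ x, (C x).2 = l x := by
  obtain ⟨v, hv⟩ : ∃ v, l v = 1 := by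
    obtain ⟨v, hv⟩ : ∃ v, l v ≠ 0 := by
      by_contra! h
      exact hl (ContinuousLinearMap.ext h)
    exact ⟨(l v)⁻¹ • v, by simp [hv]⟩
  have hl' : (l.toLinearMap : Module.Dual ℝ (E n)) ≠ 0 := fun h =>
    hl (ContinuousLinearMap.ext fun x => LinearMap.congr_fun h x)
  have hfr := Module.Dual.finrank_ker_add_one_of_ne_zero hl'
  rw [finrank_euclideanSpace_fin] at hfr
  let α : LinearMap.ker l.toLinearMap ≃ₗ[ℝ] E (n - 1) :=
    LinearEquiv.ofFinrankEq _ _ (by rw [finrank_euclideanSpace_fin]; omega)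
  let P : E n →ₗ[ℝ] LinearMap.ker l.toLinearMap :=
    LinearMap.codRestrict _ (LinearMap.id - l.toLinearMap.smulRight v) fun x => by
      simp [hv]
  let p : E n →ₗ[ℝ] E (n - 1) × ℝ := (α.toLinearMap ∘ₗ P).prod l.toLinearMap
  have hp : Function.Injective p := by
    rw [injective_iff_map_eq_zero]
    intro x hx
    have h1 : α (P x) = 0 := congrArg Prod.fst hx
    have h2 : l x = 0 := congrArg Prod.snd hx
    have h3 : P x = 0 := by simpa using h1
    have h4 : x - l x • v = 0 := congrArg Subtype.val h3
    simpa [h2] using h4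
  let e := LinearEquiv.ofInjectiveOfFinrankEq p hp (by
    simp only [Module.finrank_prod, finrank_euclideanSpace_fin, Module.finrank_self]; omega)
  exact ⟨e.toContinuousLinearEquiv, fun x => rfl⟩

/-- Near each of its points a smooth boundary is parametrized by a patch whose inverse is linear
in the global coordinates. -/
theorem exists_patch (hn : 1 ≤ n) {K : Set (Hyp n)} (hKc : IsClosed K) (hK : HasSmoothBoundary K)
    {q : Hyp n} (hq : q ∈ frontier K) :
    ∃ (U : Set (E (n - 1))) (φ : E (n - 1) → Hyp n) (O : Set (Hyp n)) (P : E n →L[ℝ] E (n - 1)),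
      IsPatch (frontier K) U φ ∧ IsOpen O ∧ q ∈ O ∧
        ∀ y ∈ frontier K, y ∈ O → P y.1.1 ∈ U ∧ φ (P y.1.1) = y := by
  obtain ⟨ρ, hρ⟩ := hK q hq
  set r : E n → ℝ := fun x => ρ (graph x) with hr
  have hrs : ContDiff ℝ ∞ r := hρ.1
  set x₀ := q.1.1 with hx₀
  have hl : fderiv ℝ r x₀ ≠ 0 := by
    obtain ⟨v, -, hv⟩ := hρ.2.2.1
    intro h
    apply hv
    change fderiv ℝ r x₀ v.1 = 0
    rw [h]; rfl
  obtain ⟨C, hC⟩ := exists_straightening hn hl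
  -- `G` replaces the linear last coordinate of `C` by `r` itself. Both have the same differential
  -- at `x₀`, so `G` is a local diffeomorphism that flattens the boundary to height `0`; its other
  -- coordinates stay linear, and they form the inverse `P` of the patch.
  let G : E n → E (n - 1) × ℝ := fun x => ((C x).1, r x)
  have hG : ContDiff ℝ ∞ G := C.contDiff.fst.prodMk hrs
  have hG' (x : E n) : HasFDerivAt G
      (((ContinuousLinearMap.fst ℝ _ _).comp C.toContinuousLinearMap).prod (fderiv ℝ r x)) x :=
    (C.hasFDerivAt.fst).prodMk ((hrs.differentiable (by simp)) x).hasFDerivAt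
  have hG0 : HasFDerivAt G (C : E n →L[ℝ] E (n - 1) × ℝ) x₀ := by
    convert! hG' x₀ using 1
    ext x
    · rfl
    · exact hC x
  have hinv : ∀ᶠ x in 𝓝 x₀, ∃ e : E n ≃L[ℝ] E (n - 1) × ℝ, HasFDerivAt G e.toContinuousLinearMap x := by
    have h1 : ContinuousAt (fderiv ℝ G) x₀ := (hG.continuous_fderiv (by simp)).continuousAt
    have h2 := h1.eventually (by rw [hG0.fderiv]; exact C.nhds)
    filter_upwards [h2] with x hx
    obtain ⟨e, he⟩ := hx
    refine ⟨e, ?_⟩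
    rw [he]
    exact (hG.differentiable (by simp) x).hasFDerivAt
  have hfr : ∀ᶠ x in 𝓝 x₀, graph x ∈ frontier K ↔ r x = 0 := by
    have := continuous_graph.continuousAt (x := x₀)
    refine this.eventually (p := fun y => y ∈ frontier K ↔ ρ y = 0) ?_
    rw [hx₀, graph_coord]
    exact hρ.eventually_frontier_iff hKc
  -- On `W` the differential of `G` is invertible at every point, so the local inverse is smooth on
  -- the whole patch and not only at the centre, and the boundary is exactly `{r = 0}`.
  obtain ⟨W, hW, hWo, hxW⟩ := eventually_nhds_iff.1 (hinv.and hfr)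
  let h := (hG.contDiffAt.toOpenPartialHomeomorph G hG0 (by simp)).restrOpen W hWo
  have hcoe (x : E n) : h x = G x := rfl
  have hsrc : x₀ ∈ h.source :=
    ⟨hG.contDiffAt.mem_toOpenPartialHomeomorph_source hG0 (by simp), hxW⟩
  have hsW : h.source ⊆ W := fun x hx => hx.2
  let U : Set (E (n - 1)) := {u | (u, (0 : ℝ)) ∈ h.target}
  let φ : E (n - 1) → Hyp n := fun u => graph (h.symm (u, 0))
  let P : E n →L[ℝ] E (n - 1) := (ContinuousLinearMap.fst ℝ _ _).comp C.toContinuousLinearMap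
  have hUo : IsOpen U := h.open_target.preimage (by fun_prop)
  have hPφ (u : E (n - 1)) (hu : u ∈ U) : P (φ u).1.1 = u ∧ r (φ u).1.1 = 0 := by
    have h1 : G (h.symm (u, 0)) = (u, 0) := h.right_inv hu
    exact ⟨congrArg Prod.fst h1, congrArg Prod.snd h1⟩
  have hsm (u : E (n - 1)) (hu : u ∈ U) : ContDiffAt ℝ ∞ (fun u => (φ u).1) u := by
    obtain ⟨e, he⟩ := (hW _ (hsW (h.map_target hu))).1
    have h1 : ContDiffAt ℝ ∞ h.symm (u, (0 : ℝ)) := h.contDiffAt_symm hu he hG.contDiffAt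
    have h2 : ContDiffAt ℝ ∞ (fun u : E (n - 1) => h.symm (u, (0 : ℝ))) u :=
      ContDiffAt.comp u h1 (contDiffAt_id.prodMk contDiffAt_const)
    exact contDiff_graph.contDiffAt.comp u h2
  refine ⟨U, φ, {y | y.1.1 ∈ h.source}, P, ⟨hUo, fun u hu => ?_, fun u hu v hv huv => ?_,
    fun u hu => (hsm u hu).contDiffWithinAt, fun u hu => ?_⟩,
    h.open_source.preimage continuous_coord, hsrc, fun y hy hyO => ?_⟩
  · exact (hW _ (hsW (h.map_target hu))).2.2 (hPφ u hu).2
  · rw [← (hPφ u hu).1, huv, (hPφ v hv).1]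
  · have h1 := ((hsm u hu).differentiableAt (by simp)).hasFDerivAt
    have h2 := (P.comp (ContinuousLinearMap.fst ℝ (E n) ℝ)).hasFDerivAt.comp u h1
    have h3 := h2.congr_of_eventuallyEq (f₁ := id) (by
      filter_upwards [hUo.mem_nhds hu] with v hv using (hPφ v hv).1.symm)
    have h4 := h3.unique (hasFDerivAt_id u)
    -- Differentiating `P ∘ φ = id` exhibits a left inverse of the differential of `φ`.
    refine Function.LeftInverse.injective (g := P.comp (ContinuousLinearMap.fst ℝ (E n) ℝ)) fun w => ?_
    exact congrArg (fun L : E (n - 1) →L[ℝ] E (n - 1) => L w) h4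
  · have hr0 : r y.1.1 = 0 := by
      refine (hW _ (hsW hyO)).2.1 ?_
      rwa [graph_coord]
    have h1 : h y.1.1 = (P y.1.1, 0) := Prod.ext rfl hr0
    have h2 := h.map_source hyO
    have h3 := h.left_inv hyO
    rw [h1] at h2 h3
    refine ⟨h2, ?_⟩
    change graph (h.symm (P y.1.1, 0)) = y
    rw [h3, graph_coord]

/-! ### The shape operator in a patch -/

theorem boundaryTangent_isTangent {K : Set (Hyp n)} {q : Hyp n} {v : Mink n}
    (h : v ∈ boundaryTangent K q) : IsTangent q v := h.1

theorem hasFDerivWithinAt_outwardNormal {K : Set (Hyp n)} (hKc : IsClosed K)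
    (hK : HasSmoothBoundary K) {q : Hyp n} (hq : q ∈ frontier K) :
    HasFDerivWithinAt (fun x : E n => outwardNormal K (graph x))
      (fderivWithin ℝ (fun x : E n => outwardNormal K (graph x)) (graph ⁻¹' frontier K) q.1.1)
      (graph ⁻¹' frontier K) q.1.1 := by
  obtain ⟨ρ, hρ⟩ := hK q hq
  have h1 := contDiffAt_unitGrad hρ.1 ((lorentz_grad_pos_iff ρ q).2 hρ.2.2.1)
  have h2 := hρ.eventually_outwardNormal hKc
  have h3 : ∀ᶠ x in 𝓝 q.1.1, graph x ∈ frontier K → outwardNormal K (graph x) = unitGrad ρ x := by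
    refine (continuous_graph.continuousAt (x := q.1.1)).eventually
      (p := fun y => y ∈ frontier K → outwardNormal K y = unitGrad ρ y.1.1) ?_
    rw [graph_coord]
    exact h2
  refine DifferentiableWithinAt.hasFDerivWithinAt ?_
  refine ((h1.differentiableAt (by simp)).differentiableWithinAt).congr_of_eventuallyEq ?_ ?_
  · filter_upwards [nhdsWithin_le_nhds h3, self_mem_nhdsWithin] with x hx hx' using hx hx'
  · exact h3.self_of_nhds (by simpa [graph_coord] using hq)

/-- A tangent vector is determined by its first component, and the first component of the normal is
not attained. The opposite bound comes from the differential of a patch, which embeds `E (n - 1)`.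
-/
theorem finrank_boundaryTangent_lt {K : Set (Hyp n)} (hK : HasSmoothBoundary K) {q : Hyp n}
    (hq : q ∈ frontier K) : Module.finrank ℝ (boundaryTangent K q) < n := by
  have hN := isOutwardUnitNormal_outwardNormal hK hq
  let f : boundaryTangent K q →ₗ[ℝ] E n := LinearMap.fst ℝ (E n) ℝ ∘ₗ (boundaryTangent K q).subtype
  have hf : Function.Injective f := fun v w h =>
    Subtype.ext (tangent_ext (boundaryTangent_isTangent v.2) (boundaryTangent_isTangent w.2) h)
  have hr : LinearMap.range f ≠ ⊤ := by
    intro h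
    obtain ⟨v, hv⟩ : (outwardNormal K q).1 ∈ LinearMap.range f := h ▸ Submodule.mem_top
    have h1 : v.1 = outwardNormal K q := tangent_ext (boundaryTangent_isTangent v.2) hN.1 hv
    have h2 := v.2.2
    rw [h1, hN.2.1] at h2
    exact one_ne_zero h2
  have h1 := Submodule.finrank_lt hr
  rwa [LinearMap.finrank_range_of_inj hf, finrank_euclideanSpace_fin] at h1

/-- The Lorentz form on the tangent space of the boundary. -/
noncomputable def tangentForm (K : Set (Hyp n)) (q : Hyp n) :
    boundaryTangent K q →ₗ[ℝ] boundaryTangent K q →ₗ[ℝ] ℝ :=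
  LinearMap.mk₂ ℝ (fun v w => lorentz v.1 w.1) (fun _ _ _ => lorentz_add_left _ _ _)
    (fun _ _ _ => lorentz_smul_left _ _ _) (fun _ _ _ => lorentz_add_right _ _ _)
    (fun _ _ _ => lorentz_smul_right _ _ _)

theorem tangentForm_pos {K : Set (Hyp n)} {q : Hyp n} (v : boundaryTangent K q) (hv : v ≠ 0) :
    0 < tangentForm K q v v := by
  by_contra! h
  exact hv (Subtype.ext (eq_zero_of_lorentz_self (boundaryTangent_isTangent v.2) h))

/-- The Jacobian of the normal exponential map of `∂K`. -/
noncomputable def jac (K : Set (Hyp n)) (q : Hyp n) (t : ℝ) : ℝ :=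
  ∑ i ∈ Finset.range n, Real.cosh t ^ (n - 1 - i) * Real.sinh t ^ i * meanCurvature K i q

namespace IsPatch

variable {K : Set (Hyp n)} {U : Set (E (n - 1))} {φ : E (n - 1) → Hyp n} {u : E (n - 1)}

section

variable (hφ : IsPatch (frontier K) U φ) (hu : u ∈ U)
include hφ hu

theorem contDiffAt : ContDiffAt ℝ ∞ (fun w => (φ w).1) u :=
  hφ.smooth.contDiffAt (hφ.isOpen.mem_nhds hu)

theorem hasFDerivAt :
    HasFDerivAt (fun w => (φ w).1) (fderiv ℝ (fun w => (φ w).1) u) u :=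
  ((hφ.contDiffAt hu).differentiableAt (by simp)).hasFDerivAt

theorem contDiffAt_coord : ContDiffAt ℝ ∞ (fun w => (φ w).1.1) u := (hφ.contDiffAt hu).fst

theorem continuousAt : ContinuousAt φ u :=
  Topology.IsInducing.subtypeVal.continuousAt_iff.2 (hφ.contDiffAt hu).continuousAt

theorem eventually_mem : ∀ᶠ v in 𝓝 u, v ∈ U := hφ.isOpen.mem_nhds hu

theorem isTangent_fderiv (w : E (n - 1)) : IsTangent (φ u) (fderiv ℝ (fun w => (φ w).1) u w) := by
  obtain ⟨L, hL, hL'⟩ := hasFDerivAt_lorentz (hφ.hasFDerivAt hu) (hφ.hasFDerivAt hu)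
  have h0 : (fun x => lorentz (φ x).1 (φ x).1) = fun _ => -1 := by
    funext x; exact lorentz_hyp_self _
  rw [h0] at hL
  have h2 := hL' w
  rw [hL.unique (hasFDerivAt_const _ _), lorentz_comm _ (φ u).1] at h2
  simp only [_root_.zero_apply] at h2
  unfold IsTangent
  linarith

variable (hKc : IsClosed K) (hK : HasSmoothBoundary K)
include hKc hK

theorem contDiffAt_normal : ContDiffAt ℝ ∞ (fun w => outwardNormal K (φ w)) u := by
  obtain ⟨ρ, hρ⟩ := hK _ (hφ.mapsTo hu)
  have h1 := contDiffAt_unitGrad hρ.1 ((lorentz_grad_pos_iff ρ (φ u)).2 hρ.2.2.1)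
  have h2 := h1.comp u (hφ.contDiffAt_coord hu)
  refine h2.congr_of_eventuallyEq ?_
  filter_upwards [(hφ.continuousAt hu).eventually (hρ.eventually_outwardNormal hKc),
    hφ.eventually_mem hu] with v hv hv' using hv (hφ.mapsTo hv')

theorem hasFDerivAt_normal : HasFDerivAt (fun w => outwardNormal K (φ w))
    (fderiv ℝ (fun w => outwardNormal K (φ w)) u) u :=
  ((hφ.contDiffAt_normal hu hKc hK).differentiableAt (by simp)).hasFDerivAt

/-- The chain rule for derivatives within the boundary: a patch stays in `∂K`, so it sees only the
boundary values of the normal. -/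
theorem fderiv_normal (w : E (n - 1)) : fderiv ℝ (fun w => outwardNormal K (φ w)) u w =
    normalDeriv K (φ u) (fderiv ℝ (fun w => (φ w).1) u w) := by
  have h1 := hasFDerivWithinAt_outwardNormal hKc hK (hφ.mapsTo hu)
  have h2 : HasFDerivWithinAt (fun w => (φ w).1.1) _ U u :=
    (hφ.hasFDerivAt hu).fst.hasFDerivWithinAt
  have h3 := h1.comp u h2 fun v hv => by
    change graph (φ v).1.1 ∈ frontier K
    rw [graph_coord]; exact hφ.mapsTo hv
  have h4 := h3.hasFDerivAt (hφ.isOpen.mem_nhds hu)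
  have h5 : ((fun x : E n => outwardNormal K (graph x)) ∘ fun w => (φ w).1.1) =
      fun w => outwardNormal K (φ w) := by
    funext w; simp [graph_coord]
  rw [h5] at h4
  rw [h4.fderiv]
  rfl

theorem lorentz_normal_fderiv (w : E (n - 1)) :
    lorentz (outwardNormal K (φ u)) (fderiv ℝ (fun w => (φ w).1) u w) = 0 := by
  obtain ⟨ρ, hρ⟩ := hK _ (hφ.mapsTo hu)
  have hw := hφ.isTangent_fderiv hu w
  have h1 : HasFDerivAt (fun w => (φ w).1.1) _ u := (hφ.hasFDerivAt hu).fst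
  have h2 := ((hρ.1.differentiableAt (φ u).1.1).hasFDerivAt).comp u h1
  have h3 : ((fun x : E n => ρ (graph x)) ∘ fun w => (φ w).1.1) =ᶠ[𝓝 u] fun _ => 0 := by
    filter_upwards [(hφ.continuousAt hu).eventually (hρ.eventually_frontier_iff hKc),
      hφ.eventually_mem hu] with v hv hv'
    simp only [Function.comp_def, graph_coord]
    exact hv.1 (hφ.mapsTo hv')
  have h4 := (h2.congr_of_eventuallyEq h3.symm).unique (hasFDerivAt_const _ _)
  have h5 : diff ρ (φ u) (fderiv ℝ (fun w => (φ w).1) u w) = 0 :=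
    congrArg (fun L : E (n - 1) →L[ℝ] ℝ => L w) h4
  rw [hρ.isOutwardUnitNormal.eq, unitGrad, lorentz_smul_left, lorentz_grad ρ hw, h5, mul_zero]

theorem fderiv_mem (w : E (n - 1)) :
    fderiv ℝ (fun w => (φ w).1) u w ∈ boundaryTangent K (φ u) :=
  ⟨hφ.isTangent_fderiv hu w, hφ.lorentz_normal_fderiv hu hKc hK w⟩

theorem fderiv_normal_mem (w : E (n - 1)) :
    fderiv ℝ (fun w => outwardNormal K (φ w)) u w ∈ boundaryTangent K (φ u) := by
  have hN := hφ.hasFDerivAt_normal hu hKc hK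
  constructor
  · obtain ⟨L, hL, hL'⟩ := hasFDerivAt_lorentz (hφ.hasFDerivAt hu) hN
    have h0 : (fun x => lorentz (φ x).1 (outwardNormal K (φ x))) =ᶠ[𝓝 u] fun _ => 0 := by
      filter_upwards [hφ.eventually_mem hu] with v hv
      exact (isOutwardUnitNormal_outwardNormal hK (hφ.mapsTo hv)).1
    have h2 := hL' w
    rw [(hL.congr_of_eventuallyEq h0.symm).unique (hasFDerivAt_const _ _), lorentz_comm _
      (outwardNormal K (φ u)), hφ.lorentz_normal_fderiv hu hKc hK] at h2
    simpa using h2.symm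
  · obtain ⟨L, hL, hL'⟩ := hasFDerivAt_lorentz hN hN
    have h0 : (fun x => lorentz (outwardNormal K (φ x)) (outwardNormal K (φ x))) =ᶠ[𝓝 u]
        fun _ => 1 := by
      filter_upwards [hφ.eventually_mem hu] with v hv
      exact (isOutwardUnitNormal_outwardNormal hK (hφ.mapsTo hv)).2.1
    have h2 := hL' w
    rw [(hL.congr_of_eventuallyEq h0.symm).unique (hasFDerivAt_const _ _), lorentz_comm _
      (outwardNormal K (φ u))] at h2
    simp only [_root_.zero_apply] at h2
    linarith

/-- Differentiating `⟨N, dφ(b)⟩ = 0` in the direction `a` gives `⟨dN(a), dφ(b)⟩ = -⟨N, D²φ(a, b)⟩`,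
and second derivatives are symmetric. -/
theorem lorentz_fderiv_symm (w w' : E (n - 1)) :
    lorentz (fderiv ℝ (fun w => outwardNormal K (φ w)) u w) (fderiv ℝ (fun w => (φ w).1) u w') =
      lorentz (fderiv ℝ (fun w => outwardNormal K (φ w)) u w')
        (fderiv ℝ (fun w => (φ w).1) u w) := by
  have hN := hφ.hasFDerivAt_normal hu hKc hK
  have h1 : HasFDerivAt (fderiv ℝ (fun w => (φ w).1)) (fderiv ℝ (fderiv ℝ fun w => (φ w).1) u) u :=
    (((hφ.contDiffAt hu).fderiv_right (m := 1) (by norm_cast)).differentiableAt (by simp)).hasFDerivAt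
  have key (a b : E (n - 1)) :
      lorentz (outwardNormal K (φ u)) (fderiv ℝ (fderiv ℝ fun w => (φ w).1) u a b) +
        lorentz (fderiv ℝ (fun w => outwardNormal K (φ w)) u a)
          (fderiv ℝ (fun w => (φ w).1) u b) = 0 := by
    have h2 : HasFDerivAt (fun v => fderiv ℝ (fun w => (φ w).1) v b)
        ((fderiv ℝ (fderiv ℝ fun w => (φ w).1) u).flip b) u := by
      have := h1.clm_apply (hasFDerivAt_const b u)
      convert! this using 1
      ext x <;> simp
    obtain ⟨L, hL, hL'⟩ := hasFDerivAt_lorentz hN h2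
    have h0 : (fun x => lorentz (outwardNormal K (φ x)) (fderiv ℝ (fun w => (φ w).1) x b))
        =ᶠ[𝓝 u] fun _ => 0 := by
      filter_upwards [hφ.eventually_mem hu] with v hv
      exact hφ.lorentz_normal_fderiv hv hKc hK b
    have h3 := hL' a
    rw [(hL.congr_of_eventuallyEq h0.symm).unique (hasFDerivAt_const _ _)] at h3
    simpa using h3.symm
  have hs : IsSymmSndFDerivAt ℝ (fun w => (φ w).1) u :=
    (hφ.contDiffAt hu).isSymmSndFDerivAt (by simp; norm_cast)
  have h3 := key w w'
  have h4 := key w' w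
  rw [hs.eq w w'] at h3
  linarith

/-- The differential of a patch as an isomorphism onto the tangent space of the boundary. -/
theorem exists_tangentEquiv (hn : 1 ≤ n) : ∃ D : E (n - 1) ≃ₗ[ℝ] boundaryTangent K (φ u),
    ∀ w, (D w).1 = fderiv ℝ (fun w => (φ w).1) u w := by
  let f : E (n - 1) →ₗ[ℝ] boundaryTangent K (φ u) :=
    LinearMap.codRestrict _ (fderiv ℝ (fun w => (φ w).1) u).toLinearMap
      (hφ.fderiv_mem hu hKc hK)
  have hf : Function.Injective f := fun v w h => hφ.immersion u hu (congrArg Subtype.val h)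
  have h1 := LinearMap.finrank_le_finrank_of_injective hf
  have h2 := finrank_boundaryTangent_lt hK (hφ.mapsTo hu)
  rw [finrank_euclideanSpace_fin] at h1
  refine ⟨LinearEquiv.ofInjectiveOfFinrankEq f hf ?_, fun w => rfl⟩
  rw [finrank_euclideanSpace_fin]
  omega

/-- Vectors tangent to `∂K` come from the patch, and there the derivative of the normal is again
tangent. So the first alternative in `shapeOperator` is the one that applies. -/
theorem shapeOperator_apply (hn : 1 ≤ n) (v : boundaryTangent K (φ u)) {w : E (n - 1)}
    (hv : v.1 = fderiv ℝ (fun w => (φ w).1) u w) :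
    (shapeOperator K (φ u) v).1 = fderiv ℝ (fun w => outwardNormal K (φ w)) u w := by
  have h : ∀ v ∈ boundaryTangent K (φ u), normalDeriv K (φ u) v ∈ boundaryTangent K (φ u) := by
    intro v hv
    obtain ⟨D, hD⟩ := hφ.exists_tangentEquiv hu hKc hK hn
    have h1 : v = fderiv ℝ (fun w => (φ w).1) u (D.symm ⟨v, hv⟩) := by
      rw [← hD, D.apply_symm_apply]
    rw [h1, ← hφ.fderiv_normal hu hKc hK]
    exact hφ.fderiv_normal_mem hu hKc hK _
  rw [shapeOperator, dif_pos h, hφ.fderiv_normal hu hKc hK, ← hv]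
  rfl

end

section

variable (hK : IsConvexBody K) (hφ : IsPatch (frontier K) U φ) (hu : u ∈ U)
include hK hφ hu

/-- Monotonicity of the normal: for `x`, `y` on `∂K` one has `⟨N(y) - N(x), y - x⟩ = -⟨N(y), x⟩ -
⟨N(x), y⟩ ≥ 0` by the support inequality. Dividing by `s²` along a line in the parameter domain and
letting `s → 0` gives the claim. -/
theorem lorentz_fderiv_nonneg (w : E (n - 1)) :
    0 ≤ lorentz (fderiv ℝ (fun w => outwardNormal K (φ w)) u w)
      (fderiv ℝ (fun w => (φ w).1) u w) := by
  have hline := hasDerivAt_line u w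
  have h1 := hasDerivAt_iff_tendsto_slope.1
    ((hφ.hasFDerivAt hu).comp_hasDerivAt_of_eq (0 : ℝ) hline (by simp))
  have h2 := hasDerivAt_iff_tendsto_slope.1
    ((hφ.hasFDerivAt_normal hu hK.isClosed hK.smooth).comp_hasDerivAt_of_eq (0 : ℝ) hline (by simp))
  have h3 := (continuous_lorentz.tendsto _).comp (h2.prodMk_nhds h1)
  refine ge_of_tendsto h3 ?_
  have h4 : ∀ᶠ s in 𝓝 (0 : ℝ), u + s • w ∈ U := by
    refine hline.continuousAt.eventually (hφ.isOpen.mem_nhds ?_)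
    simpa using hu
  filter_upwards [nhdsWithin_le_nhds h4] with s hs
  have ha := hK.lorentz_normal_le (hφ.mapsTo hu) (hK.frontier_subset (hφ.mapsTo hs))
  have hb := hK.lorentz_normal_le (hφ.mapsTo hs) (hK.frontier_subset (hφ.mapsTo hu))
  have hc : lorentz (φ u).1 (outwardNormal K (φ u)) = 0 := (hK.normal (hφ.mapsTo hu)).1
  have hd : lorentz (φ (u + s • w)).1 (outwardNormal K (φ (u + s • w))) = 0 :=
    (hK.normal (hφ.mapsTo hs)).1
  simp only [Function.comp_def, slope, vsub_eq_sub, zero_smul, add_zero, lorentz_smul_left,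
    lorentz_smul_right, lorentz_sub_left, lorentz_sub_right, lorentz_comm (outwardNormal _ _),
    hc, hd, sub_zero]
  have he : 0 ≤ s⁻¹ * s⁻¹ := mul_self_nonneg _
  nlinarith

theorem shapeOperator_symm (hn : 1 ≤ n) (v w : boundaryTangent K (φ u)) :
    tangentForm K (φ u) (shapeOperator K (φ u) v) w =
      tangentForm K (φ u) v (shapeOperator K (φ u) w) := by
  obtain ⟨D, hD⟩ := hφ.exists_tangentEquiv hu hK.isClosed hK.smooth hn
  have h (v) := hD (D.symm v)
  simp only [D.apply_symm_apply] at h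
  change lorentz (shapeOperator K (φ u) v).1 w.1 = lorentz v.1 (shapeOperator K (φ u) w).1
  rw [hφ.shapeOperator_apply hu hK.isClosed hK.smooth hn v (h v),
    hφ.shapeOperator_apply hu hK.isClosed hK.smooth hn w (h w), lorentz_comm v.1, h v, h w]
  exact hφ.lorentz_fderiv_symm hu hK.isClosed hK.smooth _ _

theorem shapeOperator_nonneg (hn : 1 ≤ n) (v : boundaryTangent K (φ u)) :
    0 ≤ tangentForm K (φ u) (shapeOperator K (φ u) v) v := by
  obtain ⟨D, hD⟩ := hφ.exists_tangentEquiv hu hK.isClosed hK.smooth hn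
  have h := hD (D.symm v)
  rw [D.apply_symm_apply] at h
  change 0 ≤ lorentz (shapeOperator K (φ u) v).1 v.1
  rw [hφ.shapeOperator_apply hu hK.isClosed hK.smooth hn v h, h]
  exact hφ.lorentz_fderiv_nonneg hK hu _

end

end IsPatch

/-! ### Principal curvatures of a convex body and the product formula for the Jacobian. -/

namespace IsConvexBody

variable {K : Set (Hyp n)} (hK : IsConvexBody K) (hn : 1 ≤ n) {q : Hyp n} (hq : q ∈ frontier K)
include hK hn hq

theorem finrank_boundaryTangent : Module.finrank ℝ (boundaryTangent K q) = n - 1 := by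
  obtain ⟨U, φ, O, P, hφ, -, hqO, h⟩ := exists_patch hn hK.isClosed hK.smooth hq
  obtain ⟨hu, hφu⟩ := h q hq hqO
  obtain ⟨D, -⟩ := hφ.exists_tangentEquiv hu hK.isClosed hK.smooth hn
  rw [← hφu, ← D.finrank_eq, finrank_euclideanSpace_fin]

theorem shapeOperator_symm (v w : boundaryTangent K q) :
    tangentForm K q (shapeOperator K q v) w = tangentForm K q v (shapeOperator K q w) := by
  obtain ⟨U, φ, O, P, hφ, -, hqO, h⟩ := exists_patch hn hK.isClosed hK.smooth hq
  obtain ⟨hu, hφu⟩ := h q hq hqO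
  have := hφ.shapeOperator_symm hK hu hn
  rw [hφu] at this
  exact this v w

theorem shapeOperator_nonneg (v : boundaryTangent K q) :
    0 ≤ tangentForm K q (shapeOperator K q v) v := by
  obtain ⟨U, φ, O, P, hφ, -, hqO, h⟩ := exists_patch hn hK.isClosed hK.smooth hq
  obtain ⟨hu, hφu⟩ := h q hq hqO
  have := hφ.shapeOperator_nonneg hK hu hn
  rw [hφu] at this
  exact this v

theorem splits_shapeOperator : (shapeOperator K q).charpoly.Splits :=
  splits_charpoly_of_symmetric (fun x y => lorentz_comm x.1 y.1) tangentForm_pos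
    (hK.shapeOperator_symm hn hq)

theorem principalCurvatures_nonneg {k : ℝ} (hk : k ∈ principalCurvatures K q) : 0 ≤ k :=
  root_charpoly_nonneg tangentForm_pos (hK.shapeOperator_nonneg hn hq) hk

theorem card_principalCurvatures : (principalCurvatures K q).card = n - 1 := by
  rw [principalCurvatures, ← (hK.splits_shapeOperator hn hq).natDegree_eq_card_roots,
    LinearMap.charpoly_natDegree, hK.finrank_boundaryTangent hn hq]

theorem jac_eq_prod {t : ℝ} (ht : 0 < t) : jac K q t =
    ((principalCurvatures K q).map fun k => Real.cosh t + Real.sinh t * k).prod := by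
  rw [multiset_prod_eq_sum_esymm _ (Real.sinh_pos_iff.2 ht).ne',
    hK.card_principalCurvatures hn hq, Nat.sub_add_cancel hn]
  rfl

theorem jac_eq_det {t : ℝ} (ht : 0 < t) : jac K q t =
    LinearMap.det (Real.cosh t • LinearMap.id + Real.sinh t • shapeOperator K q) := by
  rw [hK.jac_eq_prod hn hq ht,
    det_add_smul_eq (hK.splits_shapeOperator hn hq) (Real.sinh_pos_iff.2 ht).ne']
  rfl

/-- The principal curvatures are nonnegative, so every factor is at least `cosh t ≥ 1`. -/
theorem one_le_jac {t : ℝ} (ht : 0 < t) : 1 ≤ jac K q t := by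
  rw [hK.jac_eq_prod hn hq ht]
  refine Multiset.one_le_prod ?_
  intro x hx
  obtain ⟨k, hk, rfl⟩ := Multiset.mem_map.1 hx
  have h1 := hK.principalCurvatures_nonneg hn hq hk
  have h2 := Real.one_le_cosh t
  have h3 := mul_nonneg (Real.sinh_pos_iff.2 ht).le h1
  linarith

theorem jac_mono {s t : ℝ} (hs : 0 < s) (hst : s ≤ t) : jac K q s ≤ jac K q t := by
  rw [hK.jac_eq_prod hn hq hs, hK.jac_eq_prod hn hq (hs.trans_le hst)]
  refine Multiset.prod_map_le_prod_map₀ _ _ ?_ ?_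
  · intro k hk
    have := mul_nonneg (Real.sinh_pos_iff.2 hs).le (hK.principalCurvatures_nonneg hn hq hk)
    have := Real.cosh_pos s
    linarith
  · intro k hk
    have h1 := hK.principalCurvatures_nonneg hn hq hk
    have h2 : Real.cosh s ≤ Real.cosh t := by
      rw [Real.cosh_le_cosh, abs_of_pos hs, abs_of_pos (hs.trans_le hst)]; exact hst
    have h3 := mul_le_mul_of_nonneg_right (Real.sinh_le_sinh.2 hst) h1
    linarith

end IsConvexBody

/-! ### The normal exponential map in a patch -/

theorem det_gramL_pos {k : ℕ} {A : E k →ₗ[ℝ] Mink n} {q : Hyp n} (hA : Function.Injective A)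
    (hq : ∀ w, IsTangent q (A w)) : 0 < (gramL A).det := by
  refine Matrix.PosDef.det_pos ?_
  refine Matrix.PosDef.of_dotProduct_mulVec_pos ?_ fun x hx => ?_
  · ext i j
    simp [gramL, lorentz_comm]
  · have h1 : star x ⬝ᵥ (gramL A).mulVec x =
        lorentz (A (WithLp.toLp 2 x)) (A (WithLp.toLp 2 x)) := by
      rw [euclidean_eq_sum (WithLp.toLp 2 x)]
      simp only [map_sum, map_smul, ← lorentzL_apply, dotProduct, Matrix.mulVec, gramL,
        Matrix.of_apply, FunLike.coe_sum, Finset.sum_apply, _root_.smul_apply, smul_eq_mul,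
        Finset.mul_sum, star_trivial]
      rw [Finset.sum_comm]
      refine Finset.sum_congr rfl fun i _ => Finset.sum_congr rfl fun j _ => ?_
      rw [lorentzL_apply]
      ring
    rw [h1]
    by_contra! h2
    have h3 := hA ((eq_zero_of_lorentz_self (hq _) h2).trans (map_zero A).symm)
    exact hx (by simpa using congrArg WithLp.ofLp h3)

theorem _root_.ContinuousAt.lorentz {X : Type*} [TopologicalSpace X] {f g : X → Mink n} {x : X}
    (hf : ContinuousAt f x) (hg : ContinuousAt g x) :
    ContinuousAt (fun x => HypCap.lorentz (f x) (g x)) x := by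
  unfold HypCap.lorentz
  exact (hf.fst.inner hg.fst).sub (hf.snd.mul hg.snd)

theorem continuousAt_det_gram {X : Type*} [TopologicalSpace X] {k : ℕ} {φ : E k → Hyp n}
    {f : X → E k} {x : X}
    (h : ContinuousAt (fun x => fderiv ℝ (fun w : E k => (φ w).1) (f x)) x) :
    ContinuousAt (fun x => (gram φ (f x)).det) x := by
  have h1 : ContinuousAt (fun x => gram φ (f x)) x := by
    refine continuousAt_pi.2 fun i => continuousAt_pi.2 fun j => ?_
    have hi (i : Fin k) := h.clm_apply (continuousAt_const (y := EuclideanSpace.single i (1 : ℝ)))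
    exact (hi i).lorentz (hi j)
  exact Filter.Tendsto.comp ((Continuous.matrix_det continuous_id).tendsto (gram φ (f x))) h1

/-- The coordinates of the normal exponential map over a patch. -/
noncomputable def tubeMap (K : Set (Hyp n)) (φ : E (n - 1) → Hyp n) (x : E (n - 1) × ℝ) : E n :=
  (geodesic (φ x.1) (outwardNormal K (φ x.1)) x.2).1

theorem graph_tubeMap (K : Set (Hyp n)) (φ : E (n - 1) → Hyp n) (x : E (n - 1) × ℝ) :
    graph (tubeMap K φ x) = normalExp K (φ x.1) x.2 := rfl

namespace IsPatch

variable {K : Set (Hyp n)} {U : Set (E (n - 1))} {φ : E (n - 1) → Hyp n} {u : E (n - 1)}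
  (hφ : IsPatch (frontier K) U φ) (hK : IsConvexBody K)
include hφ hK

theorem injOn_tubeMap : Set.InjOn (tubeMap K φ) (U ×ˢ Set.Ioi 0) := by
  rintro ⟨u, t⟩ ⟨hu, ht⟩ ⟨v, s⟩ ⟨hv, hs⟩ h
  have h1 := congrArg graph h
  rw [graph_tubeMap, graph_tubeMap] at h1
  obtain ⟨h2, h3⟩ := hK.normalExp_inj (hφ.mapsTo hu) (hφ.mapsTo hv) (le_of_lt ht) (le_of_lt hs) h1
  exact Prod.ext (hφ.injOn hu hv h2) h3

variable (hu : u ∈ U)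
include hu

omit hK in
theorem det_gram_pos : 0 < (gram φ u).det :=
  det_gramL_pos (hφ.immersion u hu) (hφ.isTangent_fderiv hu)

theorem contDiffAt_geodesic (t : ℝ) : ContDiffAt ℝ ∞ (fun x : E (n - 1) × ℝ =>
    geodesic (φ x.1) (outwardNormal K (φ x.1)) x.2) (u, t) := by
  have h1 : ContDiffAt ℝ ∞ (fun x : E (n - 1) × ℝ => (φ x.1).1) (u, t) :=
    ContDiffAt.comp (u, t) (g := fun w => (φ w).1) (f := Prod.fst) (hφ.contDiffAt hu) contDiffAt_fst
  have h2 : ContDiffAt ℝ ∞ (fun x : E (n - 1) × ℝ => outwardNormal K (φ x.1)) (u, t) :=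
    ContDiffAt.comp (u, t) (g := fun w => outwardNormal K (φ w)) (f := Prod.fst)
      (hφ.contDiffAt_normal hu hK.isClosed hK.smooth) contDiffAt_fst
  exact ((Real.contDiff_cosh.contDiffAt.comp (u, t) contDiffAt_snd).smul h1).add
    ((Real.contDiff_sinh.contDiffAt.comp (u, t) contDiffAt_snd).smul h2)

theorem contDiffAt_tubeMap (t : ℝ) : ContDiffAt ℝ ∞ (tubeMap K φ) (u, t) :=
  (hφ.contDiffAt_geodesic hK hu t).fst

theorem hasFDerivAt_tubeMap (t : ℝ) :
    HasFDerivAt (tubeMap K φ) (fderiv ℝ (tubeMap K φ) (u, t)) (u, t) :=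
  ((hφ.contDiffAt_tubeMap hK hu t).differentiableAt (by simp)).hasFDerivAt

/-- The first bracket is `cosh t + sinh t S` applied to `dφ(w)`, tangent to `∂K`; the second is the
velocity of the normal geodesic. -/
theorem fderiv_graph_tubeMap (t : ℝ) (w : E (n - 1)) (a : ℝ) :
    fderiv ℝ (fun x : E n => (graph x).1) (tubeMap K φ (u, t)) (fderiv ℝ (tubeMap K φ) (u, t) (w, a)) =
      (Real.cosh t • fderiv ℝ (fun w => (φ w).1) u w +
        Real.sinh t • fderiv ℝ (fun w => outwardNormal K (φ w)) u w) +
      a • (Real.sinh t • (φ u).1 + Real.cosh t • outwardNormal K (φ u)) := by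
  have h1 := ((contDiff_graph (n := n)).differentiable (by simp) (tubeMap K φ (u, t))).hasFDerivAt.comp
    (u, t) (hφ.hasFDerivAt_tubeMap hK hu t)
  have hφ1 : HasFDerivAt (fun x : E (n - 1) × ℝ => (φ x.1).1) _ (u, t) :=
    HasFDerivAt.comp (u, t) (g := fun w => (φ w).1) (f := Prod.fst) (hφ.hasFDerivAt hu) hasFDerivAt_fst
  have hN1 : HasFDerivAt (fun x : E (n - 1) × ℝ => outwardNormal K (φ x.1)) _ (u, t) :=
    HasFDerivAt.comp (u, t) (g := fun w => outwardNormal K (φ w)) (f := Prod.fst)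
      (hφ.hasFDerivAt_normal hu hK.isClosed hK.smooth) hasFDerivAt_fst
  have hc : HasFDerivAt (fun x : E (n - 1) × ℝ => Real.cosh x.2) _ (u, t) :=
    (hasFDerivAt_snd (𝕜 := ℝ) (p := (u, t))).cosh
  have hs : HasFDerivAt (fun x : E (n - 1) × ℝ => Real.sinh x.2) _ (u, t) :=
    (hasFDerivAt_snd (𝕜 := ℝ) (p := (u, t))).sinh
  have h2 := (hc.smul hφ1).add (hs.smul hN1)
  -- Only over `U` is the normal known to be a unit tangent vector, so only there does `graph`
  -- applied to the coordinates return the geodesic itself.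
  have h3 := h1.congr_of_eventuallyEq (f₁ := (fun x : E (n - 1) × ℝ => Real.cosh x.2) •
      (fun x : E (n - 1) × ℝ => (φ x.1).1) + (fun x : E (n - 1) × ℝ => Real.sinh x.2) •
        (fun x : E (n - 1) × ℝ => outwardNormal K (φ x.1))) (by
    have : ∀ᶠ x : E (n - 1) × ℝ in 𝓝 (u, t), x.1 ∈ U :=
      continuousAt_fst.eventually (hφ.eventually_mem hu)
    filter_upwards [this] with x hx
    exact (hK.normalExp_coe (hφ.mapsTo hx) x.2).symm)
  have h4 := congrArg (fun L : E (n - 1) × ℝ →L[ℝ] Mink n => L (w, a)) (h3.unique h2)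
  refine (Eq.trans (by rfl) h4).trans ?_
  simp only [_root_.add_apply, _root_.smul_apply, ContinuousLinearMap.smulRight_apply,
    ContinuousLinearMap.comp_apply, ContinuousLinearMap.coe_fst', ContinuousLinearMap.coe_snd',
    smul_eq_mul]
  module

/-- A convex body has no focal points outside. Pairing a vanishing image with `dφ(w)` gives `cosh t
|dφ(w)|² + sinh t ⟨dN(w), dφ(w)⟩ = 0` with both terms nonnegative, so `w = 0`; pairing with `N` then
gives `a = 0`. -/
theorem exists_hasFDerivAt_tubeMap (hn : 1 ≤ n) {t : ℝ} (ht : 0 ≤ t) :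
    ∃ L : (E (n - 1) × ℝ) ≃L[ℝ] E n, HasFDerivAt (tubeMap K φ) L.toContinuousLinearMap (u, t) := by
  have hN := hK.normal (hφ.mapsTo hu)
  have hNt : lorentz (φ u).1 (outwardNormal K (φ u)) = 0 := hN.1
  have hinj : Function.Injective (fderiv ℝ (tubeMap K φ) (u, t)) := by
    rw [injective_iff_map_eq_zero]
    rintro ⟨w, a⟩ h
    have h1 := hφ.fderiv_graph_tubeMap hK hu t w a
    rw [h, map_zero] at h1
    have hm := hφ.fderiv_mem hu hK.isClosed hK.smooth w
    have hm' := hφ.fderiv_normal_mem hu hK.isClosed hK.smooth w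
    have h2 := congrArg (lorentz (fderiv ℝ (fun w => (φ w).1) u w)) h1
    simp only [lorentz_zero_right, lorentz_add_right, lorentz_smul_right,
      lorentz_comm _ (φ u).1, lorentz_comm _ (outwardNormal K (φ u)), hm.1, hm.2] at h2
    have h3 := hφ.lorentz_fderiv_nonneg hK hu w
    rw [lorentz_comm] at h3
    have h4 : lorentz (fderiv ℝ (fun w => (φ w).1) u w) (fderiv ℝ (fun w => (φ w).1) u w) ≤ 0 := by
      have h5 := Real.cosh_pos t
      have h6 := mul_nonneg (Real.sinh_nonneg_iff.2 ht) h3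
      by_contra! h7
      have := mul_pos h5 h7
      linarith
    have h5 : w = 0 := hφ.immersion u hu
      ((eq_zero_of_lorentz_self (boundaryTangent_isTangent hm) h4).trans (map_zero _).symm)
    have h6 := congrArg (lorentz (outwardNormal K (φ u))) h1
    simp only [lorentz_zero_right, lorentz_add_right, lorentz_smul_right,
      lorentz_comm _ (φ u).1, hNt, hm.2, hm'.2, hN.2.1] at h6
    have h7 := (Real.cosh_pos t).ne'
    have h8 : a = 0 := by
      have : a * Real.cosh t = 0 := by linarith
      simpa [h7] using this
    rw [h5, h8]; rfl
  let e := LinearEquiv.ofInjectiveOfFinrankEq (fderiv ℝ (tubeMap K φ) (u, t)).toLinearMap hinj (by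
    simp only [Module.finrank_prod, finrank_euclideanSpace_fin, Module.finrank_self]; omega)
  refine ⟨e.toContinuousLinearEquiv, ?_⟩
  have h1 : e.toContinuousLinearEquiv.toContinuousLinearMap = fderiv ℝ (tubeMap K φ) (u, t) :=
    ContinuousLinearMap.ext fun x => rfl
  rw [h1]
  exact hφ.hasFDerivAt_tubeMap hK hu t

theorem exists_localInverse (hn : 1 ≤ n) {t : ℝ} (ht : 0 < t) :
    ∃ g : E n → E (n - 1) × ℝ, ContDiffAt ℝ ∞ g (tubeMap K φ (u, t)) ∧
      g (tubeMap K φ (u, t)) = (u, t) ∧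
      ∀ᶠ x in 𝓝 (tubeMap K φ (u, t)), (g x).1 ∈ U ∧ 0 < (g x).2 ∧ tubeMap K φ (g x) = x := by
  obtain ⟨L, hL⟩ := hφ.exists_hasFDerivAt_tubeMap hK hu hn ht.le
  have hc := hφ.contDiffAt_tubeMap hK hu t
  have h1 := hc.to_localInverse hL (by simp)
  have h2 := hc.localInverse_apply_image hL (by simp)
  have h3 : Filter.Tendsto (hc.localInverse hL (by simp)) (𝓝 (tubeMap K φ (u, t))) (𝓝 (u, t)) := by
    have := h1.continuousAt.tendsto
    rwa [h2] at this
  refine ⟨hc.localInverse hL (by simp), h1, h2, ?_⟩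
  filter_upwards [h3.eventually (continuousAt_fst.eventually (hφ.eventually_mem hu)),
    h3.eventually (continuousAt_snd.eventually (lt_mem_nhds ht)),
    (hc.hasStrictFDerivAt' hL (by simp)).eventually_right_inverse] with x hx hx' hx''
  exact ⟨hx, hx', hx''⟩

/-- The Jacobian of the normal exponential map over a patch. -/
theorem abs_det_tubeMap (hn : 1 ≤ n) {e : (E (n - 1) × ℝ) ≃L[ℝ] E n}
    (he : ∀ (k : ℕ) (A : E n →ₗ[ℝ] Mink k) (A₁ : E (n - 1) →ₗ[ℝ] Mink k) (N : Mink k),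
      (∀ w a, A (e (w, a)) = A₁ w + a • N) → (∀ w, lorentz (A₁ w) N = 0) → lorentz N N = 1 →
      (gramL A).det = (gramL A₁).det) {t : ℝ} (ht : 0 < t) :
    |((fderiv ℝ (tubeMap K φ) (u, t)).comp e.symm.toContinuousLinearMap).det| *
      √(gram graph (tubeMap K φ (u, t))).det = jac K (φ u) t * √(gram φ u).det := by
  have hN := hK.normal (hφ.mapsTo hu)
  have hNt : lorentz (φ u).1 (outwardNormal K (φ u)) = 0 := hN.1
  obtain ⟨D, hD⟩ := hφ.exists_tangentEquiv hu hK.isClosed hK.smooth hn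
  set L := (fderiv ℝ (tubeMap K φ) (u, t)).comp e.symm.toContinuousLinearMap with hL
  set G := fderiv ℝ (fun x : E n => (graph x).1) (tubeMap K φ (u, t)) with hG
  set T := Real.cosh t • LinearMap.id + Real.sinh t • shapeOperator K (φ u) with hT
  let R : E (n - 1) →ₗ[ℝ] E (n - 1) := D.symm.toLinearMap ∘ₗ T ∘ₗ D.toLinearMap
  have hR : LinearMap.det R = jac K (φ u) t := by
    rw [hK.jac_eq_det hn (hφ.mapsTo hu) ht]
    exact LinearMap.det_conj T D.symm
  let A₁ : E (n - 1) →ₗ[ℝ] Mink n := (fderiv ℝ (fun w => (φ w).1) u).toLinearMap ∘ₗ R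
  have hA₁ (w : E (n - 1)) : A₁ w = Real.cosh t • fderiv ℝ (fun w => (φ w).1) u w +
      Real.sinh t • fderiv ℝ (fun w => outwardNormal K (φ w)) u w := by
    change fderiv ℝ (fun w => (φ w).1) u (D.symm (T (D w))) = _
    rw [← hD, D.apply_symm_apply, ← hφ.shapeOperator_apply hu hK.isClosed hK.smooth hn _ (hD w), ← hD]
    rfl
  -- The Gram determinant of the differential of the normal exponential map is computed in two ways:
  -- through the coordinates of `ℍⁿ`, which gives `(det L)²` times the volume density squared, and
  -- by splitting off the unit geodesic direction, which gives `(det R)² = jac²` times the area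
  -- density squared.
  have hblock := he n (G.toLinearMap ∘ₗ L.toLinearMap) A₁
    (Real.sinh t • (φ u).1 + Real.cosh t • outwardNormal K (φ u)) (fun w a => by
      rw [hA₁, ← hφ.fderiv_graph_tubeMap hK hu t w a]
      simp [hL, hG]) (fun w => by
      have hm := hφ.fderiv_mem hu hK.isClosed hK.smooth w
      have hm' := hφ.fderiv_normal_mem hu hK.isClosed hK.smooth w
      rw [hA₁]
      simp only [lorentz_add_right, lorentz_smul_right, lorentz_comm _ (φ u).1,
        lorentz_comm _ (outwardNormal K (φ u)), hm.1, hm.2, hm'.1, hm'.2]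
      ring) (by
      simp only [lorentz_add_right, lorentz_add_left, lorentz_smul_right, lorentz_smul_left,
        lorentz_comm _ (φ u).1, hNt, hN.2.1, lorentz_hyp_self]
      have := Real.cosh_sq t
      nlinarith)
  rw [det_gramL_comp, det_gramL_comp, hR] at hblock
  have hj : 0 ≤ jac K (φ u) t := zero_le_one.trans (hK.one_le_jac hn (hφ.mapsTo hu) ht)
  have h1 := congrArg Real.sqrt hblock
  rw [Real.sqrt_mul (sq_nonneg _), Real.sqrt_mul (sq_nonneg _), Real.sqrt_sq_eq_abs,
    Real.sqrt_sq hj] at h1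
  exact h1

end IsPatch

theorem exists_prod_equiv_pred (hn : 1 ≤ n) : ∃ e : (E (n - 1) × ℝ) ≃L[ℝ] E n,
    MeasureTheory.MeasurePreserving e ∧
    ∀ (k : ℕ) (A : E n →ₗ[ℝ] Mink k) (A₁ : E (n - 1) →ₗ[ℝ] Mink k) (N : Mink k),
      (∀ w a, A (e (w, a)) = A₁ w + a • N) → (∀ w, lorentz (A₁ w) N = 0) → lorentz N N = 1 →
      (gramL A).det = (gramL A₁).det := by
  obtain ⟨m, rfl⟩ := Nat.exists_eq_add_of_le' hn
  exact exists_prod_equiv m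

/-! ### Regularity of the distance, the foot point and the Jacobian. -/

namespace IsConvexBody

variable {K : Set (Hyp n)} (hK : IsConvexBody K) (hn : 1 ≤ n)
include hK hn

/-- By injectivity of the normal exponential map, a local inverse of `tubeMap` must return the
distance as second component and the parameter of the foot point as first component. -/
theorem contDiffAt_distTo_and_continuousAt_footPoint {y : Hyp n} (hy : y ∉ K) :
    ContDiffAt ℝ ∞ (fun x : E n => distTo K (graph x)) y.1.1 ∧ ContinuousAt (footPoint K) y := by
  obtain ⟨hq, ht, hyq⟩ := hK.footPoint_spec hy
  obtain ⟨U, φ, O, P, hφ, -, hqO, h⟩ := exists_patch hn hK.isClosed hK.smooth hq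
  obtain ⟨hu, hφu⟩ := h _ hq hqO
  set u := P (footPoint K y).1.1
  set t := distTo K y
  obtain ⟨g, hg, hg0, hg'⟩ := hφ.exists_localInverse hK hu hn ht
  have hF : tubeMap K φ (u, t) = y.1.1 := by
    conv_rhs => rw [hyq, ← hφu]
    rfl
  rw [hF] at hg hg0 hg'
  constructor
  · refine hg.snd.congr_of_eventuallyEq ?_
    filter_upwards [hg'] with x ⟨hx1, hx2, hx3⟩
    conv_lhs => rw [← hx3, graph_tubeMap, hK.distTo_normalExp (hφ.mapsTo hx1) hx2.le]
  · have h1 : ContinuousAt (fun z : Hyp n => g z.1.1) y :=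
      ContinuousAt.comp (f := fun z : Hyp n => z.1.1) hg.continuousAt continuous_coord.continuousAt
    have h2 : ContinuousAt (fun z : Hyp n => φ (g z.1.1).1) y := by
      refine ContinuousAt.comp (f := fun z : Hyp n => (g z.1.1).1) (g := φ) ?_ h1.fst
      rw [hg0]; exact hφ.continuousAt hu
    refine h2.congr ?_
    filter_upwards [continuous_coord.continuousAt.eventually hg'] with z ⟨hz1, hz2, hz3⟩
    have h3 := congrArg graph hz3
    rw [graph_tubeMap, graph_coord] at h3
    rw [← hK.footPoint_normalExp (hφ.mapsTo hz1) hz2, h3]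

theorem continuousOn_footPoint : ContinuousOn (footPoint K) Kᶜ := fun _ hy =>
  (hK.contDiffAt_distTo_and_continuousAt_footPoint hn hy).2.continuousWithinAt

/-- The formula `abs_det_tubeMap` is solved for `jac`; all other terms are visibly continuous, so
continuity of eigenvalues is not needed. -/
theorem continuousOn_jac :
    ContinuousOn (fun x : Hyp n × ℝ => jac K x.1 x.2) (frontier K ×ˢ Set.Ioi 0) := by
  rintro ⟨q, t⟩ ⟨hq, ht⟩
  obtain ⟨U, φ, O, P, hφ, hO, hqO, h⟩ := exists_patch hn hK.isClosed hK.smooth hq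
  obtain ⟨hu, hφu⟩ := h _ hq hqO
  obtain ⟨e, -, he⟩ := exists_prod_equiv_pred hn
  set u := P q.1.1
  have h1 : ContinuousAt (fun x : E (n - 1) × ℝ =>
      |((fderiv ℝ (tubeMap K φ) x).comp e.symm.toContinuousLinearMap).det| *
      √(gram graph (tubeMap K φ x)).det / √(gram φ x.1).det) (u, t) := by
    have hc := hφ.contDiffAt_tubeMap hK hu t
    have hd : ContinuousAt (fderiv ℝ (tubeMap K φ)) (u, t) :=
      (hc.fderiv_right (m := 0) (by simp)).continuousAt
    have hgr : ContinuousAt (fderiv ℝ fun x : E n => (graph x).1) (tubeMap K φ (u, t)) :=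
      (contDiff_graph.continuous_fderiv (by simp)).continuousAt
    have hφ' : ContinuousAt (fderiv ℝ fun w => (φ w).1) u :=
      ((hφ.contDiffAt hu).fderiv_right (m := 0) (by simp)).continuousAt
    refine ContinuousAt.div (ContinuousAt.mul (ContinuousAt.abs ?_) (ContinuousAt.sqrt ?_))
      (ContinuousAt.sqrt ?_) (Real.sqrt_pos.2 (hφ.det_gram_pos hu)).ne'
    · exact ContinuousLinearMap.continuous_det.continuousAt.comp
        (hd.clm_comp continuousAt_const)
    · exact continuousAt_det_gram
        (ContinuousAt.comp (f := tubeMap K φ) hgr hc.continuousAt)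
    · exact continuousAt_det_gram
        (ContinuousAt.comp (f := fun x : E (n - 1) × ℝ => x.1) hφ' continuousAt_fst)
  have h2 : ContinuousAt (fun x : Hyp n × ℝ => (P x.1.1.1, x.2)) (q, t) := by
    have : Continuous fun x : Hyp n × ℝ => (P x.1.1.1, x.2) :=
      (P.continuous.comp (continuous_coord.comp continuous_fst)).prodMk continuous_snd
    exact this.continuousAt
  have h3 := ContinuousAt.comp (f := fun x : Hyp n × ℝ => (P x.1.1.1, x.2)) (x := (q, t)) h1 h2
  have key : ∀ x : Hyp n × ℝ, x.1 ∈ O → x ∈ frontier K ×ˢ Set.Ioi 0 →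
      jac K x.1 x.2 = |((fderiv ℝ (tubeMap K φ) (P x.1.1.1, x.2)).comp
        e.symm.toContinuousLinearMap).det| *
      √(gram graph (tubeMap K φ (P x.1.1.1, x.2))).det / √(gram φ (P x.1.1.1)).det := by
    rintro ⟨z, s⟩ hz ⟨hzf, hs⟩
    obtain ⟨hv, hφv⟩ := h z hzf hz
    rw [hφ.abs_det_tubeMap hK hv hn he hs, hφv,
      mul_div_cancel_right₀ _ (Real.sqrt_pos.2 (hφ.det_gram_pos hv)).ne']
  refine h3.continuousWithinAt.congr_of_eventuallyEq ?_ (key (q, t) hqO ⟨hq, ht⟩)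
  have hev : ∀ᶠ x : Hyp n × ℝ in 𝓝 (q, t), x.1 ∈ O :=
    continuousAt_fst.eventually (hO.mem_nhds hqO)
  filter_upwards [nhdsWithin_le_nhds hev, self_mem_nhdsWithin] with x hx hx' using key x hx hx'

end IsConvexBody

open MeasureTheory

/-! ### Integration in normal coordinates -/

theorem lintegral_paramMeasure {k : ℕ} {U : Set (E k)} (hU : MeasurableSet U) {φ : E k → Hyp n}
    (hφ : ContinuousOn φ U)
    (hd : ContinuousOn (fun u => (gram φ u).det) U)
    {g : Hyp n → ℝ≥0∞} (hg : Measurable g) :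
    ∫⁻ q, g q ∂paramMeasure U φ = ∫⁻ u in U, ENNReal.ofReal (√(gram φ u).det) * g (φ u) := by
  have h1 : AEMeasurable φ (volume.restrict U) := hφ.aemeasurable hU
  have h2 : AEMeasurable (fun u => ENNReal.ofReal (√(gram φ u).det)) (volume.restrict U) :=
    (hd.sqrt.aemeasurable hU).ennreal_ofReal
  rw [paramMeasure, lintegral_map' hg.aemeasurable (h1.mono_ac (withDensity_absolutelyContinuous _ _)),
    lintegral_withDensity_eq_lintegral_mul₀ h2 (g := fun u => g (φ u)) (hg.comp_aemeasurable h1)]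
  rfl

theorem continuous_det_gram_graph : Continuous fun x : E n => (gram graph x).det :=
  continuous_iff_continuousAt.2 fun _ => continuousAt_det_gram (f := fun x => x)
    (contDiff_graph.continuous_fderiv (by simp)).continuousAt

theorem lintegral_hypVolume {g : Hyp n → ℝ≥0∞} (hg : Measurable g) :
    ∫⁻ y, g y ∂hypVolume n = ∫⁻ x, ENNReal.ofReal (√(gram graph x).det) * g (graph x) := by
  rw [hypVolume, lintegral_paramMeasure MeasurableSet.univ continuous_graph.continuousOn
    continuous_det_gram_graph.continuousOn hg, Measure.restrict_univ]

theorem setLIntegral_hypVolume {R : Set (E n)} (hR : MeasurableSet R) {g : Hyp n → ℝ≥0∞}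
    (hg : Measurable g) : ∫⁻ y in graph '' R, g y ∂hypVolume n =
      ∫⁻ x in R, ENNReal.ofReal (√(gram graph x).det) * g (graph x) := by
  have hm : MeasurableSet (graph '' R) :=
    (graphHomeo n).measurableEmbedding.measurableSet_image.2 hR
  have hinj : Function.Injective (graph : E n → Hyp n) := (graphHomeo n).injective
  rw [← lintegral_indicator hm, lintegral_hypVolume (hg.indicator hm), ← lintegral_indicator hR]
  refine lintegral_congr fun x => ?_
  by_cases hx : x ∈ R
  · rw [Set.indicator_of_mem hx, Set.indicator_of_mem (Set.mem_image_of_mem _ hx)]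
  · simp [hx, Set.indicator_of_notMem, hinj.mem_set_image]

theorem hypVolume_lt_top {C : Set (Hyp n)} (hC : IsCompact C) : hypVolume n C < ⊤ := by
  have h1 : C = graph '' ((fun q : Hyp n => q.1.1) '' C) := by
    rw [Set.image_image]; simp [graph_coord]
  have h2 : IsCompact ((fun q : Hyp n => q.1.1) '' C) := hC.image continuous_coord
  rw [← setLIntegral_one, h1, setLIntegral_hypVolume h2.measurableSet measurable_const]
  simp only [mul_one]
  exact (continuous_det_gram_graph.sqrt.continuousOn.integrableOn_compact h2).lintegral_lt_top

open Classical in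
/-- The integral of `g` along the outward normal geodesic from `q`, weighted by the Jacobian. -/
noncomputable def fiberIntegral (K : Set (Hyp n)) (g : Hyp n → ℝ≥0∞) (q : Hyp n) : ℝ≥0∞ :=
  ∫⁻ t : ℝ, (frontier K ×ˢ Set.Ioi (0 : ℝ)).indicator
    (fun x : Hyp n × ℝ => ENNReal.ofReal (jac K x.1 x.2) * g (normalExp K x.1 x.2)) (q, t)

theorem fiberIntegral_of_mem {K : Set (Hyp n)} (g : Hyp n → ℝ≥0∞) {q : Hyp n}
    (hq : q ∈ frontier K) : fiberIntegral K g q =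
      ∫⁻ t in Set.Ioi (0 : ℝ), ENNReal.ofReal (jac K q t) * g (normalExp K q t) := by
  rw [fiberIntegral, ← lintegral_indicator measurableSet_Ioi]
  refine lintegral_congr fun t => ?_
  by_cases ht : 0 < t
  · rw [Set.indicator_of_mem (show (q, t) ∈ frontier K ×ˢ Set.Ioi (0 : ℝ) from ⟨hq, ht⟩),
      Set.indicator_of_mem (show t ∈ Set.Ioi (0 : ℝ) from ht)]
  · rw [Set.indicator_of_notMem fun h => ht h.2,
      Set.indicator_of_notMem (show t ∉ Set.Ioi (0 : ℝ) from ht)]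

namespace IsPatch

variable {K : Set (Hyp n)} {U : Set (E (n - 1))} {φ : E (n - 1) → Hyp n}
  (hφ : IsPatch (frontier K) U φ)
include hφ

theorem continuousOn : ContinuousOn φ U := fun _ hu => (hφ.continuousAt hu).continuousWithinAt

theorem continuousOn_det_gram : ContinuousOn (fun u => (gram φ u).det) U := fun _ hu =>
  (continuousAt_det_gram (f := fun u => u) ((hφ.contDiffAt hu).fderiv_right (m := 0)
    (by simp)).continuousAt).continuousWithinAt

/-- Nothing is known about `φ` off `U`, so it is first replaced by a constant there. -/
theorem measurableSet_preimage {B : Set (Hyp n)} (hB : MeasurableSet B) :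
    MeasurableSet (U ∩ φ ⁻¹' B) := by
  classical
  have hU := hφ.isOpen.measurableSet
  rcases U.eq_empty_or_nonempty with h | ⟨u₀, -⟩
  · simp [h]
  have h1 : Measurable (U.piecewise φ fun _ => φ u₀) :=
    hφ.continuousOn.measurable_piecewise continuousOn_const hU
  have h2 : U ∩ φ ⁻¹' B = U ∩ (U.piecewise φ fun _ => φ u₀) ⁻¹' B := by
    ext u
    simp only [Set.mem_inter_iff, Set.mem_preimage, and_congr_right_iff]
    intro hu
    rw [Set.piecewise_eq_of_mem _ _ _ hu]
  rw [h2]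
  exact hU.inter (h1 hB)

theorem lintegral {g : Hyp n → ℝ≥0∞} (hg : Measurable g) {B : Set (Hyp n)}
    (hB : MeasurableSet B) : ∫⁻ q in B, g q ∂paramMeasure U φ =
      ∫⁻ u in U ∩ φ ⁻¹' B, ENNReal.ofReal (√(gram φ u).det) * g (φ u) := by
  rw [← lintegral_indicator hB, lintegral_paramMeasure hφ.isOpen.measurableSet hφ.continuousOn
    hφ.continuousOn_det_gram (hg.indicator hB), ← lintegral_indicator (hφ.measurableSet_preimage hB),
    ← lintegral_indicator hφ.isOpen.measurableSet]
  refine lintegral_congr fun u => ?_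
  by_cases hu : u ∈ U <;> by_cases hB' : φ u ∈ B <;> simp [Set.indicator, hu, hB']

end IsPatch

namespace IsConvexBody

variable {K : Set (Hyp n)} (hK : IsConvexBody K) (hn : 1 ≤ n)
include hK hn

theorem measurable_fiberIntegrand {g : Hyp n → ℝ≥0∞} (hg : Measurable g) :
    Measurable ((frontier K ×ˢ Set.Ioi (0 : ℝ)).indicator
      (fun x : Hyp n × ℝ => ENNReal.ofReal (jac K x.1 x.2) * g (normalExp K x.1 x.2))) := by
  classical
  set S := frontier K ×ˢ Set.Ioi (0 : ℝ) with hS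
  have hSm : MeasurableSet S := isClosed_frontier.measurableSet.prod measurableSet_Ioi
  have h1 : Measurable (S.piecewise (fun x : Hyp n × ℝ => jac K x.1 x.2) fun _ => 0) :=
    (hK.continuousOn_jac hn).measurable_piecewise continuousOn_const hSm
  have h2 : Measurable (S.piecewise (fun x : Hyp n × ℝ => normalExp K x.1 x.2) fun x => x.1) :=
    (hK.continuousOn_normalExp.mono
      (Set.prod_mono_right (Set.subset_univ _))).measurable_piecewise continuousOn_fst hSm
  convert! h1.ennreal_ofReal.mul (hg.comp h2) using 1
  funext x
  by_cases hx : x ∈ S <;> simp [Set.indicator, Set.piecewise, hx]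

theorem measurable_fiberIntegral {g : Hyp n → ℝ≥0∞} (hg : Measurable g) :
    Measurable (fiberIntegral K g) :=
  (hK.measurable_fiberIntegrand hn hg).lintegral_prod_right'

theorem measurable_footPoint : Measurable (footPoint K) := by
  classical
  have h : footPoint K = Kᶜ.piecewise (footPoint K) fun y => y := by
    funext y
    by_cases hy : y ∈ K
    -- On `K` the foot point takes its default value `y`, since no normal geodesic re-enters `K` at
    -- positive time.
    · rw [Set.piecewise_eq_of_notMem _ _ _ (by simpa using hy), footPoint, dif_neg]
      rintro ⟨q, hq, t, ht, rfl⟩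
      exact hK.normalExp_not_mem hq ht hy
    · rw [Set.piecewise_eq_of_mem _ _ _ hy]
  rw [h]
  exact (hK.continuousOn_footPoint hn).measurable_piecewise continuousOn_id
    hK.isClosed.isOpen_compl.measurableSet

/-- The part of the exterior of `K` that lies over a part of a patch. -/
theorem setLIntegral_tube {U : Set (E (n - 1))} {φ : E (n - 1) → Hyp n}
    (hφ : IsPatch (frontier K) U φ) {g : Hyp n → ℝ≥0∞} (hg : Measurable g) {B : Set (Hyp n)}
    (hB : MeasurableSet B) :
    ∫⁻ y in {y | y ∉ K ∧ footPoint K y ∈ B ∩ φ '' U}, g y ∂hypVolume n =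
      ∫⁻ q in B, fiberIntegral K g q ∂paramMeasure U φ := by
  obtain ⟨e, hem, he⟩ := exists_prod_equiv_pred hn
  set A := U ∩ φ ⁻¹' B with hA
  have hAm : MeasurableSet A := hφ.measurableSet_preimage hB
  set S : Set (E (n - 1) × ℝ) := A ×ˢ Set.Ioi (0 : ℝ) with hS
  have hSm : MeasurableSet S := hAm.prod measurableSet_Ioi
  have hSU : S ⊆ U ×ˢ Set.Ioi 0 := Set.prod_mono_left Set.inter_subset_left
  have heE : MeasurableEmbedding e := e.toHomeomorph.measurableEmbedding
  set f : E n → E n := fun z => tubeMap K φ (e.symm z) with hf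
  have hfS : f '' (e '' S) = tubeMap K φ '' S := by
    rw [Set.image_image]; simp [hf]
  -- The exterior points whose foot point lies in the given piece are exactly the image of the
  -- product of that piece with the positive times. This lets the change of variables formula apply.
  have hset : {y | y ∉ K ∧ footPoint K y ∈ B ∩ φ '' U} = graph '' (f '' (e '' S)) := by
    rw [hfS, Set.image_image]
    ext y
    constructor
    · rintro ⟨hy, hyB, u, hu, huy⟩
      obtain ⟨h1, h2, h3⟩ := hK.footPoint_spec hy
      refine ⟨(u, distTo K y), ⟨⟨hu, by simpa [huy] using hyB⟩, h2⟩, ?_⟩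
      simp only [graph_tubeMap, huy, ← h3]
    · rintro ⟨⟨u, t⟩, ⟨⟨hu, huB⟩, ht⟩, rfl⟩
      simp only [graph_tubeMap]
      refine ⟨hK.normalExp_not_mem (hφ.mapsTo hu) ht, ?_⟩
      rw [hK.footPoint_normalExp (hφ.mapsTo hu) ht]
      exact ⟨huB, u, hu, rfl⟩
  have heSm : MeasurableSet (e '' S) := heE.measurableSet_image.2 hSm
  have hfd : ∀ z ∈ e '' S, HasFDerivWithinAt f
      ((fderiv ℝ (tubeMap K φ) (e.symm z)).comp e.symm.toContinuousLinearMap) (e '' S) z := by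
    rintro _ ⟨⟨u, t⟩, hx, rfl⟩
    have h1 := hφ.hasFDerivAt_tubeMap hK (hSU hx).1 t
    refine HasFDerivAt.hasFDerivWithinAt ?_
    refine HasFDerivAt.comp (e (u, t)) (g := tubeMap K φ) ?_ e.symm.hasFDerivAt
    simpa using h1
  have hfi : Set.InjOn f (e '' S) := by
    rintro _ ⟨x, hx, rfl⟩ _ ⟨y, hy, rfl⟩ h
    simp only [hf, ContinuousLinearEquiv.symm_apply_apply] at h
    rw [hφ.injOn_tubeMap hK (hSU hx) (hSU hy) h]
  have hfm : MeasurableSet (f '' (e '' S)) := measurable_image_of_fderivWithin heSm hfd hfi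
  have hFm : AEMeasurable (fun x : E (n - 1) × ℝ => ENNReal.ofReal (√(gram φ x.1).det) *
      (ENNReal.ofReal (jac K (φ x.1) x.2) * g (normalExp K (φ x.1) x.2)))
      ((volume : Measure (E (n - 1) × ℝ)).restrict S) := by
    have hφc : ContinuousOn (fun x : E (n - 1) × ℝ => (φ x.1, x.2)) S :=
      (hφ.continuousOn.comp continuousOn_fst fun x hx => (hSU hx).1).prodMk continuousOn_snd
    have h1 : ContinuousOn (fun x : E (n - 1) × ℝ => √(gram φ x.1).det) S :=
      (hφ.continuousOn_det_gram.comp continuousOn_fst fun x hx => (hSU hx).1).sqrt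
    have h2 : ContinuousOn (fun x : E (n - 1) × ℝ => jac K (φ x.1) x.2) S :=
      ContinuousOn.comp (g := fun x : Hyp n × ℝ => jac K x.1 x.2)
        (f := fun x : E (n - 1) × ℝ => (φ x.1, x.2)) (hK.continuousOn_jac hn) hφc fun x hx => ⟨hφ.mapsTo (hSU hx).1, hx.2⟩
    have h3 : ContinuousOn (fun x : E (n - 1) × ℝ => normalExp K (φ x.1) x.2) S :=
      ContinuousOn.comp (g := fun x : Hyp n × ℝ => normalExp K x.1 x.2)
        (f := fun x : E (n - 1) × ℝ => (φ x.1, x.2)) hK.continuousOn_normalExp hφc fun x hx => ⟨hφ.mapsTo (hSU hx).1, Set.mem_univ _⟩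
    exact (h1.aemeasurable hSm).ennreal_ofReal.mul ((h2.aemeasurable hSm).ennreal_ofReal.mul
      (hg.comp_aemeasurable (h3.aemeasurable hSm)))
  rw [hset, setLIntegral_hypVolume hfm hg,
    lintegral_image_eq_lintegral_abs_det_fderiv_mul volume heSm hfd hfi,
    ← hem.setLIntegral_comp_emb heE, hφ.lintegral (hK.measurable_fiberIntegral hn hg) hB, ← hA]
  have h1 : ∀ x ∈ S, ENNReal.ofReal |((fderiv ℝ (tubeMap K φ) (e.symm (e x))).comp
        e.symm.toContinuousLinearMap).det| *
      (ENNReal.ofReal (√(gram graph (f (e x))).det) * g (graph (f (e x)))) =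
      ENNReal.ofReal (√(gram φ x.1).det) *
      (ENNReal.ofReal (jac K (φ x.1) x.2) * g (normalExp K (φ x.1) x.2)) := by
    rintro ⟨u, t⟩ hx
    have h2 := hφ.abs_det_tubeMap hK (hSU hx).1 hn he hx.2
    simp only [hf, ContinuousLinearEquiv.symm_apply_apply, graph_tubeMap]
    rw [← mul_assoc, ← mul_assoc, ← ENNReal.ofReal_mul (abs_nonneg _), h2,
      ← ENNReal.ofReal_mul (Real.sqrt_nonneg _), mul_comm (jac _ _ _)]
  rw [setLIntegral_congr_fun hSm h1]
  have h3 : (volume : Measure (E (n - 1) × ℝ)).restrict S =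
      (volume.restrict A).prod (volume.restrict (Set.Ioi 0)) := (Measure.prod_restrict _ _).symm
  rw [h3] at hFm ⊢
  rw [lintegral_prod _ hFm]
  refine setLIntegral_congr_fun hAm fun u hu => ?_
  simp only
  rw [lintegral_const_mul' _ _ ENNReal.ofReal_ne_top, fiberIntegral_of_mem g (hφ.mapsTo hu.1)]

end IsConvexBody

/-! ### The area measure -/

/-- Compactness turns local agreement into agreement on a finite cover, to which the null complement
of the boundary is added. -/
theorem measure_eq_of_frontier {K : Set (Hyp n)} (hc : IsCompact (frontier K))
    {μ ν : Measure (Hyp n)} (hμ : μ (frontier K)ᶜ = 0) (hν : ν (frontier K)ᶜ = 0)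
    (h : ∀ q ∈ frontier K, ∃ O, IsOpen O ∧ q ∈ O ∧ ∀ B ⊆ O, MeasurableSet B → μ B = ν B) :
    μ = ν := by
  choose! O hO hqO hB using h
  obtain ⟨s, hs, hsc⟩ := hc.elim_nhds_subcover O fun q hq => (hO q hq).mem_nhds (hqO q hq)
  let V : Option s → Set (Hyp n) := fun i => i.elim (frontier K)ᶜ fun q => O q
  have hV : (⋃ i, V i) = Set.univ := by
    refine Set.eq_univ_of_forall fun y => Set.mem_iUnion.2 ?_
    by_cases hy : y ∈ frontier K
    · obtain ⟨q, hq, hyq⟩ := Set.mem_iUnion₂.1 (hsc hy)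
      exact ⟨some ⟨q, hq⟩, hyq⟩
    · exact ⟨none, hy⟩
  rw [← Measure.restrict_univ (μ := μ), ← Measure.restrict_univ (μ := ν), ← hV,
    Measure.restrict_iUnion_congr]
  rintro (_ | ⟨q, hq⟩)
  · change μ.restrict (frontier K)ᶜ = ν.restrict (frontier K)ᶜ
    rw [Measure.restrict_eq_zero.2 hμ, Measure.restrict_eq_zero.2 hν]
  · change μ.restrict (O q) = ν.restrict (O q)
    ext B hBm
    rw [Measure.restrict_apply hBm, Measure.restrict_apply hBm]
    exact hB q (hs q hq) _ Set.inter_subset_right (hBm.inter (hO q (hs q hq)).measurableSet)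

/-- The image of the measure `g dv` on the exterior of `K` under the foot point map. -/
noncomputable def footMeasure (K : Set (Hyp n)) (g : Hyp n → ℝ≥0∞) : Measure (Hyp n) :=
  (((hypVolume n).withDensity g).restrict Kᶜ).map (footPoint K)

open Classical in
/-- A density on the exterior of `K` whose integrals along the normal geodesics are `1`. -/
noncomputable def collarDensity (K : Set (Hyp n)) : Hyp n → ℝ≥0∞ :=
  (Kᶜ ∩ {y | distTo K y < 1}).indicator fun y =>
    (ENNReal.ofReal (jac K (footPoint K y) (distTo K y)))⁻¹

theorem IsPatch.paramMeasure_compl {K : Set (Hyp n)} {U : Set (E (n - 1))}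
    {φ : E (n - 1) → Hyp n} (hφ : IsPatch (frontier K) U φ) :
    paramMeasure U φ (frontier K)ᶜ = 0 := by
  rw [← setLIntegral_one, hφ.lintegral measurable_const isClosed_frontier.isOpen_compl.measurableSet]
  have : U ∩ φ ⁻¹' (frontier K)ᶜ = ∅ := by
    ext u; simp only [Set.mem_inter_iff, Set.mem_preimage, Set.mem_compl_iff]
    exact ⟨fun h => h.2 (hφ.mapsTo h.1), fun h => h.elim⟩
  rw [this, Measure.restrict_empty, lintegral_zero_measure]

theorem IsPatch.paramMeasure_le {K : Set (Hyp n)} {U : Set (E (n - 1))}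
    {φ : E (n - 1) → Hyp n} (hφ : IsPatch (frontier K) U φ) :
    paramMeasure U φ ≤ areaMeasure (frontier K) :=
  le_iSup_of_le U (le_iSup_of_le φ (le_iSup_of_le hφ le_rfl))

namespace IsConvexBody

variable {K : Set (Hyp n)} (hK : IsConvexBody K) (hn : 1 ≤ n)
include hK hn

theorem footMeasure_apply {g : Hyp n → ℝ≥0∞} {B : Set (Hyp n)}
    (hB : MeasurableSet B) :
    footMeasure K g B = ∫⁻ y in {y | y ∉ K ∧ footPoint K y ∈ B}, g y ∂hypVolume n := by
  have hm := hK.measurable_footPoint hn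
  have h1 : {y | y ∉ K ∧ footPoint K y ∈ B} = footPoint K ⁻¹' B ∩ Kᶜ := by
    ext y; simp [and_comm]
  have hKm := hK.isClosed.isOpen_compl.measurableSet
  rw [footMeasure, Measure.map_apply hm hB, Measure.restrict_apply (hm hB), h1,
    withDensity_apply _ ((hm hB).inter hKm)]

theorem footMeasure_compl (g : Hyp n → ℝ≥0∞) : footMeasure K g (frontier K)ᶜ = 0 := by
  rw [hK.footMeasure_apply hn isClosed_frontier.isOpen_compl.measurableSet]
  have : {y | y ∉ K ∧ footPoint K y ∈ (frontier K)ᶜ} = ∅ := by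
    ext y
    simp only [Set.mem_ofPred_eq, Set.mem_compl_iff, Set.mem_empty_iff_false, iff_false]
    exact fun h => h.2 (hK.footPoint_spec h.1).1
  rw [this, Measure.restrict_empty, lintegral_zero_measure]

theorem measurable_collarDensity : Measurable (collarDensity K) := by
  classical
  have hm : MeasurableSet (Kᶜ ∩ {y | distTo K y < 1}) :=
    (hK.isClosed.isOpen_compl.inter (isOpen_lt hK.continuous_distTo continuous_const)).measurableSet
  have h1 : ContinuousOn (fun y => jac K (footPoint K y) (distTo K y)) Kᶜ :=
    ContinuousOn.comp (g := fun x : Hyp n × ℝ => jac K x.1 x.2)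
      (f := fun y => (footPoint K y, distTo K y)) (hK.continuousOn_jac hn)
      ((hK.continuousOn_footPoint hn).prodMk hK.continuous_distTo.continuousOn) fun y hy =>
        ⟨(hK.footPoint_spec hy).1, (hK.footPoint_spec hy).2.1⟩
  have h2 : Measurable (Kᶜ.piecewise (fun y => jac K (footPoint K y) (distTo K y)) fun _ => 0) :=
    h1.measurable_piecewise continuousOn_const hK.isClosed.isOpen_compl.measurableSet
  convert! (h2.ennreal_ofReal.inv).indicator hm using 1
  funext y
  by_cases hy : y ∈ Kᶜ ∩ {y | distTo K y < 1}
  · simp only [collarDensity, Set.indicator_of_mem hy, Pi.inv_apply,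
      Set.piecewise_eq_of_mem _ _ _ hy.1]
  · simp only [collarDensity, Set.indicator_of_notMem hy]

/-- The density cancels the Jacobian on the collar, so what is left is the length of `(0, 1)`. -/
theorem fiberIntegral_collarDensity {q : Hyp n} (hq : q ∈ frontier K) :
    fiberIntegral K (collarDensity K) q = 1 := by
  rw [fiberIntegral_of_mem _ hq]
  have h1 : ∀ t ∈ Set.Ioi (0 : ℝ), ENNReal.ofReal (jac K q t) * collarDensity K (normalExp K q t) =
      (Set.Ioo (0 : ℝ) 1).indicator (fun _ => 1) t := by
    intro t ht
    have ht' : 0 < t := ht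
    have hj := hK.one_le_jac hn hq ht'
    have hd := hK.distTo_normalExp hq ht'.le
    by_cases h : t < 1
    · have hmem : normalExp K q t ∈ Kᶜ ∩ {y | distTo K y < 1} :=
        ⟨hK.normalExp_not_mem hq ht', by simpa [hd] using h⟩
      rw [collarDensity, Set.indicator_of_mem hmem,
        Set.indicator_of_mem (show t ∈ Set.Ioo (0 : ℝ) 1 from ⟨ht', h⟩), hK.footPoint_normalExp hq ht', hd]
      exact ENNReal.mul_inv_cancel (by simp; linarith) ENNReal.ofReal_ne_top
    · rw [collarDensity, Set.indicator_of_notMem (fun h' => h (by simpa [hd] using h'.2)),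
        Set.indicator_of_notMem (fun h' => h h'.2), mul_zero]
  rw [setLIntegral_congr_fun measurableSet_Ioi h1, setLIntegral_indicator measurableSet_Ioo,
    setLIntegral_one]
  have : Set.Ioo (0 : ℝ) 1 ∩ Set.Ioi 0 = Set.Ioo 0 1 :=
    Set.inter_eq_left.2 fun t ht => ht.1
  rw [this]
  simp

/-- The right side depends on the patch only through its image. This gives the consistency of
different patches at no cost. -/
theorem paramMeasure_apply {U : Set (E (n - 1))} {φ : E (n - 1) → Hyp n}
    (hφ : IsPatch (frontier K) U φ) {B : Set (Hyp n)} (hB : MeasurableSet B) :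
    paramMeasure U φ B =
      ∫⁻ y in {y | y ∉ K ∧ footPoint K y ∈ B ∩ φ '' U}, collarDensity K y ∂hypVolume n := by
  rw [hK.setLIntegral_tube hn hφ (hK.measurable_collarDensity hn) hB, ← setLIntegral_one]
  refine lintegral_congr_ae (ae_restrict_of_ae ?_)
  filter_upwards [compl_mem_ae_iff.2 hφ.paramMeasure_compl] with q hq
  rw [hK.fiberIntegral_collarDensity hn (by simpa using hq)]

/-- Each patch measure is the collar integral restricted to its image, hence at most the full one;
near every boundary point some patch attains it. -/
theorem areaMeasure_eq : areaMeasure (frontier K) = footMeasure K (collarDensity K) := by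
  have hle : areaMeasure (frontier K) ≤ footMeasure K (collarDensity K) := by
    refine iSup_le fun U => iSup_le fun φ => iSup_le fun hφ => Measure.le_iff.2 fun B hB => ?_
    rw [hK.paramMeasure_apply hn hφ hB, hK.footMeasure_apply hn hB]
    exact lintegral_mono_set fun y hy => ⟨hy.1, hy.2.1⟩
  have h0 := hK.footMeasure_compl hn (collarDensity K)
  refine measure_eq_of_frontier hK.isCompact_frontier (le_antisymm ((hle _).trans h0.le) zero_le) h0
    fun q hq => ?_
  obtain ⟨U, φ, O, P, hφ, hO, hqO, h⟩ := exists_patch hn hK.isClosed hK.smooth hq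
  refine ⟨O, hO, hqO, fun B hBO hB => le_antisymm (hle B) ?_⟩
  refine le_trans ?_ (hφ.paramMeasure_le B)
  rw [hK.paramMeasure_apply hn hφ hB, hK.footMeasure_apply hn hB]
  refine lintegral_mono_set fun y hy => ⟨hy.1, hy.2, ?_⟩
  obtain ⟨h1, h2⟩ := h _ (hK.footPoint_spec hy.1).1 (hBO hy.2)
  exact ⟨_, h1, h2⟩

theorem areaMeasure_compl : areaMeasure (frontier K) (frontier K)ᶜ = 0 := by
  rw [hK.areaMeasure_eq hn]; exact hK.footMeasure_compl hn _

theorem ae_mem_frontier : ∀ᵐ q ∂areaMeasure (frontier K), q ∈ frontier K := by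
  filter_upwards [compl_mem_ae_iff.2 (hK.areaMeasure_compl hn)] with q hq
  simpa using hq

/-- Integration over the exterior of a convex body in normal coordinates. -/
theorem lintegral_exterior {g : Hyp n → ℝ≥0∞} (hg : Measurable g) :
    ∫⁻ y in Kᶜ, g y ∂hypVolume n = ∫⁻ q, fiberIntegral K g q ∂areaMeasure (frontier K) := by
  have hI := hK.measurable_fiberIntegral hn hg
  have key : footMeasure K g = (areaMeasure (frontier K)).withDensity (fiberIntegral K g) := by
    refine measure_eq_of_frontier hK.isCompact_frontier (hK.footMeasure_compl hn g)
      (withDensity_absolutelyContinuous _ _ (hK.areaMeasure_compl hn)) fun q hq => ?_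
    obtain ⟨U, φ, O, P, hφ, hO, hqO, h⟩ := exists_patch hn hK.isClosed hK.smooth hq
    have hset (B : Set (Hyp n)) (hBO : B ⊆ O) : {y | y ∉ K ∧ footPoint K y ∈ B} =
        {y | y ∉ K ∧ footPoint K y ∈ B ∩ φ '' U} := by
      ext y
      refine ⟨fun hy => ⟨hy.1, hy.2, ?_⟩, fun hy => ⟨hy.1, hy.2.1⟩⟩
      obtain ⟨h1, h2⟩ := h _ (hK.footPoint_spec hy.1).1 (hBO hy.2)
      exact ⟨_, h1, h2⟩
    have hres (B : Set (Hyp n)) (hBO : B ⊆ O) (hB : MeasurableSet B) :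
        (areaMeasure (frontier K)).restrict B = (paramMeasure U φ).restrict B := by
      ext C hC
      rw [Measure.restrict_apply hC, Measure.restrict_apply hC, hK.areaMeasure_eq hn,
        hK.footMeasure_apply hn (hC.inter hB), hK.paramMeasure_apply hn hφ (hC.inter hB),
        hset _ (Set.inter_subset_right.trans hBO)]
    refine ⟨O, hO, hqO, fun B hBO hB => ?_⟩
    rw [hK.footMeasure_apply hn hB, hset B hBO, hK.setLIntegral_tube hn hφ hg hB,
      withDensity_apply _ hB, hres B hBO hB]
  have h1 := congrArg (fun μ : Measure (Hyp n) => μ Set.univ) key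
  simp only [withDensity_apply _ MeasurableSet.univ, hK.footMeasure_apply hn MeasurableSet.univ,
    Set.mem_univ, and_true, Measure.restrict_univ] at h1
  exact h1

/-- The Jacobian increases with time, so its value at `t` is at most its integral over `(t, t + 1]`.
Integrated over `∂K` this is bounded by the volume of a compact parallel set. Finiteness of the area
is a consequence. -/
theorem lintegral_jac_lt_top {t : ℝ} (ht : 0 < t) :
    ∫⁻ q, ENNReal.ofReal (jac K q t) ∂areaMeasure (frontier K) < ⊤ := by
  have hm : MeasurableSet {y | distTo K y ≤ t + 1} := (hK.isCompact_parallel (t + 1)).measurableSet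
  have h1 := hK.lintegral_exterior hn (g := {y | distTo K y ≤ t + 1}.indicator fun _ => 1)
    (measurable_const.indicator hm)
  have h2 : ∫⁻ y in Kᶜ, {y | distTo K y ≤ t + 1}.indicator (fun _ => 1) y ∂hypVolume n < ⊤ := by
    refine (setLIntegral_le_lintegral _ _).trans_lt ?_
    rw [lintegral_indicator hm, setLIntegral_one]
    exact hypVolume_lt_top (hK.isCompact_parallel (t + 1))
  rw [h1] at h2
  refine lt_of_le_of_lt (lintegral_mono_ae ?_) h2
  filter_upwards [hK.ae_mem_frontier hn] with q hq
  rw [fiberIntegral_of_mem _ hq]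
  calc ENNReal.ofReal (jac K q t) = ∫⁻ _ in Set.Ioc t (t + 1), ENNReal.ofReal (jac K q t) := by
        simp
    _ ≤ ∫⁻ s in Set.Ioc t (t + 1), ENNReal.ofReal (jac K q s) *
          {y | distTo K y ≤ t + 1}.indicator (fun _ => 1) (normalExp K q s) := by
        refine setLIntegral_mono' measurableSet_Ioc fun s hs => ?_
        have hs0 : 0 < s := ht.trans hs.1
        rw [Set.indicator_of_mem (by simpa [hK.distTo_normalExp hq hs0.le] using hs.2), mul_one]
        exact ENNReal.ofReal_le_ofReal (hK.jac_mono hn hq ht hs.1.le)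
    _ ≤ _ := lintegral_mono_set fun s hs => ht.trans hs.1

theorem isFiniteMeasure_areaMeasure : IsFiniteMeasure (areaMeasure (frontier K)) := by
  refine ⟨?_⟩
  rw [← lintegral_one]
  refine lt_of_le_of_lt (lintegral_mono_ae ?_) (hK.lintegral_jac_lt_top hn one_pos)
  filter_upwards [hK.ae_mem_frontier hn] with q hq
  rw [← ENNReal.ofReal_one]
  exact ENNReal.ofReal_le_ofReal (hK.one_le_jac hn hq one_pos)

theorem restrict_areaMeasure :
    (areaMeasure (frontier K)).restrict (frontier K) = areaMeasure (frontier K) :=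
  Measure.restrict_eq_self_of_ae_mem (hK.ae_mem_frontier hn)

theorem integrable_jac {t : ℝ} (ht : 0 < t) :
    Integrable (fun q => jac K q t) (areaMeasure (frontier K)) := by
  have hc : ContinuousOn (fun q => jac K q t) (frontier K) :=
    ContinuousOn.comp (g := fun x : Hyp n × ℝ => jac K x.1 x.2) (f := fun q => (q, t))
      (hK.continuousOn_jac hn) (Continuous.continuousOn (by fun_prop)) fun q hq => ⟨hq, ht⟩
  have hm := hc.aestronglyMeasurable (μ := areaMeasure (frontier K)) isClosed_frontier.measurableSet
  rw [hK.restrict_areaMeasure hn] at hm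
  refine ⟨hm, ?_⟩
  rw [hasFiniteIntegral_iff_ofReal]
  · exact hK.lintegral_jac_lt_top hn ht
  · filter_upwards [hK.ae_mem_frontier hn] with q hq
    exact zero_le_one.trans (hK.one_le_jac hn hq ht)

theorem ofReal_curvatureIntegral {t : ℝ} (ht : 0 < t) :
    ENNReal.ofReal (curvatureIntegral K t) =
      ∫⁻ q, ENNReal.ofReal (jac K q t) ∂areaMeasure (frontier K) := by
  refine ofReal_integral_eq_lintegral_ofReal (hK.integrable_jac hn ht) ?_
  filter_upwards [hK.ae_mem_frontier hn] with q hq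
  exact zero_le_one.trans (hK.one_le_jac hn hq ht)

theorem lintegral_exterior_radial {g : ℝ → ℝ≥0∞} (hg : Measurable g) :
    ∫⁻ y in Kᶜ, g (distTo K y) ∂hypVolume n =
      ∫⁻ t in Set.Ioi (0 : ℝ), g t * ENNReal.ofReal (curvatureIntegral K t) := by
  have := hK.isFiniteMeasure_areaMeasure hn
  have h1 : ∀ᵐ q ∂areaMeasure (frontier K), fiberIntegral K (fun y => g (distTo K y)) q =
      ∫⁻ t in Set.Ioi (0 : ℝ), ENNReal.ofReal (jac K q t) * g t := by
    filter_upwards [hK.ae_mem_frontier hn] with q hq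
    rw [fiberIntegral_of_mem _ hq]
    refine setLIntegral_congr_fun measurableSet_Ioi fun t ht => ?_
    simp only [hK.distTo_normalExp hq (le_of_lt ht)]
  rw [hK.lintegral_exterior hn (g := fun y => g (distTo K y))
    (hg.comp hK.continuous_distTo.measurable), lintegral_congr_ae h1,
    lintegral_lintegral_swap]
  · refine setLIntegral_congr_fun measurableSet_Ioi fun t ht => ?_
    simp only [hK.ofReal_curvatureIntegral hn ht]
    rw [mul_comm, lintegral_mul_const'' _ (hK.integrable_jac hn ht).aemeasurable.ennreal_ofReal]
  · have h2 := (hK.continuousOn_jac hn).aemeasurable (μ := (areaMeasure (frontier K)).prod volume)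
      (isClosed_frontier.measurableSet.prod measurableSet_Ioi)
    rw [← Measure.prod_restrict, hK.restrict_areaMeasure hn] at h2
    exact h2.ennreal_ofReal.mul (hg.comp measurable_snd).aemeasurable

end IsConvexBody

/-! ### The length of the gradient -/

/-- The supremum is attained at the normalized gradient `u`, or at `u = 0` when the gradient
vanishes; the upper bound is Cauchy–Schwarz. -/
theorem gradNorm_eq (f : Hyp n → ℝ) (q : Hyp n) :
    gradNorm f q = √(lorentz (grad f q.1.1) (grad f q.1.1)) := by
  set g := grad f q.1.1 with hg
  have hgt : IsTangent q g := isTangent_grad f q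
  have hr := Real.sqrt_nonneg (lorentz g g)
  have hsq := Real.sq_sqrt (lorentz_self_nonneg hgt)
  obtain ⟨u, hu, hu1, hgu⟩ : ∃ u, IsTangent q u ∧ (lorentz u u = 1 ∨ u = 0) ∧
      g = √(lorentz g g) • u := by
    by_cases h0 : lorentz g g ≤ 0
    · refine ⟨0, tangent_zero q, Or.inr rfl, ?_⟩
      rw [smul_zero]; exact eq_zero_of_lorentz_self hgt h0
    · push Not at h0
      have hs := Real.sqrt_pos.2 h0
      refine ⟨(√(lorentz g g))⁻¹ • g, hgt.smul _, Or.inl ?_, ?_⟩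
      · rw [lorentz_smul_left, lorentz_smul_right]
        nth_rw 3 [← hsq]
        field_simp
      · rw [smul_smul, mul_inv_cancel₀ hs.ne', one_smul]
  refine IsGreatest.csSup_eq ⟨⟨u, hu, ?_, ?_⟩, ?_⟩
  · rcases hu1 with h | h
    · exact h.le
    · rw [h, lorentz_zero_left]; exact zero_le_one
  · rw [← lorentz_grad f hu, ← hg]
    rcases hu1 with h | h
    · have h1 : lorentz g u = √(lorentz g g) * lorentz u u := by
        conv_lhs => rw [hgu, lorentz_smul_left]
      rw [h1, h, mul_one]
    · have : g = 0 := by rw [hgu, h, smul_zero]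
      rw [this, lorentz_zero_left, lorentz_zero_left, Real.sqrt_zero]
  · rintro a ⟨v, hv, hv1, rfl⟩
    rw [← lorentz_grad f hv, ← hg]
    rcases hu1 with h | h
    · have h1 := lorentz_mul_le hu hv h
      have h2 : lorentz u v ≤ 1 := by nlinarith
      calc lorentz g v = √(lorentz g g) * lorentz u v := by
            conv_lhs => rw [hgu, lorentz_smul_left]
        _ ≤ √(lorentz g g) * 1 := mul_le_mul_of_nonneg_left h2 hr
        _ = _ := mul_one _
    · have : g = 0 := by rw [hgu, h, smul_zero]
      rw [this, lorentz_zero_left]; exact Real.sqrt_nonneg _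

theorem gradNorm_le {f : Hyp n → ℝ} {q : Hyp n} {a : ℝ}
    (h : ∀ v, IsTangent q v → lorentz v v ≤ 1 → diff f q v ≤ a) : gradNorm f q ≤ a :=
  csSup_le ⟨0, 0, tangent_zero q, by rw [lorentz_zero_left]; exact zero_le_one, by simp [diff]⟩ (by
    rintro _ ⟨v, hv, hv1, rfl⟩; exact h v hv hv1)

theorem abs_diff_le_gradNorm {f : Hyp n → ℝ} {q : Hyp n} {v : Mink n} (hv : IsTangent q v)
    (h1 : lorentz v v = 1) : |diff f q v| ≤ gradNorm f q := by
  rw [gradNorm_eq, ← lorentz_grad f hv, lorentz_comm]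
  exact Real.abs_le_sqrt (lorentz_mul_le hv (isTangent_grad f q) h1)

theorem IsSmooth.continuous_gradNorm {f : Hyp n → ℝ} (hf : IsSmooth f) :
    Continuous (gradNorm f) := by
  have h1 : gradNorm f = fun q => √(lorentz (grad f q.1.1) (grad f q.1.1)) := by
    funext q; exact gradNorm_eq f q
  have h2 := (contDiff_grad hf).continuous.comp (continuous_coord (n := n))
  rw [h1]
  exact (h2.lorentz h2).sqrt

/-! ### Smoothness of the curvature integral -/

/-- `jac / cosh^(n-1)` is a polynomial in `tanh t` with coefficients `σᵢ`, so the `σᵢ` are recovered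
from its values at `n` distinct times. The times `1, …, n` are positive, as `integrable_jac`
requires; in this way integrability passes from `jac` to each `σᵢ`. -/
theorem exists_vandermonde (n : ℕ) : ∃ c : Fin n → Fin n → ℝ, ∀ (K : Set (Hyp n)) (q : Hyp n)
    (i : Fin n), meanCurvature K i q = ∑ k : Fin n, c i k * jac K q (k + 1 : ℝ) := by
  let τ : Fin n → ℝ := fun k => Real.tanh (k + 1)
  have hτ : Function.Injective τ := fun i j h => by
    have h1 := Real.tanh_injective h
    simpa [Fin.ext_iff] using h1
  set V := Matrix.vandermonde τ with hV
  have hdet : IsUnit V.det := (Matrix.det_vandermonde_ne_zero_iff.2 hτ).isUnit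
  refine ⟨fun i k => V⁻¹ i k * (Real.cosh (k + 1) ^ (n - 1))⁻¹, fun K q i => ?_⟩
  have h1 (k : Fin n) : jac K q (k + 1 : ℝ) = Real.cosh (k + 1) ^ (n - 1) *
      (V.mulVec fun i : Fin n => meanCurvature K i q) k := by
    rw [jac, ← Fin.sum_univ_eq_sum_range (fun i => Real.cosh (k + 1 : ℝ) ^ (n - 1 - i) *
      Real.sinh (k + 1 : ℝ) ^ i * meanCurvature K i q), Matrix.mulVec, dotProduct, Finset.mul_sum]
    refine Finset.sum_congr rfl fun j _ => ?_
    have hj : (j : ℕ) ≤ n - 1 := by omega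
    have hc := (Real.cosh_pos (k + 1 : ℝ)).ne'
    rw [hV, Matrix.vandermonde_apply]
    simp only [τ, Real.tanh_eq_sinh_div_cosh, div_pow]
    rw [← Nat.sub_add_cancel hj, pow_add, Nat.add_sub_cancel]
    field_simp
  have h2 : V⁻¹.mulVec (V.mulVec fun i : Fin n => meanCurvature K i q) =
      fun i : Fin n => meanCurvature K i q := by
    rw [Matrix.mulVec_mulVec, Matrix.nonsing_inv_mul _ hdet, Matrix.one_mulVec]
  have h3 : V⁻¹.mulVec (V.mulVec fun i : Fin n => meanCurvature K i q) i = meanCurvature K i q :=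
    congrFun h2 i
  rw [← h3, Matrix.mulVec, dotProduct]
  refine Finset.sum_congr rfl fun k _ => ?_
  rw [h1]
  have hc := (Real.cosh_pos (k + 1 : ℝ)).ne'
  field_simp

namespace IsConvexBody

variable {K : Set (Hyp n)} (hK : IsConvexBody K) (hn : 1 ≤ n)
include hK hn

theorem integrable_meanCurvature {i : ℕ} (hi : i < n) :
    Integrable (meanCurvature K i) (areaMeasure (frontier K)) := by
  obtain ⟨c, hc⟩ := exists_vandermonde n
  have h : meanCurvature K i = fun q => ∑ k : Fin n, c ⟨i, hi⟩ k * jac K q (k + 1 : ℝ) := by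
    funext q; exact hc K q ⟨i, hi⟩
  rw [h]
  exact integrable_finsetSum _ fun k _ => (hK.integrable_jac hn (by positivity)).const_mul _

theorem contDiff_curvatureIntegral : ContDiff ℝ ∞ (curvatureIntegral K) := by
  have h : curvatureIntegral K = fun t => ∑ i ∈ Finset.range n,
      Real.cosh t ^ (n - 1 - i) * Real.sinh t ^ i *
        ∫ q, meanCurvature K i q ∂areaMeasure (frontier K) := by
    funext t
    rw [curvatureIntegral, integral_finsetSum _ fun i hi =>
      (hK.integrable_meanCurvature hn (Finset.mem_range.1 hi)).const_mul _]
    exact Finset.sum_congr rfl fun i _ => integral_const_mul _ _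
  rw [h]
  exact ContDiff.sum fun i _ =>
    ((Real.contDiff_cosh.pow _).mul (Real.contDiff_sinh.pow _)).mul contDiff_const

theorem curvatureIntegral_pos (h : areaMeasure (frontier K) ≠ 0) {t : ℝ} (ht : 0 < t) :
    0 < curvatureIntegral K t := by
  rw [← ENNReal.ofReal_pos, hK.ofReal_curvatureIntegral hn ht]
  have h1 : areaMeasure (frontier K) Set.univ ≠ 0 := by rwa [Ne, Measure.measure_univ_eq_zero]
  refine (pos_iff_ne_zero.2 h1).trans_le ?_
  rw [← lintegral_one]
  refine lintegral_mono_ae ?_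
  filter_upwards [hK.ae_mem_frontier hn] with q hq
  rw [← ENNReal.ofReal_one]
  exact ENNReal.ofReal_le_ofReal (hK.one_le_jac hn hq ht)

/-! ### Radial test functions -/

omit hn in
/-- The velocity of a normal geodesic is a unit tangent vector. -/
theorem velocity_normalExp {q : Hyp n} (hq : q ∈ frontier K) (t : ℝ) :
    IsTangent (normalExp K q t) (Real.sinh t • q.1 + Real.cosh t • outwardNormal K q) ∧
      lorentz (Real.sinh t • q.1 + Real.cosh t • outwardNormal K q)
        (Real.sinh t • q.1 + Real.cosh t • outwardNormal K q) = 1 := by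
  have hN := hK.normal hq
  have hNq : lorentz q.1 (outwardNormal K q) = 0 := hN.1
  have hcs := Real.cosh_sq t
  rw [IsTangent, hK.normalExp_coe hq, lorentz_geodesic_left]
  simp only [lorentz_add_right, lorentz_add_left, lorentz_smul_left, lorentz_smul_right,
    lorentz_hyp_self, hNq, lorentz_comm _ q.1, hN.2.1]
  constructor
  · ring
  · nlinarith

/-- With `q` the foot point of `y`, the function `-⟨q, ·⟩ - cosh dist` is nonnegative and vanishes
at `y`, so its derivative there is zero. This identifies the differential of the distance with `⟨ν,
·⟩`, where `ν` is the unit velocity of the normal geodesic at `y`. -/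
theorem abs_diff_distTo_le {y : Hyp n} (hy : y ∉ K) {w : Mink n} (hw : IsTangent y w)
    (hw1 : lorentz w w ≤ 1) : |diff (distTo K) y w| ≤ 1 := by
  obtain ⟨hq, ht, hyq⟩ := hK.footPoint_spec hy
  set q := footPoint K y
  set t := distTo K y with htdef
  have hd := ((hK.contDiffAt_distTo_and_continuousAt_footPoint hn hy).1).differentiableAt (by simp)
  have h1 := (hasDerivAt_comp_coordLine hd w).cosh
  have h2 := hasDerivAt_lorentz (hasDerivAt_const (0 : ℝ) q.1) (hasDerivAt_coordLine hw)
  have h3 := h2.neg.sub h1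
  have hmin : IsLocalMin (-(fun s : ℝ => lorentz q.1 (graph (y.1.1 + s • w.1)).1) -
      fun s : ℝ => Real.cosh (distTo K (graph (y.1.1 + s • w.1)))) 0 := by
    refine Filter.Eventually.of_forall fun s => ?_
    simp only [Pi.sub_apply, Pi.neg_apply, coordLine_zero]
    have h4 := coshDist_le (hK.frontier_subset hq) (graph (y.1.1 + s • w.1))
    have h6 : Real.cosh (distTo K (graph (y.1.1 + s • w.1))) =
        coshDist K (graph (y.1.1 + s • w.1)) := Real.cosh_arcosh (hK.one_le_coshDist _)
    have h5 : -lorentz q.1 y.1 = Real.cosh (distTo K y) := by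
      conv_lhs => rw [hyq]
      exact hK.lorentz_normalExp_self hq t
    rw [h5]
    linarith
  have h4 := hmin.hasDerivAt_eq_zero h3
  rw [coordLine_zero, lorentz_zero_left] at h4
  have hs := Real.sinh_pos_iff.2 ht
  set ν := Real.sinh t • q.1 + Real.cosh t • outwardNormal K q with hν
  have hyc : y.1 = geodesic q (outwardNormal K q) t := by
    conv_lhs => rw [hyq]
    exact hK.normalExp_coe hq t
  have hcs := Real.cosh_sq t
  obtain ⟨hνt, hν1⟩ := hK.velocity_normalExp hq t
  rw [← hyq] at hνt
  have hνq : Real.sinh t • ν = Real.cosh t • y.1 - q.1 := by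
    rw [hyc, hν, geodesic, smul_add, smul_add, smul_smul, smul_smul, smul_smul, smul_smul,
      ← sq, ← sq, hcs]
    module
  have h5 : Real.sinh t * lorentz ν w = - lorentz q.1 w := by
    rw [← lorentz_smul_left, hνq, lorentz_sub_left, lorentz_smul_left]
    have : lorentz y.1 w = 0 := hw
    rw [this]; ring
  have h6 : diff (distTo K) y w = lorentz ν w := by
    refine mul_left_cancel₀ hs.ne' ?_
    rw [h5]
    linarith
  rw [h6]
  have := lorentz_mul_le hνt hw hν1
  exact abs_le_one_iff_mul_self_le_one.2 (by nlinarith)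

/-- The test function is `η(dist)`. The profile is constant up to `a > 0` because the distance need
not be smooth on `∂K`; beyond `∂K` the chain rule and the gradient bound for the distance reduce the
energy to a one-dimensional integral. -/
theorem capacity_le_of_profile {p : ℝ} (hp : 0 < p) {η : ℝ → ℝ} (hη : ContDiff ℝ ∞ η) {a b : ℝ}
    (ha : 0 < a) (h1 : ∀ t ≤ a, η t = 1) (h0 : ∀ t, b ≤ t → η t = 0) :
    capacity p K ≤ ∫⁻ t in Set.Ioi (0 : ℝ),
      ENNReal.ofReal |deriv η t| ^ p * ENNReal.ofReal (curvatureIntegral K t) := by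
  have hnear (y : Hyp n) (hy : y ∈ K) : ∀ᶠ x in 𝓝 y.1.1, η (distTo K (graph x)) = 1 := by
    have hc : Continuous fun x : E n => distTo K (graph x) :=
      hK.continuous_distTo.comp continuous_graph
    have : distTo K (graph y.1.1) < a := by rw [graph_coord, distTo_of_mem hy]; exact ha
    filter_upwards [hc.continuousAt.eventually_lt_const this] with x hx using h1 _ hx.le
  have hsm : IsSmooth fun y => η (distTo K y) := by
    refine contDiff_iff_contDiffAt.2 fun x => ?_
    by_cases hx : graph x ∈ K
    · exact contDiffAt_const.congr_of_eventuallyEq (hnear _ hx)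
    · exact hη.contDiffAt.comp x (hK.contDiffAt_distTo_and_continuousAt_footPoint hn hx).1
  have hcs : HasCompactSupport fun y => η (distTo K y) :=
    HasCompactSupport.intro (hK.isCompact_parallel b) fun y hy => h0 _ (not_le.1 hy).le
  have hcap : capacity p K ≤ ∫⁻ x, ENNReal.ofReal (gradNorm (fun y => η (distTo K y)) x) ^ p
      ∂hypVolume n := iInf₂_le _ ⟨hsm, hcs, fun y hy => by
        simp only [distTo_of_mem hy]; exact h1 0 ha.le⟩
  refine hcap.trans ?_
  rw [← lintegral_add_compl _ hK.isClosed.measurableSet]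
  have hzero : ∫⁻ x in K, ENNReal.ofReal (gradNorm (fun y => η (distTo K y)) x) ^ p
      ∂hypVolume n = 0 := by
    rw [setLIntegral_congr_fun hK.isClosed.measurableSet (g := fun _ => 0), lintegral_zero]
    intro y hy
    have : gradNorm (fun y => η (distTo K y)) y ≤ 0 := gradNorm_le fun v _ _ => by
      rw [diff, Filter.EventuallyEq.fderiv_eq (hnear y hy)]
      simp
    simp only [ENNReal.ofReal_of_nonpos this]
    exact ENNReal.zero_rpow_of_pos hp
  have hη' : Measurable fun t => ENNReal.ofReal |deriv η t| ^ p :=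
    ((hη.continuous_deriv (by simp)).abs.measurable.ennreal_ofReal).pow_const p
  rw [hzero, zero_add, ← hK.lintegral_exterior_radial hn hη']
  refine setLIntegral_mono' hK.isClosed.isOpen_compl.measurableSet fun y hy => ?_
  refine ENNReal.rpow_le_rpow (ENNReal.ofReal_le_ofReal (gradNorm_le fun v hv hv1 => ?_)) hp.le
  have hd := ((hK.contDiffAt_distTo_and_continuousAt_footPoint hn hy).1).differentiableAt (by simp)
  have h2 : HasDerivAt η (deriv η (distTo K y)) (distTo K (graph y.1.1)) := by
    rw [graph_coord]
    exact (hη.differentiable (by simp) _).hasDerivAt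
  have h3 := h2.comp_hasFDerivAt y.1.1 hd.hasFDerivAt
  have h4 : diff (fun y => η (distTo K y)) y v = deriv η (distTo K y) * diff (distTo K) y v := by
    rw [diff, show (fun x : E n => η (distTo K (graph x))) = η ∘ fun x => distTo K (graph x) from rfl,
      h3.fderiv]
    rfl
  rw [h4]
  refine (le_abs_self _).trans ?_
  rw [abs_mul]
  exact mul_le_of_le_one_right (abs_nonneg _) (hK.abs_diff_distTo_le hn hy hv hv1)

end IsConvexBody

/-! ### The optimal profile -/

/-- The primitive of a bump of total mass one, decreasing from `1` to `0`. -/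
theorem exists_profile {h : ℝ → ℝ} (hh : ContDiff ℝ ∞ h) {a b : ℝ}
    (ha0 : 0 < a) (ha : ∀ t ≤ a, h t = 0) (hb : ∀ t, b ≤ t → h t = 0) {c : ℝ}
    (hc : ∫ t in (0)..b, h t = c) (hc0 : c ≠ 0) :
    ∃ η : ℝ → ℝ, ContDiff ℝ ∞ η ∧ (∀ t ≤ a, η t = 1) ∧ (∀ t, b ≤ t → η t = 0) ∧
      ∀ t, deriv η t = -(h t / c) := by
  let η : ℝ → ℝ := fun t => 1 - (∫ s in (0)..t, h s) / c
  have hd (t : ℝ) : HasDerivAt η (-(h t / c)) t := by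
    have h1 := intervalIntegral.integral_hasDerivAt_right (hh.continuous.intervalIntegrable 0 t)
      (hh.continuous.stronglyMeasurableAtFilter _ _) hh.continuous.continuousAt
    exact (h1.div_const c).const_sub 1
  have hderiv : deriv η = fun t => -(h t / c) := funext fun t => (hd t).deriv
  have hi (s t : ℝ) : IntervalIntegrable h volume s t := hh.continuous.intervalIntegrable s t
  refine ⟨η, ?_, fun t ht => ?_, fun t ht => ?_, fun t => (hd t).deriv⟩
  · rw [contDiff_infty_iff_deriv, hderiv]
    exact ⟨fun t => (hd t).differentiableAt, (hh.div_const c).neg⟩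
  · have : ∫ s in (0)..t, h s = 0 := by
      rw [intervalIntegral.integral_congr (g := fun _ => 0), intervalIntegral.integral_zero]
      intro s hs
      exact ha s (hs.2.trans (max_le ha0.le ht))
    simp [η, this]
  · have : ∫ s in (0)..t, h s = c := by
      rw [← intervalIntegral.integral_add_adjacent_intervals (hi 0 b) (hi b t), hc,
        intervalIntegral.integral_congr (a := b) (g := fun _ => 0), intervalIntegral.integral_zero,
        add_zero]
      intro s hs
      rw [Set.uIcc_of_le ht] at hs
      exact hb s hs.1
    simp [η, this, hc0]

theorem exists_cutoff {a b : ℝ} (ha : 0 < a) (hab : a < b) : ∃ χ : ℝ → ℝ, ContDiff ℝ ∞ χ ∧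
    (∀ t, 0 ≤ χ t) ∧ (∀ t, χ t ≤ 1) ∧ (∀ t ∈ Set.Icc a b, χ t = 1) ∧ (∀ t ≤ a / 2, χ t = 0) ∧
      ∀ t, b + a / 2 ≤ t → χ t = 0 := by
  -- Radii `(b - a) / 2` and `b / 2` around the midpoint give the plateau `[a, b]` and a support
  -- between `a / 2` and `b + a / 2`, which stays away from `0`.
  let f : ContDiffBump ((a + b) / 2) := ⟨(b - a) / 2, b / 2, by linarith, by linarith⟩
  have hz (t : ℝ) (ht : b / 2 ≤ |t - (a + b) / 2|) : f t = 0 :=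
    f.zero_of_le_dist (by rw [Real.dist_eq]; exact ht)
  refine ⟨f, f.contDiff, fun t => f.nonneg, fun t => f.le_one, fun t ht => ?_, fun t ht => hz t ?_,
    fun t ht => hz t ?_⟩
  · refine f.one_of_mem_closedBall ?_
    rw [Metric.mem_closedBall, Real.dist_eq, abs_le]
    change -((b - a) / 2) ≤ _ ∧ _ ≤ (b - a) / 2
    constructor <;> linarith [ht.1, ht.2]
  · rw [abs_of_nonpos (by linarith)]; linarith
  · rw [abs_of_nonneg (by linarith)]; linarith

namespace IsConvexBody

variable {K : Set (Hyp n)} (hK : IsConvexBody K) (hn : 1 ≤ n) {p : ℝ} (hp : 1 < p)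
include hK hn hp

theorem capacity_le_of_density {h : ℝ → ℝ} (hh : ContDiff ℝ ∞ h) (h0 : ∀ t, 0 ≤ h t) {a b : ℝ}
    (ha0 : 0 < a) (ha : ∀ t ≤ a, h t = 0) (hb : ∀ t, b ≤ t → h t = 0) {c : ℝ}
    (hc : ∫ t in (0)..b, h t = c) (hc0 : 0 < c) :
    capacity p K ≤ ∫⁻ t in Set.Ioi (0 : ℝ),
      ENNReal.ofReal (h t / c) ^ p * ENNReal.ofReal (curvatureIntegral K t) := by
  obtain ⟨η, hη, hη1, hη0, hd⟩ := exists_profile hh ha0 ha hb hc hc0.ne'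
  refine (hK.capacity_le_of_profile hn (zero_lt_one.trans hp) hη ha0 hη1 hη0).trans_eq ?_
  refine setLIntegral_congr_fun measurableSet_Ioi fun t _ => ?_
  simp only [hd, abs_neg, abs_of_nonneg (div_nonneg (h0 t) hc0.le)]

/-- The density `A^r χ` with `r = -1 / (p - 1)` is the optimal one up to cutoff. As `r p + 1 = r`
and `χ^p ≤ χ`, the energy after normalizing by the total mass `c` is at most `c^(-p) * c = c^(1-p)`,
while `c` is at least the integral of `A^r` over `[a, b]`. -/
theorem capacity_le_Icc (hA : ∀ t, 0 < t → 0 < curvatureIntegral K t) {a b : ℝ} (ha : 0 < a)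
    (hab : a < b) : capacity p K ≤ (∫⁻ t in Set.Icc a b,
      ENNReal.ofReal (curvatureIntegral K t) ^ (-1 / (p - 1))) ^ (1 - p) := by
  obtain ⟨χ, hχ, hχ0, hχ1, hχab, hχa, hχb⟩ := exists_cutoff ha hab
  set A := curvatureIntegral K with hAdef
  set r := -1 / (p - 1) with hr
  have hp1 : 0 < p - 1 := by linarith
  let h : ℝ → ℝ := fun t => A t ^ r * χ t
  have hh : ContDiff ℝ ∞ h := by
    refine contDiff_iff_contDiffAt.2 fun t => ?_
    rcases lt_or_ge 0 t with ht | ht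
    · exact ((hK.contDiff_curvatureIntegral hn).contDiffAt.rpow_const_of_ne (hA t ht).ne').mul
        hχ.contDiffAt
    · refine contDiffAt_const (c := (0 : ℝ)).congr_of_eventuallyEq ?_
      filter_upwards [gt_mem_nhds (show t < a / 2 by linarith)] with s hs
      simp [h, hχa s hs.le]
  have h0 (t : ℝ) : 0 ≤ h t := by
    rcases lt_or_ge 0 t with ht | ht
    · exact mul_nonneg (Real.rpow_nonneg (hA t ht).le _) (hχ0 t)
    · simp [h, hχa t (by linarith)]
  have hza (t : ℝ) (ht : t ≤ a / 2) : h t = 0 := by simp [h, hχa t ht]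
  have hzb (t : ℝ) (ht : b + a / 2 ≤ t) : h t = 0 := by simp [h, hχb t ht]
  have hB : 0 < b + a / 2 := by linarith
  set c := ∫ t in (0)..(b + a / 2), h t with hc
  have hc0 : 0 < c := intervalIntegral.integral_pos hB hh.continuous.continuousOn
    (fun t _ => h0 t) ⟨a, ⟨ha.le, by linarith⟩, by
      simp only [h, hχab a ⟨le_rfl, hab.le⟩, mul_one]
      exact Real.rpow_pos_of_pos (hA a ha) _⟩
  have hofc : ∫⁻ t in Set.Ioi (0 : ℝ), ENNReal.ofReal (h t) = ENNReal.ofReal c := by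
    rw [hc, intervalIntegral.integral_of_le hB.le, ofReal_integral_eq_lintegral_ofReal
      ((hh.continuous.integrableOn_Icc).mono_set Set.Ioc_subset_Icc_self)
      (Filter.Eventually.of_forall h0), ← lintegral_indicator measurableSet_Ioi,
      ← lintegral_indicator measurableSet_Ioc]
    refine lintegral_congr fun t => ?_
    by_cases ht : 0 < t
    · rw [Set.indicator_of_mem (show t ∈ Set.Ioi (0 : ℝ) from ht)]
      by_cases htb : t ≤ b + a / 2
      · rw [Set.indicator_of_mem (show t ∈ Set.Ioc 0 (b + a / 2) from ⟨ht, htb⟩)]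
      · rw [Set.indicator_of_notMem (fun h' => htb h'.2), hzb t (not_le.1 htb).le, ENNReal.ofReal_zero]
    · rw [Set.indicator_of_notMem (show t ∉ Set.Ioi (0 : ℝ) from ht),
        Set.indicator_of_notMem (fun h' => ht h'.1)]
  have hle : ∫⁻ t in Set.Icc a b, ENNReal.ofReal (A t) ^ r ≤ ENNReal.ofReal c := by
    rw [← hofc]
    refine le_trans (setLIntegral_mono' measurableSet_Icc fun t ht => ?_)
      (lintegral_mono_set fun t (ht : t ∈ Set.Icc a b) => (ha.trans_le ht.1 : 0 < t))
    rw [ENNReal.ofReal_rpow_of_pos (hA t (ha.trans_le ht.1))]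
    simp [h, hχab t ht]
  have hcap := hK.capacity_le_of_density hn hp hh h0 (half_pos ha) hza hzb hc.symm hc0
  have hbound : ∫⁻ t in Set.Ioi (0 : ℝ), ENNReal.ofReal (h t / c) ^ p * ENNReal.ofReal (A t) ≤
      ∫⁻ t in Set.Ioi (0 : ℝ), ENNReal.ofReal (c ^ (-p)) * ENNReal.ofReal (h t) := by
    refine setLIntegral_mono' measurableSet_Ioi fun t ht => ?_
    have hAt := hA t ht
    have hw : (A t ^ r) ^ p * A t = A t ^ r := by
      rw [← Real.rpow_mul hAt.le]
      conv_lhs => rw [← Real.rpow_one (A t), ← Real.rpow_mul hAt.le, ← Real.rpow_add hAt]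
      congr 1
      rw [hr]
      field_simp
      ring
    have hχp : χ t ^ p ≤ χ t := Real.rpow_le_self_of_le_one (hχ0 t) (hχ1 t) hp.le
    rw [ENNReal.ofReal_rpow_of_nonneg (div_nonneg (h0 t) hc0.le) (zero_le_one.trans hp.le),
      ← ENNReal.ofReal_mul (Real.rpow_nonneg (div_nonneg (h0 t) hc0.le) _),
      ← ENNReal.ofReal_mul (Real.rpow_nonneg hc0.le _)]
    refine ENNReal.ofReal_le_ofReal ?_
    have hwr := Real.rpow_nonneg hAt.le r
    calc (h t / c) ^ p * A t = c ^ (-p) * (((A t ^ r) ^ p * A t) * χ t ^ p) := by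
          rw [Real.div_rpow (h0 t) hc0.le, Real.mul_rpow hwr (hχ0 t), Real.rpow_neg hc0.le]
          ring
      _ = c ^ (-p) * (A t ^ r * χ t ^ p) := by rw [hw]
      _ ≤ c ^ (-p) * (A t ^ r * χ t) := by gcongr
  refine (hcap.trans hbound).trans ?_
  rw [lintegral_const_mul' _ _ ENNReal.ofReal_ne_top, hofc, ← ENNReal.ofReal_mul
    (Real.rpow_nonneg hc0.le _)]
  have hcc : c ^ (-p) * c = c ^ (1 - p) := by
    conv_lhs => rw [← Real.rpow_one c, ← Real.rpow_mul hc0.le, ← Real.rpow_add hc0]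
    congr 1; ring
  rw [hcc, ← ENNReal.ofReal_rpow_of_pos hc0]
  -- The exponent `1 - p` is negative, so the lower bound for `c` becomes an upper bound.
  rw [← neg_sub, ENNReal.rpow_neg, ENNReal.rpow_neg]
  exact ENNReal.inv_le_inv.2 (ENNReal.rpow_le_rpow hle hp1.le)

theorem capacity_le : capacity p K ≤ (∫⁻ t in Set.Ioi (0 : ℝ),
    ENNReal.ofReal (curvatureIntegral K t) ^ (-1 / (p - 1))) ^ (1 - p) := by
  -- If the boundary has zero area measure, `A` vanishes identically and its negative power is not
  -- available as a density; any admissible profile then has zero energy.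
  by_cases hμ : areaMeasure (frontier K) = 0
  · obtain ⟨χ, hχ, hχ0, hχ1, hχab, hχa, hχb⟩ := exists_cutoff one_pos one_lt_two
    have hc0 : 0 < ∫ t in (0 : ℝ)..(2 + 1 / 2), χ t :=
      intervalIntegral.integral_pos (by norm_num) hχ.continuous.continuousOn
        (fun t _ => hχ0 t) ⟨1, by norm_num, by simp [hχab 1 (by norm_num)]⟩
    have := hK.capacity_le_of_density hn hp hχ hχ0 (by norm_num) hχa hχb rfl hc0
    refine this.trans ?_
    simp [curvatureIntegral, hμ]
  · have hA (t : ℝ) (ht : 0 < t) := hK.curvatureIntegral_pos hn hμ ht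
    have hm : Measurable fun t => ENNReal.ofReal (curvatureIntegral K t) ^ (-1 / (p - 1)) :=
      ((hK.contDiff_curvatureIntegral hn).continuous.measurable.ennreal_ofReal).pow_const _
    -- The intervals `[1/(k+2), k+2]` exhaust `(0, ∞)`, and `x ↦ x^(1-p)` is continuous on `ℝ≥0∞`,
    -- so the bounds pass to the limit even when the integral is infinite.
    have hcov : AECover (volume.restrict (Set.Ioi (0 : ℝ))) Filter.atTop
        fun k : ℕ => Set.Icc ((k + 2 : ℝ)⁻¹) (k + 2 : ℝ) := by
      refine ⟨?_, fun _ => measurableSet_Icc⟩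
      filter_upwards [ae_restrict_mem measurableSet_Ioi] with t ht
      have ht' : 0 < t := ht
      obtain ⟨N, hN⟩ := exists_nat_ge (max t t⁻¹)
      filter_upwards [Filter.eventually_ge_atTop N] with k hk
      have hk' : (N : ℝ) ≤ k := by exact_mod_cast hk
      constructor
      · rw [inv_le_comm₀ (by positivity) ht']
        linarith [le_max_right t t⁻¹]
      · linarith [le_max_left t t⁻¹]
    have hlim := hcov.lintegral_tendsto_of_countably_generated hm.aemeasurable
    have hlim2 := ((ENNReal.continuous_rpow_const (y := 1 - p)).tendsto _).comp hlim
    refine ge_of_tendsto' hlim2 fun k => ?_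
    have hk : (k + 2 : ℝ)⁻¹ < k + 2 := by
      have : (1 : ℝ) < k + 2 := by have := Nat.cast_nonneg (α := ℝ) k; linarith
      exact (inv_lt_one_of_one_lt₀ this).trans this
    have h1 := hK.capacity_le_Icc hn hp hA (a := (k + 2 : ℝ)⁻¹) (b := k + 2) (by positivity) hk
    have h2 : Set.Icc ((k + 2 : ℝ)⁻¹) (k + 2 : ℝ) ∩ Set.Ioi 0 = Set.Icc ((k + 2 : ℝ)⁻¹) (k + 2 : ℝ) :=
      Set.inter_eq_left.2 fun t ht => lt_of_lt_of_le (by positivity) ht.1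
    simp only [Function.comp_apply]
    rwa [Measure.restrict_restrict measurableSet_Icc, h2]

end IsConvexBody

/-! ### Geodesic balls -/

theorem mem_geodesicBall {x y : Hyp n} {r : ℝ} (hr : 0 < r) :
    y ∈ geodesicBall x r ↔ -lorentz x.1 y.1 ≤ Real.cosh r := by
  have h1 : 1 ≤ -lorentz x.1 y.1 := by linarith [lorentz_hyp_le x y]
  change Real.arcosh _ ≤ r ↔ _
  conv_lhs => rw [← Real.arcosh_cosh hr.le]
  exact Real.arcosh_le_arcosh (by linarith) (Real.cosh_pos r)

/-- The function whose sublevel set is the geodesic ball. -/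
noncomputable def ballFunction (x : Hyp n) (r : ℝ) (y : Hyp n) : ℝ := -lorentz x.1 y.1 - Real.cosh r

theorem isSmooth_ballFunction (x : Hyp n) (r : ℝ) : IsSmooth (ballFunction x r) := by
  refine contDiff_iff_contDiffAt.2 fun y => ?_
  exact ((contDiffAt_const (c := x.1)).lorentz contDiff_graph.contDiffAt).neg.sub contDiffAt_const

theorem diff_ballFunction (x : Hyp n) (r : ℝ) {q : Hyp n} {w : Mink n} (hw : IsTangent q w) :
    diff (ballFunction x r) q w = -lorentz x.1 w := by
  have h1 := hasDerivAt_comp_coordLine ((isSmooth_ballFunction x r).differentiableAt q.1.1) w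
  have h2 := ((hasDerivAt_lorentz (hasDerivAt_const (0 : ℝ) x.1)
    (hasDerivAt_coordLine hw)).neg).sub_const (Real.cosh r)
  rw [lorentz_zero_left, add_zero] at h2
  exact h1.unique h2

theorem geodesicBall_eq (x : Hyp n) {r : ℝ} (hr : 0 < r) :
    geodesicBall x r = {y | ballFunction x r y ≤ 0} := by
  ext y
  rw [mem_geodesicBall hr, Set.mem_ofPred_eq, ballFunction, sub_nonpos]

theorem lorentz_of_mem_frontier_ball {x q : Hyp n} {r : ℝ} (hr : 0 < r)
    (hq : q ∈ frontier (geodesicBall x r)) : lorentz x.1 q.1 = -Real.cosh r := by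
  rw [geodesicBall_eq x hr] at hq
  have h := frontier_le_subset_eq (isSmooth_ballFunction x r).continuous continuous_const hq
  have h' : -lorentz x.1 q.1 - Real.cosh r = 0 := h
  linarith

theorem isDefiningFunctionAt_ball {x q : Hyp n} {r : ℝ} (hr : 0 < r)
    (hq : q ∈ frontier (geodesicBall x r)) :
    IsDefiningFunctionAt (geodesicBall x r) q (ballFunction x r) := by
  have h := lorentz_of_mem_frontier_ball hr hq
  have hs := Real.sinh_pos_iff.2 hr
  refine ⟨isSmooth_ballFunction x r, by rw [ballFunction, h]; ring,
    ⟨tangentPart q x.1, isTangent_tangentPart q x.1, ?_⟩, ?_⟩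
  · rw [diff_ballFunction x r (isTangent_tangentPart q x.1),
      ← lorentz_tangentPart (isTangent_tangentPart q x.1), lorentz_tangentPart_self,
      lorentz_hyp_self, h, neg_sq, Real.cosh_sq]
    have := pow_pos hs 2
    linarith
  · refine Filter.Eventually.of_forall fun y => ?_
    rw [geodesicBall_eq x hr]; rfl

theorem outwardNormal_ball {x q : Hyp n} {r : ℝ} (hr : 0 < r)
    (hq : q ∈ frontier (geodesicBall x r)) : outwardNormal (geodesicBall x r) q =
      (Real.sinh r)⁻¹ • (Real.cosh r • q.1 - x.1) := by
  have h := lorentz_of_mem_frontier_ball hr hq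
  have hs := Real.sinh_pos_iff.2 hr
  have h' : lorentz q.1 x.1 = -Real.cosh r := by rw [lorentz_comm, h]
  refine IsOutwardUnitNormal.eq ⟨?_, ?_, ballFunction x r, isDefiningFunctionAt_ball hr hq,
    Real.sinh r, hs, fun w hw => ?_⟩
  · rw [IsTangent, lorentz_smul_right, lorentz_sub_right, lorentz_smul_right, lorentz_hyp_self, h']
    ring
  · have := Real.cosh_sq r
    simp only [lorentz_smul_right, lorentz_smul_left, lorentz_sub_right, lorentz_sub_left,
      lorentz_hyp_self, h, h']
    field_simp
    linarith
  · have hw' : lorentz q.1 w = 0 := hw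
    rw [diff_ballFunction x r hw, lorentz_smul_left, lorentz_sub_left, lorentz_smul_left, hw']
    field_simp
    ring

/-- `-⟨x, y⟩ ≥ (x.2 - ‖x.1‖) ‖y.1‖`, so a bound on `-⟨x, y⟩` bounds the coordinates of `y`. -/
theorem isCompact_geodesicBall (x : Hyp n) {r : ℝ} (hr : 0 < r) :
    IsCompact (geodesicBall x r) := by
  have hx : 0 < x.1.2 - ‖x.1.1‖ := by
    rw [sub_pos, x.2]; exact Real.lt_sqrt_of_sq_lt (by linarith)
  have h1 : IsCompact (graph '' Metric.closedBall (0 : E n) (Real.cosh r / (x.1.2 - ‖x.1.1‖))) :=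
    (isCompact_closedBall _ _).image continuous_graph
  refine h1.of_isClosed_subset ?_ fun y hy => ⟨y.1.1, ?_, graph_coord y⟩
  · rw [geodesicBall_eq x hr]
    exact isClosed_le (isSmooth_ballFunction x r).continuous continuous_const
  · rw [mem_closedBall_zero_iff, le_div_iff₀ hx]
    have h2 := (mem_geodesicBall hr).1 hy
    have h3 := (abs_le.1 (abs_real_inner_le_norm x.1.1 y.1.1)).2
    have h4 : ‖y.1.1‖ ≤ y.1.2 := by
      rw [y.2]; exact (Real.lt_sqrt_of_sq_lt (by linarith)).le
    have h5 := mul_le_mul_of_nonneg_left h4 (hyp_snd_pos x).le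
    simp only [lorentz] at h2
    nlinarith

theorem isGeodesicallyConvex_geodesicBall (x : Hyp n) {r : ℝ} (hr : 0 < r) :
    IsGeodesicallyConvex (geodesicBall x r) := by
  rintro q hq v hv hv1 ρ hρ ⟨z, hz, hzρ⟩ s hs
  refine ⟨graph (geodesic q v s).1, ?_, graph_geodesic hv hv1 s⟩
  rw [mem_geodesicBall hr] at hq hz ⊢
  rw [graph_geodesic hv hv1, lorentz_comm, lorentz_geodesic_left]
  rw [hzρ, lorentz_comm, lorentz_geodesic_left] at hz
  rw [lorentz_comm] at hq
  set a := -lorentz q.1 x.1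
  set b := -lorentz v x.1
  have hz' : Real.cosh ρ * a + Real.sinh ρ * b ≤ Real.cosh r := by
    simp only [a, b]; linarith
  suffices h : Real.cosh s * a + Real.sinh s * b ≤ Real.cosh r by
    simp only [a, b] at h; linarith
  rcases hρ.eq_or_lt with h0 | h0
  · have : s = 0 := le_antisymm (h0 ▸ hs.2) hs.1
    simpa [this] using hq
  have hsρ := Real.sinh_pos_iff.2 h0
  have h1 : 0 ≤ Real.sinh s := Real.sinh_nonneg_iff.2 hs.1
  have h2 : 0 ≤ Real.sinh (ρ - s) := Real.sinh_nonneg_iff.2 (by linarith [hs.2])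
  -- The value at `s` is a combination of the values at the end points `0` and `ρ` with weights
  -- `sinh (ρ - s) / sinh ρ` and `sinh s / sinh ρ`. Their sum is at most `1`, which suffices since
  -- the bound `cosh r` is positive.
  have hid : Real.sinh ρ * (Real.cosh s * a + Real.sinh s * b) =
      Real.sinh (ρ - s) * a + Real.sinh s * (Real.cosh ρ * a + Real.sinh ρ * b) := by
    rw [Real.sinh_sub]; ring
  have hsum : Real.sinh (ρ - s) + Real.sinh s ≤ Real.sinh ρ := by
    have h3 : Real.sinh ρ = Real.sinh (ρ - s) * Real.cosh s + Real.cosh (ρ - s) * Real.sinh s := by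
      rw [← Real.sinh_add]; congr 1; ring
    have h4 := mul_le_mul_of_nonneg_left (Real.one_le_cosh s) h2
    have h5 := mul_le_mul_of_nonneg_right (Real.one_le_cosh (ρ - s)) h1
    linarith
  refine le_of_mul_le_mul_left ?_ hsρ
  rw [hid]
  have h3 := mul_le_mul_of_nonneg_left hq h2
  have h4 := mul_le_mul_of_nonneg_left hz' h1
  have h5 := mul_le_mul_of_nonneg_right hsum (Real.cosh_pos r).le
  linarith

theorem isConvexBody_geodesicBall (x : Hyp n) {r : ℝ} (hr : 0 < r) :
    IsConvexBody (geodesicBall x r) where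
  compact := isCompact_geodesicBall x hr
  convex := isGeodesicallyConvex_geodesicBall x hr
  smooth := fun _ hq => ⟨_, isDefiningFunctionAt_ball hr hq⟩
  nonempty := ⟨x, by
    rw [mem_geodesicBall hr, lorentz_hyp_self, neg_neg]; exact Real.one_le_cosh r⟩

/-- On the sphere the normal is `(cosh r • q - x) / sinh r`, affine in `q`, so its derivative is
multiplication by `coth r`. -/
theorem shapeOperator_ball (hn : 1 ≤ n) {x q : Hyp n} {r : ℝ} (hr : 0 < r)
    (hq : q ∈ frontier (geodesicBall x r)) :
    shapeOperator (geodesicBall x r) q = (Real.cosh r / Real.sinh r) • LinearMap.id := by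
  have hK := isConvexBody_geodesicBall x hr
  obtain ⟨U, φ, O, P, hφ, -, hqO, h⟩ := exists_patch hn hK.isClosed hK.smooth hq
  obtain ⟨hu, hφu⟩ := h q hq hqO
  obtain ⟨D, hD⟩ := hφ.exists_tangentEquiv hu hK.isClosed hK.smooth hn
  rw [← hφu]
  ext1 v
  have hv := hD (D.symm v)
  rw [D.apply_symm_apply] at hv
  refine Subtype.ext ?_
  rw [hφ.shapeOperator_apply hu hK.isClosed hK.smooth hn v hv]
  have h1 : (fun w => outwardNormal (geodesicBall x r) (φ w)) =ᶠ[𝓝 (P q.1.1)]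
      fun w => (Real.sinh r)⁻¹ • (Real.cosh r • (φ w).1 - x.1) := by
    filter_upwards [hφ.eventually_mem hu] with w hw using outwardNormal_ball hr (hφ.mapsTo hw)
  have h2 := (((hφ.hasFDerivAt hu).const_smul (Real.cosh r)).sub_const x.1).const_smul (Real.sinh r)⁻¹
  have h3 := (h2.congr_of_eventuallyEq h1).fderiv
  rw [h3]
  change (Real.sinh r)⁻¹ • (Real.cosh r • fderiv ℝ (fun w => (φ w).1) (P q.1.1) (D.symm v)) =
    (Real.cosh r / Real.sinh r) • v.1
  rw [← hv, smul_smul, div_eq_inv_mul]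

theorem jac_ball (hn : 1 ≤ n) {x q : Hyp n} {r : ℝ} (hr : 0 < r)
    (hq : q ∈ frontier (geodesicBall x r)) {t : ℝ} (ht : 0 < t) : jac (geodesicBall x r) q t =
      (Real.cosh t + Real.sinh t * (Real.cosh r / Real.sinh r)) ^ (n - 1) := by
  have hK := isConvexBody_geodesicBall x hr
  rw [hK.jac_eq_det hn hq ht, shapeOperator_ball hn hr hq, smul_smul, ← add_smul, LinearMap.det_smul,
    LinearMap.det_id, mul_one, hK.finrank_boundaryTangent hn hq]

/-! ### The lower bound -/

/-- Hölder's inequality for the factorization `G = (J^(1/p) G) · J^(-1/p)`, raised to the power `p`.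
-/
theorem rpow_lintegral_le {p : ℝ} (hp : 1 < p) {α : Type*} [MeasurableSpace α] {μ : Measure α}
    {J G : α → ℝ≥0∞} (hJ : Measurable J) (hG : AEMeasurable G μ) (hJ0 : ∀ t, J t ≠ 0)
    (hJt : ∀ t, J t ≠ ⊤) (h1 : 1 ≤ ∫⁻ t, G t ∂μ) :
    (∫⁻ t, J t ^ (-1 / (p - 1)) ∂μ) ^ (1 - p) ≤ ∫⁻ t, J t * G t ^ p ∂μ := by
  have hp0 : 0 < p := zero_lt_one.trans hp
  have hp1 : 0 < p - 1 := by linarith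
  have hpq : p.HolderConjugate (p / (p - 1)) := Real.HolderConjugate.conjExponent hp
  have h2 := ENNReal.lintegral_mul_le_Lp_mul_Lq μ hpq (f := fun t => J t ^ (1 / p) * G t)
    (g := fun t => J t ^ (-(1 / p))) ((hJ.pow_const _).aemeasurable.mul hG)
    (hJ.pow_const _).aemeasurable
  have e1 (t : α) : ((fun t => J t ^ (1 / p) * G t) * fun t => J t ^ (-(1 / p))) t = G t := by
    simp only [Pi.mul_apply]
    rw [mul_right_comm, ← ENNReal.rpow_add _ _ (hJ0 t) (hJt t), add_neg_cancel, ENNReal.rpow_zero,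
      one_mul]
  have e2 (t : α) : (J t ^ (1 / p) * G t) ^ p = J t * G t ^ p := by
    rw [ENNReal.mul_rpow_of_nonneg _ _ hp0.le, ← ENNReal.rpow_mul, one_div_mul_cancel hp0.ne',
      ENNReal.rpow_one]
  have e3 (t : α) : (J t ^ (-(1 / p))) ^ (p / (p - 1)) = J t ^ (-1 / (p - 1)) := by
    rw [← ENNReal.rpow_mul]
    congr 1
    field_simp
  simp only [e1, e2, e3] at h2
  have h3 := ENNReal.rpow_le_rpow (h1.trans h2) hp0.le
  rw [ENNReal.one_rpow, ENNReal.mul_rpow_of_nonneg _ _ hp0.le, ← ENNReal.rpow_mul,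
    ← ENNReal.rpow_mul, one_div_mul_cancel hp0.ne', ENNReal.rpow_one,
    show 1 / (p / (p - 1)) * p = p - 1 by field_simp] at h3
  rw [show 1 - p = -(p - 1) by ring, ENNReal.rpow_neg, ← one_div]
  exact ENNReal.div_le_of_le_mul h3

namespace IsConvexBody

variable {K : Set (Hyp n)} (hK : IsConvexBody K)
include hK

/-- Along the normal geodesic `f` falls from `1` at `q` to `0` outside its support, and the geodesic
has unit speed, so the gradient dominates the derivative. -/
theorem one_le_lintegral_gradNorm {f : Hyp n → ℝ} (hf : IsSmooth f) (hfc : HasCompactSupport f)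
    (hf1 : ∀ x ∈ K, f x = 1) {q : Hyp n} (hq : q ∈ frontier K) :
    1 ≤ ∫⁻ t in Set.Ioi (0 : ℝ), ENNReal.ofReal (gradNorm f (normalExp K q t)) := by
  obtain ⟨T, hT⟩ := (hfc.isCompact.image hK.continuous_distTo).bddAbove
  have hT0 (t : ℝ) (ht : 0 ≤ t) (htT : T < t) : f (normalExp K q t) = 0 := by
    by_contra h
    have := hT ⟨_, subset_tsupport f h, rfl⟩
    rw [hK.distTo_normalExp hq ht] at this
    linarith
  set N := outwardNormal K q
  have hu : ContDiff ℝ ∞ fun t : ℝ => f (normalExp K q t) := by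
    have h1 : ContDiff ℝ ∞ fun t : ℝ => (geodesic q N t).1 :=
      (Real.contDiff_cosh.smul contDiff_const).add (Real.contDiff_sinh.smul contDiff_const)
    exact ContDiff.comp (g := fun x : E n => f (graph x)) hf h1
  have hd (t : ℝ) : deriv (fun t : ℝ => f (normalExp K q t)) t =
      diff f (normalExp K q t) (Real.sinh t • q.1 + Real.cosh t • N) := by
    have h1 : HasDerivAt (fun t => (geodesic q N t).1) (Real.sinh t • q.1 + Real.cosh t • N).1 t :=
      ((Real.hasDerivAt_cosh t).smul_const q.1.1).add ((Real.hasDerivAt_sinh t).smul_const N.1)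
    exact ((hf.differentiableAt (geodesic q N t).1).hasFDerivAt.comp_hasDerivAt t h1).deriv
  set S := max T 0 + 1 with hS
  have hS0 : 0 < S := by have := le_max_right T 0; linarith
  have hST : T < S := by have := le_max_left T 0; linarith
  have hint : ∫ t in (0)..S, deriv (fun t : ℝ => f (normalExp K q t)) t = -1 := by
    rw [intervalIntegral.integral_deriv_eq_sub (fun t _ => hu.differentiable (by simp) t)
      ((hu.continuous_deriv (by simp)).intervalIntegrable _ _), hT0 S hS0.le hST]
    have : normalExp K q 0 = q := by simp [normalExp, geodesic, graph_coord]
    rw [this, hf1 q (hK.frontier_subset hq)]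
    norm_num
  rw [intervalIntegral.integral_of_le hS0.le] at hint
  have h1 := enorm_integral_le_lintegral_enorm (μ := volume.restrict (Set.Ioc 0 S))
    (deriv fun t : ℝ => f (normalExp K q t))
  rw [hint] at h1
  calc (1 : ℝ≥0∞) = ‖(-1 : ℝ)‖ₑ := by simp
    _ ≤ _ := h1
    _ ≤ ∫⁻ t in Set.Ioc 0 S, ENNReal.ofReal (gradNorm f (normalExp K q t)) := by
        refine lintegral_mono fun t => ?_
        rw [Real.enorm_eq_ofReal_abs, hd]
        obtain ⟨h2, h3⟩ := hK.velocity_normalExp hq t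
        exact ENNReal.ofReal_le_ofReal (abs_diff_le_gradNorm h2 h3)
    _ ≤ _ := lintegral_mono_set fun t ht => ht.1

/-- If the Jacobian of the normal exponential map does not depend on the foot point, then the
upper bound for the capacity is also a lower bound. -/
theorem le_capacity (hn : 1 ≤ n) {p : ℝ} (hp : 1 < p) {j : ℝ → ℝ} (hjc : Continuous j)
    (hj : ∀ q ∈ frontier K, ∀ t, 0 < t → jac K q t = j t) :
    (∫⁻ t in Set.Ioi (0 : ℝ), ENNReal.ofReal (curvatureIntegral K t) ^ (-1 / (p - 1))) ^ (1 - p) ≤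
      capacity p K := by
  have hp1 : 0 < p - 1 := by linarith
  have hneg : -1 / (p - 1) < 0 := div_neg_of_neg_of_pos (by norm_num) hp1
  have := hK.isFiniteMeasure_areaMeasure hn
  set μ := areaMeasure (frontier K) with hμ
  -- Taking the maximum with `1` leaves `j` unchanged at positive times as soon as `∂K` has a point,
  -- and makes the weight nonzero on all of `ℝ`, as `rpow_lintegral_le` demands.
  have hA (t : ℝ) (ht : t ∈ Set.Ioi (0 : ℝ)) :
      ENNReal.ofReal (curvatureIntegral K t) = μ Set.univ * ENNReal.ofReal (max 1 (j t)) := by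
    rw [hK.ofReal_curvatureIntegral hn ht, mul_comm, ← lintegral_const]
    refine lintegral_congr_ae ?_
    filter_upwards [hK.ae_mem_frontier hn] with q hq
    rw [← hj q hq t ht, max_eq_right (hK.one_le_jac hn hq ht)]
  -- With zero area the integrand is `0` to a negative power, that is `⊤`; the integral is `⊤` and
  -- its power `1 - p` is `0`.
  rcases eq_or_ne (μ Set.univ) 0 with h0 | h0
  · have h1 : ∫⁻ t in Set.Ioi (0 : ℝ), ENNReal.ofReal (curvatureIntegral K t) ^ (-1 / (p - 1)) =
        ⊤ := by
      rw [setLIntegral_congr_fun (g := fun _ => ⊤) measurableSet_Ioi fun t ht => by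
        simp only [hA t ht, h0, zero_mul, ENNReal.zero_rpow_of_neg hneg]]
      simp
    rw [h1, ENNReal.top_rpow_of_neg (by linarith)]
    exact zero_le
  have ht : μ Set.univ ≠ ⊤ := measure_ne_top μ _
  set J : ℝ → ℝ≥0∞ := fun t => ENNReal.ofReal (max 1 (j t)) with hJ
  have hJm : Measurable J := (measurable_const.max hjc.measurable).ennreal_ofReal
  have hJ0 (t : ℝ) : J t ≠ 0 := by
    simp [hJ]
  have hJt (t : ℝ) : J t ≠ ⊤ := ENNReal.ofReal_ne_top
  -- The area is a constant factor of `A`, and `(-1 / (p - 1)) (1 - p) = 1`, so it comes out with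
  -- exponent one.
  have hY : (∫⁻ t in Set.Ioi (0 : ℝ),
      ENNReal.ofReal (curvatureIntegral K t) ^ (-1 / (p - 1))) ^ (1 - p) =
      μ Set.univ * (∫⁻ t in Set.Ioi (0 : ℝ), J t ^ (-1 / (p - 1))) ^ (1 - p) := by
    have h1 : ∀ t ∈ Set.Ioi (0 : ℝ), ENNReal.ofReal (curvatureIntegral K t) ^ (-1 / (p - 1)) =
        μ Set.univ ^ (-1 / (p - 1)) * J t ^ (-1 / (p - 1)) := fun t h => by
      rw [hA t h, ENNReal.mul_rpow_of_ne_top ht (hJt t)]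
    have h2 : μ Set.univ ^ (-1 / (p - 1)) ≠ 0 := by simp [ENNReal.rpow_eq_zero_iff, h0, ht]
    have h3 : μ Set.univ ^ (-1 / (p - 1)) ≠ ⊤ := by simp [ENNReal.rpow_eq_top_iff, h0, ht]
    rw [setLIntegral_congr_fun measurableSet_Ioi h1, lintegral_const_mul _ (hJm.pow_const _),
      ENNReal.mul_rpow_eq_ite, if_neg (by simp [h2, h3]), ← ENNReal.rpow_mul,
      show -1 / (p - 1) * (1 - p) = 1 by field_simp; ring, ENNReal.rpow_one]
  rw [hY]
  refine le_iInf₂ fun f hf => ?_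
  obtain ⟨hfs, hfc, hf1⟩ := hf
  have hg : Measurable fun y => ENNReal.ofReal (gradNorm f y) ^ p :=
    hfs.continuous_gradNorm.measurable.ennreal_ofReal.pow_const p
  -- The energy inside `K` is discarded; the rest is integrated along normal geodesics and bounded
  -- below on each of them separately.
  refine le_trans ?_ (setLIntegral_le_lintegral Kᶜ _)
  rw [hK.lintegral_exterior hn hg, mul_comm, ← lintegral_const]
  refine lintegral_mono_ae ?_
  filter_upwards [hK.ae_mem_frontier hn] with q hq
  rw [fiberIntegral_of_mem _ hq]
  have hcont : Continuous (normalExp K q) := by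
    refine continuous_graph.comp (continuous_fst.comp ?_)
    unfold geodesic
    fun_prop
  have h1 := rpow_lintegral_le hp hJm
    ((hfs.continuous_gradNorm.comp hcont).measurable.ennreal_ofReal.aemeasurable) hJ0 hJt
    (hK.one_le_lintegral_gradNorm hfs hfc hf1 hq)
  refine h1.trans_eq (setLIntegral_congr_fun measurableSet_Ioi fun t ht => ?_)
  simp only [hJ, Function.comp_apply, hj q hq t ht]
  rw [max_eq_right]
  rw [← hj q hq t ht]
  exact hK.one_le_jac hn hq ht

end IsConvexBody

/-! ### The empty set and the conclusion. -/

theorem capacity_empty {p : ℝ} (hp : 0 < p) : capacity p (∅ : Set (Hyp n)) = 0 := by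
  refine le_antisymm ?_ zero_le
  refine (iInf₂_le (fun _ => 0) ⟨contDiff_const, HasCompactSupport.zero, by simp⟩).trans ?_
  have h (x : Hyp n) : gradNorm (fun _ : Hyp n => (0 : ℝ)) x ≤ 0 :=
    gradNorm_le fun v _ _ => by simp [diff]
  simp [ENNReal.ofReal_of_nonpos (h _), ENNReal.zero_rpow_of_pos hp]

end HypCap

theorem theorem4 (n : ℕ) (hn : 2 ≤ n) (p : ℝ) (hp : 1 < p) :
    (∀ K : Set (HypCap.Hyp n), IsCompact K → HypCap.IsGeodesicallyConvex K →
      HypCap.HasSmoothBoundary K →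
      HypCap.capacity p K ≤
        (∫⁻ t in Set.Ioi (0 : ℝ),
          ENNReal.ofReal (HypCap.curvatureIntegral K t) ^ (-1 / (p - 1))) ^ (1 - p)) ∧
    (∀ (x : HypCap.Hyp n) (r : ℝ), 0 < r →
      HypCap.capacity p (HypCap.geodesicBall x r) =
        (∫⁻ t in Set.Ioi (0 : ℝ),
          ENNReal.ofReal (HypCap.curvatureIntegral (HypCap.geodesicBall x r) t) ^
            (-1 / (p - 1))) ^ (1 - p)) := by
  have hn1 : 1 ≤ n := one_le_two.trans hn
  refine ⟨fun K hc hg hs => ?_, fun x r hr => ?_⟩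
  -- The empty set has no nearest points and is excluded from `IsConvexBody`; its capacity is zero,
  -- so the bound is trivial.
  · rcases K.eq_empty_or_nonempty with rfl | hne
    · rw [HypCap.capacity_empty (zero_lt_one.trans hp)]
      exact zero_le
    · exact HypCap.IsConvexBody.capacity_le ⟨hc, hg, hs, hne⟩ hn1 hp
  · have hK := HypCap.isConvexBody_geodesicBall x hr
    refine le_antisymm (hK.capacity_le hn1 hp) (hK.le_capacity hn1 hp
      (j := fun t => (Real.cosh t + Real.sinh t * (Real.cosh r / Real.sinh r)) ^ (n - 1)) ?_
      fun q hq t ht => HypCap.jac_ball hn1 hr hq ht)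
    fun_prop
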